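/- A flat manifold is a compact connected smooth Riemannian manifold $X$ without boundary whose sectional curvatures are all zero. Its fundamental group is an extension $0\to L\to\pi_1(X)\to G\to 1$, where $L\cong\mathbb Z^{\dim X}$ is the unique maximal abelian subgroup of finite index. The finite group $G$ is the holonomy group of $X$, and the action of $G$ on $L$ by conjugation in $\pi_1(X)$ is its holonomy representation. An irreducible $\mathbb R G$-module $V$ is of quaternionic type if $\operatorname{End}_{\mathbb R G}(V)\cong\mathbb H$. A class in $H^2(G,L)$ is special if its restriction to every non-trivial cyclic subgroup of $G$ is non-zero. **Theorem.** There is a flat manifold of dimension $48$ such that every irreducible $\mathbb R G$-submodule of $\mathbb R\otimes_{\mathbb Z}L$ is of quaternionic type, and every irreducible $\mathbb C G$-submodule of $\mathbb C\otimes_{\mathbb Z}L$ has Frobenius–Schur indicator $-1$. Explicitly, it can be obtained as follows. *The group.* $G$ is generated by $a,b,c,d$ subject to $a^4=b^4=1$, $a^2=c^2$, $b^2=d^2$, $a^2$ and $b^2$ central, $[a,b]=a^2$, $[a,c]=a^2b^2$, $[a,d]=b^2$, $[b,c]=a^2$, $[b,d]=a^2b^2$, $[c,d]=1$ (this is $\mathrm{SmallGroup}(64,245)$).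 It has order $64$, the elements $a,b,c,d$ have order $4$, its centre $Z(G)=\langle a^2,b^2\rangle$ is isomorphic to $C_2^2$, and $G/Z(G)\cong C_2^4$. Put $z_1=a^2$, $z_2=b^2$, $z_3=a^2b^2$ and let $\chi_i:G\to\mathbb Z$ be the function with value $4$ on $\{1,z_i\}$, value $-4$ on $Z(G)\setminus\{1,z_i\}$ and value $0$ off $Z(G)$. There are automorphisms $f_2,f_3$ of $G$ with $\chi_2=\chi_1\circ f_2$ and $\chi_3=\chi_1\circ f_3$. *The lattice.* For a permutation $s$ let $P_s$ be the permutation matrix with entries $1$ at the positions $(i,s(i))$, and let $P_s^{R}$ be obtained from it by multiplying the rows in $R$ by $-1$. There is a representation $\rho_1:G\to \mathrm{GL}_{32}(\mathbb Z)$ with - $a\mapsto P_{(1\,13)(2\,14)(3\,9)(4\,10)(5\,21)(6\,22)(7\,11)(8\,12)(15\,24)(16\,23)(17\,26)(18\,25)(19\,27)(20\,28)(29\,31)(30\,32)}$, - $b\mapsto P_{(1\,3\,2\,4)(5\,18\,6\,17)(7\,15\,8\,16)(9\,14\,10\,13)(11\,24\,12\,23)(19\,30\,20\,29)(21\,25\,22\,26)(27\,32\,28\,31)}$,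 - $c\mapsto P_{(1\,5)(2\,6)(3\,18)(4\,17)(7\,20)(8\,19)(9\,26)(10\,25)(11\,27)(12\,28)(13\,22)(14\,21)(15\,29)(16\,30)(23\,31)(24\,32)}$, - $d\mapsto P_{(1\,8\,2\,7)(3\,15\,4\,16)(5\,19\,6\,20)(9\,23\,10\,24)(11\,14\,12\,13)(17\,30\,18\,29)(21\,28\,22\,27)(25\,32\,26\,31)}$, and its module is isomorphic to the permutation module $\mathbb Z[G/\langle a^2\rangle]$. The vectors $e_1-e_2,e_3-e_4,\dots,e_{31}-e_{32}$ are a $\mathbb Z$-basis of the $G$-sublattice $M=\{v\in\mathbb Z^{32}: nv\in \operatorname{im}\sum_{g\in G}\chi_1(g)\rho_1(g)\text{ for some integer } n\ne0\}$, which has character $4\chi_1$. In this basis $G$ acts on $M=\mathbb Z^{16}$ by the representation $\rho_M$ with - $a\mapsto P^{8,9,12,13}_{(1\,7)(2\,5)(3\,11)(4\,6)(8\,12)(9\,13)(10\,14)(15\,16)}$, - $b\mapsto P^{2,3,5,6,8,10,13,14}_{(1\,2)(3\,9)(4\,8)(5\,7)(6\,12)(10\,15)(11\,13)(14\,16)}$,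 - $c\mapsto P^{2,4,5,7,9,10,11,13}_{(1\,3)(2\,9)(4\,10)(5\,13)(6\,14)(7\,11)(8\,15)(12\,16)}$, - $d\mapsto P^{1,6,8,9,10,11,12,13}_{(1\,4)(2\,8)(3\,10)(5\,12)(6\,7)(9\,15)(11\,14)(13\,16)}$. *The class.* There is a 1-cocycle $\hat\alpha:G\to\mathbb Q^{16}/\mathbb Z^{16}$, $\hat\alpha(gh)=\hat\alpha(g)+\rho_M(g)\hat\alpha(h)$, with - $a\mapsto\tfrac12(0,1,0,0,0,1,1,1,1,0,1,0,0,1,1,0)$, - $b\mapsto\tfrac12(0,0,0,1,0,1,0,1,0,1,0,1,0,1,1,1)$, - $c\mapsto\tfrac12(0,1,1,0,0,1,1,1,0,1,0,0,1,0,0,1)$, - $d\mapsto 0$. Let $\alpha\in H^2(G,M)$ be the image of its class under the connecting homomorphism $H^1(G,\mathbb Q^{16}/\mathbb Z^{16})\to H^2(G,\mathbb Z^{16})$. *The manifold.* Let $f_2,f_3$ be any automorphisms as above. Write $M^{f}$ for $M$ with $g$ acting as $f(g)$. Then $L=M\oplus M^{f_2}\oplus M^{f_3}$ has rank $48$ and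 character $4(\chi_1+\chi_2+\chi_3)$, all irreducible submodules of $\mathbb R\otimes_{\mathbb Z} L$ are of quaternionic type, and those of $\mathbb C\otimes_{\mathbb Z} L$ have Frobenius–Schur indicator $-1$. The class $\alpha+f_2^*(\alpha)+f_3^*(\alpha)\in H^2(G,L)$ is special. There is a flat manifold $X$ of dimension $48$ with holonomy group $G$ and holonomy representation $L$ whose fundamental group is torsion-free and is the extension of $G$ by $L$ belonging to this class. -/

import Mathlib

open scoped Manifold ContDiff TensorProduct Quaternion
open scoped commutatorElement
open CategoryTheory

noncomputable section

/-! ## Flat Riemannian manifolds -/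

namespace FlatQuat

section Riemannian

variable {n : ℕ} {X : Type} [TopologicalSpace X] [ChartedSpace (EuclideanSpace ℝ (Fin n)) X]
  [IsManifold (𝓡 n) ∞ X]

/-- The `i`-th partial derivative of a real function on `ℝⁿ`. -/
def partialDeriv (i : Fin n) (f : EuclideanSpace ℝ (Fin n) → ℝ)
    (y : EuclideanSpace ℝ (Fin n)) : ℝ :=
  fderiv ℝ f y (EuclideanSpace.single i 1)

/-- The matrix `g_{ij}` of a Riemannian metric in the coordinates given by a chart `φ`:
`g_{ij}(y) = g(∂_i, ∂_j)` at the point `φ⁻¹(y)`. -/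
def metricMatrix
    (g : Bundle.ContMDiffRiemannianMetric (𝓡 n) ∞ (EuclideanSpace ℝ (Fin n))
      (fun x : X => TangentSpace (𝓡 n) x))
    (φ : OpenPartialHomeomorph X (EuclideanSpace ℝ (Fin n)))
    (y : EuclideanSpace ℝ (Fin n)) : Matrix (Fin n) (Fin n) ℝ :=
  Matrix.of fun i j =>
    g.inner (φ.symm y)
      (mfderiv (𝓡 n) (𝓡 n) φ.symm y (EuclideanSpace.single i (1 : ℝ)))
      (mfderiv (𝓡 n) (𝓡 n) φ.symm y (EuclideanSpace.single j (1 : ℝ)))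

/-- The Christoffel symbols `Γ^l_{ij}` of a metric `G = (g_{ij})` on a domain of `ℝⁿ`. -/
def christoffel (G : EuclideanSpace ℝ (Fin n) → Matrix (Fin n) (Fin n) ℝ) (l i j : Fin n)
    (y : EuclideanSpace ℝ (Fin n)) : ℝ :=
  (1 / 2) * ∑ m, (G y)⁻¹ l m *
    (partialDeriv i (fun z => G z j m) y + partialDeriv j (fun z => G z i m) y
      - partialDeriv m (fun z => G z i j) y)

/-- The curvature tensor: `R(∂_i, ∂_j) ∂_k = ∑_l R^l_{ijk} ∂_l`. -/
def riemannTensor (G : EuclideanSpace ℝ (Fin n) → Matrix (Fin n) (Fin n) ℝ) (l i j k : Fin n)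
    (y : EuclideanSpace ℝ (Fin n)) : ℝ :=
  partialDeriv i (christoffel G l j k) y - partialDeriv j (christoffel G l i k) y
    + ∑ m, (christoffel G l i m y * christoffel G m j k y
      - christoffel G l j m y * christoffel G m i k y)

/-- The sectional curvature `⟨R(u,v)v, u⟩ / (⟨u,u⟩⟨v,v⟩ - ⟨u,v⟩²)` of the plane spanned by
`u` and `v`, in coordinates. -/
def sectionalCurvature (G : EuclideanSpace ℝ (Fin n) → Matrix (Fin n) (Fin n) ℝ)
    (y : EuclideanSpace ℝ (Fin n)) (u v : Fin n → ℝ) : ℝ :=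
  (∑ i, ∑ j, ∑ k, ∑ l, ∑ m, G y l m * riemannTensor G l i j k y * u i * v j * v k * u m) /
    ((u ⬝ᵥ (G y).mulVec u) * (v ⬝ᵥ (G y).mulVec v) - (u ⬝ᵥ (G y).mulVec v) ^ 2)

/-- A Riemannian metric is flat if all its sectional curvatures vanish. (The sectional curvature
does not depend on the coordinates in which it is computed, so that it is enough to compute it in
the charts of the given atlas.) -/
def IsFlat (g : Bundle.ContMDiffRiemannianMetric (𝓡 n) ∞ (EuclideanSpace ℝ (Fin n))
      (fun x : X => TangentSpace (𝓡 n) x)) : Prop :=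
  ∀ φ ∈ atlas (EuclideanSpace ℝ (Fin n)) X, ∀ y ∈ φ.target, ∀ u v : Fin n → ℝ,
    LinearIndependent ℝ ![u, v] → sectionalCurvature (metricMatrix g φ) y u v = 0

end Riemannian

/-- A flat manifold of dimension `n`: a compact connected smooth Riemannian manifold without
boundary all of whose sectional curvatures are zero. -/
structure FlatManifold (n : ℕ) where
  carrier : Type
  [topology : TopologicalSpace carrier]
  [charts : ChartedSpace (EuclideanSpace ℝ (Fin n)) carrier]
  [smooth : IsManifold (𝓡 n) ∞ carrier]
  [hausdorff : T2Space carrier]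
  [compact : CompactSpace carrier]
  [connected : ConnectedSpace carrier]
  metric : Bundle.ContMDiffRiemannianMetric (𝓡 n) ∞ (EuclideanSpace ℝ (Fin n))
    (fun x : carrier => TangentSpace (𝓡 n) x)
  flat : IsFlat metric

attribute [instance] FlatManifold.topology

/-! ## Representations of quaternionic type -/

section Representations

variable {G : Type} [Group G]

/-- The representation on `K ⊗ L` obtained from a representation on the `k`-module `L`. -/
def extendScalars {k : Type} [CommRing k] (K : Type) [Field K] [Algebra k K] {L : Type}
    [AddCommGroup L] [Module k L] (ρ : Representation k G L) :
    Representation K G (K ⊗[k] L) :=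
  (Module.End.baseChangeHom k K L : Module.End k L →* Module.End K (K ⊗[k] L)).comp ρ

/-- A real representation has only summands of quaternionic type if the endomorphism algebra of
each of its irreducible subrepresentations is isomorphic to the quaternions. -/
def IsOfQuaternionicType {V : Type} [AddCommGroup V] [Module ℝ V]
    (σ : Representation ℝ G V) : Prop :=
  ∀ W : Subrepresentation σ, W.toRepresentation.IsIrreducible →
    Nonempty (W.toRepresentation.IntertwiningMap W.toRepresentation ≃ₐ[ℝ] ℍ[ℝ])

/-- The Frobenius–Schur indicator `|G|⁻¹ ∑_g χ(g²)` of the character of a complex representation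
of a finite group. -/
def frobeniusSchur {V : Type} [AddCommGroup V] [Module ℂ V] (σ : Representation ℂ G V) : ℂ :=
  (Nat.card G : ℂ)⁻¹ * ∑ᶠ g : G, σ.character (g ^ 2)

end Representations

/-! ## Cohomology classes and extensions -/

section Cohomology

variable {k G : Type} [CommRing k] [Group G]

open groupCohomology

/-- The pull-back `H²(G, A) → H²(H, A)` along a homomorphism `f : H → G`, where `H` acts on `A`
through `f`. -/
def pullback {H : Type} [Group H] (f : H →* G) (A : Rep.{0} k G) (α : H2 A) : H2 (Rep.res f A) :=
  groupCohomology.map f (𝟙 (Rep.res f A)) 2 α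

/-- The map `H²(G, A) → H²(G, B)` induced by a homomorphism of `G`-modules `A → B`. -/
def pushforward {A B : Rep.{0} k G} (φ : A ⟶ B) (α : H2 A) : H2 B :=
  groupCohomology.map (MonoidHom.id G) φ 2 α

/-- A class in `H²(G, A)` is special if its restriction to every non-trivial cyclic subgroup is
non-zero. -/
def IsSpecial {A : Rep.{0} k G} (α : H2 A) : Prop :=
  ∀ C : Subgroup G, C ≠ ⊥ → IsCyclic C → pullback C.subtype A α ≠ 0

/-- `x ↦ A x` for an integral matrix `A` and a vector `x` with entries in an abelian group. -/
def intMulVec {m : ℕ} {Q : Type} [AddCommGroup Q] (A : Matrix (Fin m) (Fin m) ℤ)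
    (x : Fin m → Q) : Fin m → Q :=
  fun i => ∑ j, A i j • x j

/-- `γ : G → ℚᵐ/ℤᵐ` is a 1-cocycle, where `G` acts on `ℤᵐ` by `ρ`. -/
def IsCocycle {m : ℕ} (ρ : Representation ℤ G (Fin m → ℤ))
    (γ : G → Fin m → AddCircle (1 : ℚ)) : Prop :=
  ∀ g h, γ (g * h) = γ g + intMulVec (LinearMap.toMatrix' (ρ g)) (γ h)

/-- The class `α ∈ H²(G, ℤᵐ)` is the image of the class of the 1-cocycle `γ : G → ℚᵐ/ℤᵐ` under the
connecting homomorphism `H¹(G, ℚᵐ/ℤᵐ) → H²(G, ℤᵐ)`: for a lift `s : G → ℚᵐ` of `γ`, the class `α`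
is represented by the 2-cocycle `(g, h) ↦ g • s(h) - s(gh) + s(g)`. -/
def IsConnectingImage {m : ℕ} (ρ : Representation ℤ G (Fin m → ℤ))
    (γ : G → Fin m → AddCircle (1 : ℚ)) (α : H2 (Rep.of ρ)) : Prop :=
  ∃ (s : G → Fin m → ℚ) (c : cocycles₂ (Rep.of ρ)),
    (∀ g i, (s g i : AddCircle (1 : ℚ)) = γ g i) ∧
    (∀ (g h : G) (i : Fin m), (((c (g, h) : Fin m → ℤ) i : ℤ) : ℚ) =
      intMulVec (LinearMap.toMatrix' (ρ g)) (s h) i - s (g * h) i + s g i) ∧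
    H2π (Rep.of ρ) c = α

/-- The extension `0 → L → Γ → G → 1` induces the given action of `G` on `L`: for `γ ∈ Γ` over
`g ∈ G` and `z ∈ L` one has `g • z = γ z γ⁻¹`. -/
def InducesAction {Γ L : Type} [Group Γ] [AddCommGroup L] [Module k L]
    (S : GroupExtension (Multiplicative L) Γ G) (ρ : Representation k G L) : Prop :=
  ∀ (γ : Γ) (z : L), S.inl (Multiplicative.ofAdd (ρ (S.rightHom γ) z)) =
    γ * S.inl (Multiplicative.ofAdd z) * γ⁻¹

/-- The extension `0 → L → Γ → G → 1` belongs to the class `β ∈ H²(G, L)`: for a section `σ`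
one has `σ(g) σ(h) = c(g, h) σ(gh)` with a 2-cocycle `c` of class `β`. -/
def HasClass {Γ L : Type} [Group Γ] [AddCommGroup L] [Module k L]
    (S : GroupExtension (Multiplicative L) Γ G) {ρ : Representation k G L}
    (β : H2 (Rep.of ρ)) : Prop :=
  ∃ (σ : S.Section) (c : cocycles₂ (Rep.of ρ)),
    (∀ g h, σ g * σ h = S.inl (Multiplicative.ofAdd (c (g, h) : L)) * σ (g * h)) ∧
    H2π (Rep.of ρ) c = β

/-- `T` is the unique maximal abelian subgroup of finite index of `Γ`. -/
def IsTranslationSubgroup {Γ : Type} [Group Γ] (T : Subgroup Γ) : Prop :=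
  IsGreatest {B : Subgroup Γ | IsMulCommutative B ∧ B.FiniteIndex} T

/-- A group is torsion-free if its only element of finite order is the identity. -/
def IsTorsionFreeGroup (Γ : Type) [Group Γ] : Prop :=
  ∀ γ : Γ, IsOfFinOrder γ → γ = 1

end Cohomology

/-! ## The group -/

/-- The relations `a⁴ = b⁴ = 1`, `a² = c²`, `b² = d²`, `[a,b] = a²`, `[a,c] = a²b²`, `[a,d] = b²`,
`[b,c] = a²`, `[b,d] = a²b²`, `[c,d] = 1` and the centrality of `a²` and `b²`, where `a, b, c, d`
are the generators `0, 1, 2, 3`. -/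
def relators : Set (FreeGroup (Fin 4)) :=
  let a := FreeGroup.of (0 : Fin 4)
  let b := FreeGroup.of (1 : Fin 4)
  let c := FreeGroup.of (2 : Fin 4)
  let d := FreeGroup.of (3 : Fin 4)
  {a ^ 4, b ^ 4, a ^ 2 * (c ^ 2)⁻¹, b ^ 2 * (d ^ 2)⁻¹,
    ⁅a, b⁆ * (a ^ 2)⁻¹, ⁅a, c⁆ * (a ^ 2 * b ^ 2)⁻¹, ⁅a, d⁆ * (b ^ 2)⁻¹,
    ⁅b, c⁆ * (a ^ 2)⁻¹, ⁅b, d⁆ * (a ^ 2 * b ^ 2)⁻¹, ⁅c, d⁆,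
    ⁅a ^ 2, b⁆, ⁅a ^ 2, c⁆, ⁅a ^ 2, d⁆, ⁅b ^ 2, a⁆, ⁅b ^ 2, c⁆, ⁅b ^ 2, d⁆}

/-- The group `G` of order 64, which is `SmallGroup(64,245)`. -/
abbrev G64 : Type := PresentedGroup relators

namespace G64

/-- The generator `a`. -/
def a : G64 := PresentedGroup.of 0
/-- The generator `b`. -/
def b : G64 := PresentedGroup.of 1
/-- The generator `c`. -/
def c : G64 := PresentedGroup.of 2
/-- The generator `d`. -/
def d : G64 := PresentedGroup.of 3

end G64

open Classical in
/-- The function on `G` that is `4` on `{1, z}`, `-4` on the other elements of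
`{1, a², b², a²b²}`, and `0` elsewhere. -/
def chi (z : G64) (g : G64) : ℤ :=
  if g = 1 ∨ g = z then 4
  else if g = G64.a ^ 2 ∨ g = G64.b ^ 2 ∨ g = G64.a ^ 2 * G64.b ^ 2 then -4
  else 0

/-- The character `χ₁`. -/
def chi₁ : G64 → ℤ := chi (G64.a ^ 2)
/-- The character `χ₂`. -/
def chi₂ : G64 → ℤ := chi (G64.b ^ 2)
/-- The character `χ₃`. -/
def chi₃ : G64 → ℤ := chi (G64.a ^ 2 * G64.b ^ 2)

/-! ## The permutation module and the lattice -/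

/-- The permutation of `Fin n` given by a product of cycles, where the points are labelled by
`1, …, n` (so that the label `k` denotes the element `k - 1` of `Fin n`). -/
def ofCycles (n : ℕ) [NeZero n] (L : List (List ℕ)) : Equiv.Perm (Fin n) :=
  (L.map fun l => (l.map fun k => Fin.ofNat n (k - 1)).formPerm).prod

/-- The permutation matrix `P_s` of the product `s` of the cycles `L`; it has the entry `1` in the
positions `(i, s(i))`. -/
def permMat (n : ℕ) [NeZero n] (L : List (List ℕ)) : Matrix (Fin n) (Fin n) ℤ :=
  (ofCycles n L).permMatrix ℤ

/-- The permutation matrix of the product of the cycles `L`, with the rows in `R` (labelled by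
`1, …, n`) multiplied by `-1`. -/
def signedPermMat (n : ℕ) [NeZero n] (R : List ℕ) (L : List (List ℕ)) :
    Matrix (Fin n) (Fin n) ℤ :=
  Matrix.diagonal (fun i : Fin n => if (i : ℕ) + 1 ∈ R then (-1 : ℤ) else 1) * permMat n L

/-- The values of the permutation representation of degree 32 on `a, b, c, d`. -/
def permRepGen : Fin 4 → Matrix (Fin 32) (Fin 32) ℤ :=
  ![permMat 32 [[1, 13], [2, 14], [3, 9], [4, 10], [5, 21], [6, 22], [7, 11], [8, 12], [15, 24],
      [16, 23], [17, 26], [18, 25], [19, 27], [20, 28], [29, 31], [30, 32]],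
    permMat 32 [[1, 3, 2, 4], [5, 18, 6, 17], [7, 15, 8, 16], [9, 14, 10, 13], [11, 24, 12, 23],
      [19, 30, 20, 29], [21, 25, 22, 26], [27, 32, 28, 31]],
    permMat 32 [[1, 5], [2, 6], [3, 18], [4, 17], [7, 20], [8, 19], [9, 26], [10, 25], [11, 27],
      [12, 28], [13, 22], [14, 21], [15, 29], [16, 30], [23, 31], [24, 32]],
    permMat 32 [[1, 8, 2, 7], [3, 15, 4, 16], [5, 19, 6, 20], [9, 23, 10, 24], [11, 14, 12, 13],
      [17, 30, 18, 29], [21, 28, 22, 27], [25, 32, 26, 31]]]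

/-- The values of the integral representation of degree 16 on `a, b, c, d`. -/
def latticeRepGen : Fin 4 → Matrix (Fin 16) (Fin 16) ℤ :=
  ![signedPermMat 16 [8, 9, 12, 13]
      [[1, 7], [2, 5], [3, 11], [4, 6], [8, 12], [9, 13], [10, 14], [15, 16]],
    signedPermMat 16 [2, 3, 5, 6, 8, 10, 13, 14]
      [[1, 2], [3, 9], [4, 8], [5, 7], [6, 12], [10, 15], [11, 13], [14, 16]],
    signedPermMat 16 [2, 4, 5, 7, 9, 10, 11, 13]
      [[1, 3], [2, 9], [4, 10], [5, 13], [6, 14], [7, 11], [8, 15], [12, 16]],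
    signedPermMat 16 [1, 6, 8, 9, 10, 11, 12, 13]
      [[1, 4], [2, 8], [3, 10], [5, 12], [6, 7], [9, 15], [11, 14], [13, 16]]]

/-- The map `ℤ¹⁶ → ℤ³²` that sends the standard basis to
`e₁ - e₂, e₃ - e₄, …, e₃₁ - e₃₂`. -/
def latticeIncl : (Fin 16 → ℤ) →ₗ[ℤ] (Fin 32 → ℤ) :=
  Fintype.linearCombination ℤ fun i : Fin 16 =>
    (Pi.single (⟨2 * i, by omega⟩ : Fin 32) 1 - Pi.single (⟨2 * i + 1, by omega⟩ : Fin 32) 1 :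
      Fin 32 → ℤ)

/-- The element of `ℚᵐ/ℤᵐ` with entry `1/2` where `v` is `1` and entry `0` where `v` is `0`. -/
def halves {m : ℕ} (v : Fin m → ℕ) : Fin m → AddCircle (1 : ℚ) :=
  fun i => (((v i : ℚ) / 2 : ℚ) : AddCircle (1 : ℚ))

/-- The values of the cocycle on `a, b, c, d`. -/
def cocycleGen : Fin 4 → Fin 16 → AddCircle (1 : ℚ) :=
  ![halves ![0, 1, 0, 0, 0, 1, 1, 1, 1, 0, 1, 0, 0, 1, 1, 0],
    halves ![0, 0, 0, 1, 0, 1, 0, 1, 0, 1, 0, 1, 0, 1, 1, 1],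
    halves ![0, 1, 1, 0, 0, 1, 1, 1, 0, 1, 0, 0, 1, 0, 0, 1],
    halves ![0, 0, 0, 0, 0, 0, 0, 0, 0, 0, 0, 0, 0, 0, 0, 0]]

/-! ## The holonomy lattice and the extension class -/

section Lattice

variable {k L : Type} [CommRing k] [AddCommGroup L] [Module k L]

/-- The representation `ρ` twisted by the automorphism `f`: the element `g` acts as `f(g)`. -/
abbrev twist (ρ : Representation k G64 L) (f : MulAut G64) : Representation k G64 L :=
  ρ.comp f.toMonoidHom

/-- The representation on `M ⊕ M^{f₂} ⊕ M^{f₃}`. -/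
abbrev tripleRep (ρ : Representation k G64 L) (f₂ f₃ : MulAut G64) :
    Representation k G64 (L × L × L) :=
  ρ.prod ((twist ρ f₂).prod (twist ρ f₃))

/-- The inclusion of `M` into `M ⊕ M^{f₂} ⊕ M^{f₃}`. -/
def incl₁ (ρ : Representation k G64 L) (f₂ f₃ : MulAut G64) :
    Rep.of ρ ⟶ Rep.of (tripleRep ρ f₂ f₃) :=
  Rep.ofHom (Representation.IntertwiningMap.inl k ρ _)

/-- The inclusion of `M^{f₂}` into `M ⊕ M^{f₂} ⊕ M^{f₃}`. -/
def incl₂ (ρ : Representation k G64 L) (f₂ f₃ : MulAut G64) :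
    Rep.of (twist ρ f₂) ⟶ Rep.of (tripleRep ρ f₂ f₃) :=
  Rep.ofHom ((Representation.IntertwiningMap.inr k ρ _).comp
    (Representation.IntertwiningMap.inl k (twist ρ f₂) (twist ρ f₃)))

/-- The inclusion of `M^{f₃}` into `M ⊕ M^{f₂} ⊕ M^{f₃}`. -/
def incl₃ (ρ : Representation k G64 L) (f₂ f₃ : MulAut G64) :
    Rep.of (twist ρ f₃) ⟶ Rep.of (tripleRep ρ f₂ f₃) :=
  Rep.ofHom ((Representation.IntertwiningMap.inr k ρ _).comp
    (Representation.IntertwiningMap.inr k (twist ρ f₂) (twist ρ f₃)))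

/-- The class `α + f₂*(α) + f₃*(α)` in `H²(G, M ⊕ M^{f₂} ⊕ M^{f₃})`. -/
def totalClass {ρ : Representation k G64 L} (f₂ f₃ : MulAut G64)
    (α : groupCohomology.H2 (Rep.of ρ)) :
    groupCohomology.H2 (Rep.of (tripleRep ρ f₂ f₃)) :=
  pushforward (incl₁ ρ f₂ f₃) α
    + pushforward (incl₂ ρ f₂ f₃) (pullback f₂.toMonoidHom (Rep.of ρ) α)
    + pushforward (incl₃ ρ f₂ f₃) (pullback f₃.toMonoidHom (Rep.of ρ) α)

end Lattice

end FlatQuat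

end

open FlatQuat

/-!
The presented group `G64` is identified with an explicit model, the set `𝔽₂⁴ × 𝔽₂²` with a twisted
addition (`G64.equivModel`), in which statements about its elements are decided by evaluation. Its
centre is `{1, a², b², a²b²}`, these are all the squares, and there are automorphisms that move any
of the three involutions to `a²` (`exists_mulAut_a_sq`). On `M` the involution `a²` acts as `1` and
the two others as `-1`. The matrices of `ρ_M` are signed permutation matrices and the cocycle `α̂`
has values of order two, so that both together amount to a single homomorphism `latticeHom` to a
group of signed permutations with translations, given by its values on the generators.

*Type of the summands.* In an irreducible submodule of `K ⊗ L` the centre acts by a non-trivial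
character, and after an automorphism of `G64` the element `a²` acts as `1` and `b²` as `-1`
(`exists_twist`). Then `a` and `c` generate a matrix algebra of degree two, with which `b` and `dc`
commute; these satisfy the relations of the quaternion units `i` and `j`. Over `ℝ` the module is
therefore `ℍ²`, with endomorphism algebra `ℍ`
(`nonempty_intertwiningMap_equiv_quaternion`). Over `ℂ` it has dimension four, and counting the
square roots of the central elements (4 for the identity, 20 for each involution) gives the
Frobenius–Schur indicator `(16 + 80 - 80 - 80) / 64 = -1` (`frobeniusSchur_eq`).

*The class.* Let `c` be the 2-cocycle that is the coboundary of the lift of `α̂` with entries in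
`{0, 1/2}`. A non-trivial cyclic subgroup of `G64` contains an involution `z`, and there is a
component of `L` on which `z` acts through `a²`. On this component `z` acts trivially and
`c(z, z) = (1, …, 1)`, because all entries of `α̂(a²)` are `1/2`. This is not a multiple of two, so
that the class is special (`isSpecial_totalClass`). For the same reason the square of an element
over `z` of the corresponding extension is a non-zero element of `L` (`exists_sq_eq_inl`), and the
fourth power of any element other than the identity is one (`exists_pow_four_eq_inl`).

*The manifold.* The extension acts on `ℝ⁴⁸` by the affine isometries `x ↦ l + g x + s(g)`, where `s`
is the lift of `α̂`. By the above the fourth power of an element `γ ≠ 1` is the translation by a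
non-zero integral vector, so that `γ` moves every point by at least `1/4` (`le_dist_smul`). Hence
the extension is torsion-free, the action is free and properly discontinuous, and it is cocompact
because it contains `ℤ⁴⁸`. The local sections of the projection of `ℝ⁴⁸` to the quotient form an
atlas whose coordinate changes are isometries; it carries a Riemannian metric with constant
coefficients, which is flat (`exists_flatManifold`). The fundamental group of the quotient is the
extension, as `ℝ⁴⁸` is simply connected. Finally `L` is the largest abelian subgroup of finite
index because `G64` acts faithfully on it (`InducesAction.isTranslationSubgroup`).
-/


noncomputable section

namespace FlatQuat

/-! ### The group of order 64 and its automorphisms -/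

/-- The group with underlying set `𝔽₂⁴ × 𝔽₂²` and multiplication
`(u, z)(v, w) = (u + v, z + w + B(u, v))`, where `B` is the bilinear map that is read off from the
squares and commutators of the generators of `G64`. The element `(u, z)` stands for
`a ^ u₀ * b ^ u₁ * c ^ u₂ * d ^ u₃ * (a ^ 2) ^ z₀ * (b ^ 2) ^ z₁`. -/
@[ext]
structure Model : Type where
  u₀ : ZMod 2
  u₁ : ZMod 2
  u₂ : ZMod 2
  u₃ : ZMod 2
  z₀ : ZMod 2
  z₁ : ZMod 2
deriving DecidableEq

namespace Model

instance : Fintype Model :=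
  Fintype.ofEquiv (ZMod 2 × ZMod 2 × ZMod 2 × ZMod 2 × ZMod 2 × ZMod 2)
    { toFun := fun x => ⟨x.1, x.2.1, x.2.2.1, x.2.2.2.1, x.2.2.2.2.1, x.2.2.2.2.2⟩
      invFun := fun x => (x.u₀, x.u₁, x.u₂, x.u₃, x.z₀, x.z₁)
      left_inv := fun _ => rfl
      right_inv := fun _ => rfl }

instance : Mul Model where
  mul x y :=
    { u₀ := x.u₀ + y.u₀
      u₁ := x.u₁ + y.u₁
      u₂ := x.u₂ + y.u₂
      u₃ := x.u₃ + y.u₃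
      z₀ := x.z₀ + y.z₀ + (x.u₀ * y.u₀ + x.u₂ * y.u₂ + x.u₁ * y.u₀ + x.u₂ * y.u₀ + x.u₂ * y.u₁ +
        x.u₃ * y.u₁)
      z₁ := x.z₁ + y.z₁ + (x.u₁ * y.u₁ + x.u₃ * y.u₃ + x.u₂ * y.u₀ + x.u₃ * y.u₀ + x.u₃ * y.u₁) }

instance : One Model := ⟨⟨0, 0, 0, 0, 0, 0⟩⟩

instance : Inv Model where
  inv x :=
    { u₀ := -x.u₀
      u₁ := -x.u₁
      u₂ := -x.u₂
      u₃ := -x.u₃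
      z₀ := -x.z₀ + (x.u₀ * x.u₀ + x.u₂ * x.u₂ + x.u₁ * x.u₀ + x.u₂ * x.u₀ + x.u₂ * x.u₁ +
        x.u₃ * x.u₁)
      z₁ := -x.z₁ + (x.u₁ * x.u₁ + x.u₃ * x.u₃ + x.u₂ * x.u₀ + x.u₃ * x.u₀ + x.u₃ * x.u₁) }

theorem mul_def (x y : Model) : x * y =
    { u₀ := x.u₀ + y.u₀
      u₁ := x.u₁ + y.u₁
      u₂ := x.u₂ + y.u₂
      u₃ := x.u₃ + y.u₃
      z₀ := x.z₀ + y.z₀ + (x.u₀ * y.u₀ + x.u₂ * y.u₂ + x.u₁ * y.u₀ + x.u₂ * y.u₀ + x.u₂ * y.u₁ +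
        x.u₃ * y.u₁)
      z₁ := x.z₁ + y.z₁ + (x.u₁ * y.u₁ + x.u₃ * y.u₃ + x.u₂ * y.u₀ + x.u₃ * y.u₀ + x.u₃ * y.u₁) } :=
  rfl

theorem one_def : (1 : Model) = ⟨0, 0, 0, 0, 0, 0⟩ := rfl

instance : Group Model :=
  Group.ofLeftAxioms
    (fun x y z => by
      simp only [mul_def, mk.injEq]
      refine ⟨?_, ?_, ?_, ?_, ?_, ?_⟩ <;> ring)
    (fun x => by simp [mul_def, one_def])
    (fun x => by
      simp only [mul_def, one_def, mk.injEq]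
      refine ⟨neg_add_cancel _, neg_add_cancel _, neg_add_cancel _, neg_add_cancel _, ?_, ?_⟩ <;>
        simp only [Inv.inv] <;> ring)

/-- The images of `a, b, c, d`. -/
def gen : Fin 4 → Model :=
  ![⟨1, 0, 0, 0, 0, 0⟩, ⟨0, 1, 0, 0, 0, 0⟩, ⟨0, 0, 1, 0, 0, 0⟩, ⟨0, 0, 0, 1, 0, 0⟩]

end Model

/-- The defining relations of `G64` for four elements of a group. -/
abbrev Relations {K : Type*} [Group K] (f : Fin 4 → K) : Prop :=
  (f 0 ^ 4 = 1 ∧ f 1 ^ 4 = 1 ∧ f 0 ^ 2 = f 2 ^ 2 ∧ f 1 ^ 2 = f 3 ^ 2) ∧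
    (⁅f 0, f 1⁆ = f 0 ^ 2 ∧ ⁅f 0, f 2⁆ = f 0 ^ 2 * f 1 ^ 2 ∧ ⁅f 0, f 3⁆ = f 1 ^ 2 ∧
      ⁅f 1, f 2⁆ = f 0 ^ 2 ∧ ⁅f 1, f 3⁆ = f 0 ^ 2 * f 1 ^ 2 ∧ ⁅f 2, f 3⁆ = 1) ∧
    ⁅f 0 ^ 2, f 1⁆ = 1 ∧ ⁅f 0 ^ 2, f 2⁆ = 1 ∧ ⁅f 0 ^ 2, f 3⁆ = 1 ∧ ⁅f 1 ^ 2, f 0⁆ = 1 ∧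
      ⁅f 1 ^ 2, f 2⁆ = 1 ∧ ⁅f 1 ^ 2, f 3⁆ = 1

theorem relations_iff {K : Type*} [Group K] (f : Fin 4 → K) :
    Relations f ↔ ∀ r ∈ relators, FreeGroup.lift f r = 1 := by
  simp only [relators, Set.mem_insert_iff, Set.mem_singleton_iff, forall_eq_or_imp, forall_eq,
    map_pow, map_mul, map_inv, map_commutatorElement, FreeGroup.lift_apply_of, mul_inv_eq_one,
    Relations, and_assoc]

namespace G64

/-- The homomorphism from `G64` given by four elements that satisfy the defining relations. -/
def lift {K : Type*} [Group K] (f : Fin 4 → K) (h : Relations f) : G64 →* K :=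
  PresentedGroup.toGroup (f := f) ((relations_iff f).1 h)

@[simp]
theorem lift_of {K : Type*} [Group K] (f : Fin 4 → K) (h : Relations f) (i : Fin 4) :
    lift f h (PresentedGroup.of i) = f i :=
  PresentedGroup.toGroup.of _

/-- The homomorphism to the concrete model, which is shown to be an isomorphism below. -/
def toModel : G64 →* Model :=
  lift Model.gen (by decide +kernel)

@[simp]
theorem toModel_of (i : Fin 4) : toModel (PresentedGroup.of i) = Model.gen i :=
  lift_of ..

theorem relations : Relations ![a, b, c, d] := by
  have h : ![a, b, c, d] = (PresentedGroup.of : Fin 4 → G64) := by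
    ext i; fin_cases i <;> rfl
  rw [relations_iff, h]
  intro r hr
  rw [← PresentedGroup.one_of_mem hr]
  exact DFunLike.congr_fun (FreeGroup.ext_hom (FreeGroup.lift PresentedGroup.of)
    (PresentedGroup.mk relators) fun i => FreeGroup.lift_apply_of) r

theorem closure_generators : Subgroup.closure {a, b, c, d} = ⊤ := by
  rw [← PresentedGroup.closure_range_of relators]
  congr 1
  ext x
  simp [Fin.exists_fin_succ, a, b, c, d, eq_comm]

theorem mem_center_iff {z : G64} :
    z ∈ Subgroup.center G64 ↔ Commute a z ∧ Commute b z ∧ Commute c z ∧ Commute d z := by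
  rw [← Subgroup.centralizer_univ, ← Subgroup.coe_top, ← closure_generators,
    Subgroup.centralizer_closure, Subgroup.mem_centralizer_iff]
  simp [Commute, SemiconjBy]

theorem a_sq_mem_center : a ^ 2 ∈ Subgroup.center G64 := by
  obtain ⟨-, -, h1, h2, h3, -, -, -⟩ := relations
  simp only [commutatorElement_eq_one_iff_commute] at h1 h2 h3
  exact mem_center_iff.2 ⟨Commute.self_pow a 2, h1.symm, h2.symm, h3.symm⟩

theorem b_sq_mem_center : b ^ 2 ∈ Subgroup.center G64 := by
  obtain ⟨-, -, -, -, -, h1, h2, h3⟩ := relations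
  simp only [commutatorElement_eq_one_iff_commute] at h1 h2 h3
  exact mem_center_iff.2 ⟨h1.symm, Commute.self_pow b 2, h2.symm, h3.symm⟩

/-- The element of `G64` in normal form that a point of the model stands for. -/
def ofModel (m : Model) : G64 :=
  a ^ m.u₀.val * (b ^ m.u₁.val * (c ^ m.u₂.val * (d ^ m.u₃.val *
    ((a ^ 2) ^ m.z₀.val * (b ^ 2) ^ m.z₁.val))))

theorem toModel_ofModel (m : Model) : toModel (ofModel m) = m := by
  simp only [ofModel, a, b, c, d, map_mul, map_pow, toModel_of]
  revert m
  decide +kernel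

section Exponents

variable {K : Type*} [Group K] {x y z : K} (i j : ZMod 2) (r : K)

/-- Moving a generator into a normal form, when its own exponent increases. -/
theorem mul_pow_val_of_sq (h : x ^ 2 = z) :
    x * (x ^ i.val * r) = x ^ (1 + i).val * (z ^ i.val * r) := by
  obtain rfl | rfl : i = 0 ∨ i = 1 := by revert i; decide
  · simp [ZMod.val_one]
  · have : (1 + 1 : ZMod 2) = 0 := by decide
    simp [this, ZMod.val_one, ← h, pow_two, mul_assoc]

/-- Moving a generator into a normal form, when it passes an earlier generator. -/
theorem mul_pow_val_of_commutator (hz : ∀ g, Commute z g) (hz2 : z ^ 2 = 1) (h : ⁅x, y⁆ = z) :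
    y * (x ^ i.val * r) = x ^ i.val * (y * (z ^ i.val * r)) := by
  obtain rfl | rfl : i = 0 ∨ i = 1 := by revert i; decide
  · simp
  · rw [commutatorElement_def, mul_inv_eq_iff_eq_mul, mul_inv_eq_iff_eq_mul] at h
    have : x * y * z = y * x := by
      rw [h, ← (hz (z * y * x)).eq, ← mul_assoc, ← mul_assoc, ← pow_two, hz2, one_mul]
    simp only [ZMod.val_one, pow_one]
    rw [← mul_assoc, ← this]
    simp only [mul_assoc]

theorem pow_val_add (hz2 : z ^ 2 = 1) : z ^ (i + j).val * r = z ^ i.val * (z ^ j.val * r) := by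
  rw [← mul_assoc, ← pow_add, ZMod.val_add]
  conv_rhs => rw [← Nat.mod_add_div (i.val + j.val) 2, pow_add, pow_mul, hz2, one_pow, mul_one]

end Exponents

/-- Left multiplication of normal forms by generators. -/
theorem ofModel_gen_mul (i : Fin 4) (m : Model) :
    ofModel (Model.gen i * m) = PresentedGroup.of i * ofModel m := by
  have hza : ∀ g, Commute (a ^ 2) g := fun g => (Subgroup.mem_center_iff.1 a_sq_mem_center g).symm
  have hwa : ∀ g, Commute (b ^ 2) g := fun g => (Subgroup.mem_center_iff.1 b_sq_mem_center g).symm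
  obtain ⟨⟨ha, hb, hc, hd⟩, ⟨hab, hac, had, hbc, hbd, hcd⟩, -⟩ := relations
  simp only [Fin.isValue, Matrix.cons_val_zero, Matrix.cons_val_one, Matrix.cons_val] at *
  have hz2 : (a ^ 2) ^ 2 = 1 := by rw [← pow_mul]; exact ha
  have hw2 : (b ^ 2) ^ 2 = 1 := by rw [← pow_mul]; exact hb
  have hzw : ∀ g, Commute (a ^ 2 * b ^ 2) g := fun g => (hza g).mul_left (hwa g)
  have hzw2 : (a ^ 2 * b ^ 2) ^ 2 = 1 := by rw [(hza _).mul_pow, hz2, hw2, one_mul]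
  have hone : ∀ g : G64, Commute 1 g := Commute.one_left
  obtain ⟨u₀, u₁, u₂, u₃, z₀, z₁⟩ := m
  simp only [ofModel]
  clear ha hb
  generalize hz : a ^ 2 = z at *
  generalize hw : b ^ 2 = w at *
  have ea := fun i r => mul_pow_val_of_sq i r hz
  have eb := fun i r => mul_pow_val_of_sq i r hw
  have ec := fun i r => mul_pow_val_of_sq i r hc.symm
  have ed := fun i r => mul_pow_val_of_sq i r hd.symm
  have eab := fun i r => mul_pow_val_of_commutator i r hza hz2 hab
  have eac := fun i r => mul_pow_val_of_commutator i r hzw hzw2 hac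
  have ead := fun i r => mul_pow_val_of_commutator i r hwa hw2 had
  have ebc := fun i r => mul_pow_val_of_commutator i r hza hz2 hbc
  have ebd := fun i r => mul_pow_val_of_commutator i r hzw hzw2 hbd
  have ecd := fun i r => mul_pow_val_of_commutator i r hone (one_pow 2) hcd
  have az := fun i j r => pow_val_add i j r hz2
  have aw := fun i j => pow_val_add i j 1 hw2
  simp only [mul_one] at aw
  have mp : ∀ k, (z * w) ^ k = z ^ k * w ^ k := fun k => (hza w).mul_pow k
  have pull : ∀ (k l : ℕ) (r : G64),
      z ^ k * (a ^ l * r) = a ^ l * (z ^ k * r) ∧ z ^ k * (b ^ l * r) = b ^ l * (z ^ k * r) ∧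
      z ^ k * (c ^ l * r) = c ^ l * (z ^ k * r) ∧ z ^ k * (d ^ l * r) = d ^ l * (z ^ k * r) ∧
      w ^ k * (a ^ l * r) = a ^ l * (w ^ k * r) ∧ w ^ k * (b ^ l * r) = b ^ l * (w ^ k * r) ∧
      w ^ k * (c ^ l * r) = c ^ l * (w ^ k * r) ∧ w ^ k * (d ^ l * r) = d ^ l * (w ^ k * r) ∧
      w ^ k * (z ^ l * r) = z ^ l * (w ^ k * r) := by
    intro k l r
    refine ⟨?_, ?_, ?_, ?_, ?_, ?_, ?_, ?_, ?_⟩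
    iterate 4 exact ((hza _).pow_pow k l).left_comm r
    iterate 5 exact ((hwa _).pow_pow k l).left_comm r
  have sort : ∀ (k l : ℕ) (r : G64), z ^ k * (z ^ l * r) = z ^ l * (z ^ k * r) ∧
      w ^ k * (w ^ l * r) = w ^ l * (w ^ k * r) :=
    fun k l r => ⟨((hza z).pow_pow k l).left_comm r, ((hwa w).pow_pow k l).left_comm r⟩
  have sort' : ∀ k l : ℕ, w ^ k * w ^ l = w ^ l * w ^ k := fun k l => ((hwa w).pow_pow k l).eq
  fin_cases i
  · change _ = a * _
    simp [Model.mul_def, Model.gen, ea, pull, az]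
    simp only [sort]
  · change _ = b * _
    simp [Model.mul_def, Model.gen, eab, eb, pull, az, aw]
    simp only [sort, sort']
  · change _ = c * _
    simp [Model.mul_def, Model.gen, eac, ebc, ec, mp, pull, az, aw, mul_assoc]
    simp only [sort, sort']
  · change _ = d * _
    simp [Model.mul_def, Model.gen, ead, ebd, ecd, ed, mp, pull, az, aw, mul_assoc]
    simp only [sort, sort']

/-- Normal forms are closed under left multiplication by generators, so that every element has
one; with `toModel_ofModel` this identifies `G64` with the model. -/
theorem ofModel_toModel (g : G64) : ofModel (toModel g) = g := by
  have key : ∀ g : G64, ∀ m, ofModel (toModel g * m) = g * ofModel m := by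
    intro g
    have hg : g ∈ Subgroup.closure (Set.range (PresentedGroup.of (rels := relators))) := by
      rw [PresentedGroup.closure_range_of]; trivial
    induction hg using Subgroup.closure_induction with
    | mem x hx =>
      obtain ⟨i, rfl⟩ := hx
      intro m
      rw [toModel_of, ofModel_gen_mul]
    | one => simp
    | mul x y _ _ hx hy => intro m; rw [map_mul, mul_assoc, hx, hy, mul_assoc]
    | inv x _ hx =>
      intro m
      rw [eq_inv_mul_iff_mul_eq, ← hx, ← mul_assoc, ← map_mul, mul_inv_cancel, map_one, one_mul]
  have h1 : ofModel 1 = 1 := by simp [ofModel, Model.one_def]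
  simpa [h1] using key g 1

/-- The isomorphism of `G64` with the concrete model. It makes statements about all elements of
`G64` decidable by evaluation. -/
def equivModel : G64 ≃* Model where
  toFun := toModel
  invFun := ofModel
  left_inv := ofModel_toModel
  right_inv := toModel_ofModel
  map_mul' := map_mul toModel

@[simp]
theorem equivModel_of (i : Fin 4) : equivModel (PresentedGroup.of i) = Model.gen i :=
  toModel_of i

instance : Finite G64 := Finite.of_equiv _ equivModel.symm.toEquiv

noncomputable instance : Fintype G64 := Fintype.ofEquiv _ equivModel.symm.toEquiv

theorem card_eq : Nat.card G64 = 64 := by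
  rw [Nat.card_congr equivModel.toEquiv, Nat.card_eq_fintype_card]
  decide +kernel

@[simp] theorem equivModel_a : equivModel a = ⟨1, 0, 0, 0, 0, 0⟩ := equivModel_of 0
@[simp] theorem equivModel_b : equivModel b = ⟨0, 1, 0, 0, 0, 0⟩ := equivModel_of 1
@[simp] theorem equivModel_c : equivModel c = ⟨0, 0, 1, 0, 0, 0⟩ := equivModel_of 2
@[simp] theorem equivModel_d : equivModel d = ⟨0, 0, 0, 1, 0, 0⟩ := equivModel_of 3

@[simp] theorem equivModel_a_sq : equivModel (a ^ 2) = ⟨0, 0, 0, 0, 1, 0⟩ := by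
  rw [map_pow, equivModel_a]; decide +kernel
@[simp] theorem equivModel_b_sq : equivModel (b ^ 2) = ⟨0, 0, 0, 0, 0, 1⟩ := by
  rw [map_pow, equivModel_b]; decide +kernel

theorem orderOf_generator (i : Fin 4) : orderOf (PresentedGroup.of i : G64) = 4 := by
  rw [← MulEquiv.orderOf_eq equivModel, equivModel_of]
  refine orderOf_eq_prime_pow (p := 2) (n := 1) ?_ ?_ <;> revert i <;> decide +kernel

theorem mem_center_iff_model {g : G64} : g ∈ Subgroup.center G64 ↔
    (equivModel g).u₀ = 0 ∧ (equivModel g).u₁ = 0 ∧ (equivModel g).u₂ = 0 ∧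
      (equivModel g).u₃ = 0 := by
  rw [mem_center_iff]
  simp only [Commute, SemiconjBy, ← equivModel.injective.eq_iff, map_mul, equivModel_a,
    equivModel_b, equivModel_c, equivModel_d]
  generalize equivModel g = m
  revert m
  decide +kernel

theorem mem_center_iff_eq {g : G64} : g ∈ Subgroup.center G64 ↔
    g = 1 ∨ g = a ^ 2 ∨ g = b ^ 2 ∨ g = a ^ 2 * b ^ 2 := by
  rw [mem_center_iff_model]
  simp only [← equivModel.injective.eq_iff, map_mul, equivModel_a_sq, equivModel_b_sq, map_one]
  generalize equivModel g = m
  revert m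
  decide +kernel

theorem center_eq_closure : Subgroup.center G64 = Subgroup.closure {a ^ 2, b ^ 2} := by
  apply le_antisymm
  · intro g hg
    have ha : a ^ 2 ∈ Subgroup.closure {a ^ 2, b ^ 2} := Subgroup.subset_closure (by simp)
    have hb : b ^ 2 ∈ Subgroup.closure {a ^ 2, b ^ 2} := Subgroup.subset_closure (by simp)
    obtain rfl | rfl | rfl | rfl := mem_center_iff_eq.1 hg
    exacts [one_mem _, ha, hb, mul_mem ha hb]
  · rw [Subgroup.closure_le]
    rintro _ (rfl | rfl)
    exacts [a_sq_mem_center, b_sq_mem_center]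

/-- The projection of `G64` to its quotient by the centre. -/
def toQuotientCenter : G64 →* Multiplicative (Fin 4 → ZMod 2) where
  toFun g := Multiplicative.ofAdd
    ![(equivModel g).u₀, (equivModel g).u₁, (equivModel g).u₂, (equivModel g).u₃]
  map_one' := by rw [map_one]; decide +kernel
  map_mul' g h := by
    rw [map_mul, ← ofAdd_add]
    simp [Model.mul_def]

theorem nonempty_center_equiv :
    Nonempty (Subgroup.center G64 ≃* Multiplicative (Fin 2 → ZMod 2)) := by
  let f : Subgroup.center G64 →* Multiplicative (Fin 2 → ZMod 2) :=
    { toFun := fun g => Multiplicative.ofAdd ![(equivModel g).z₀, (equivModel g).z₁]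
      map_one' := by rw [Subgroup.coe_one, map_one]; decide +kernel
      map_mul' := fun g h => by
        obtain ⟨h0, h1, h2, h3⟩ := mem_center_iff_model.1 g.2
        rw [Subgroup.coe_mul, map_mul, ← ofAdd_add]
        simp [Model.mul_def, h0, h1, h2, h3] }
  refine ⟨MulEquiv.ofBijective f ⟨?_, ?_⟩⟩
  · rintro ⟨g, hg⟩ ⟨h, hh⟩ hgh
    rw [mem_center_iff_model] at hg hh
    have h' := Multiplicative.ofAdd.injective hgh
    refine Subtype.ext (equivModel.injective
      (Model.ext ?_ ?_ ?_ ?_ (congrFun h' 0) (congrFun h' 1)))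
    exacts [hg.1.trans hh.1.symm, hg.2.1.trans hh.2.1.symm, hg.2.2.1.trans hh.2.2.1.symm,
      hg.2.2.2.trans hh.2.2.2.symm]
  · intro v
    refine ⟨⟨equivModel.symm ⟨0, 0, 0, 0, v.toAdd 0, v.toAdd 1⟩, ?_⟩, ?_⟩
    · simp [mem_center_iff_model]
    · apply Multiplicative.toAdd.injective
      ext i
      fin_cases i <;> simp [f]

theorem nonempty_quotient_center_equiv :
    Nonempty (G64 ⧸ Subgroup.center G64 ≃* Multiplicative (Fin 4 → ZMod 2)) := by
  have hker : toQuotientCenter.ker = Subgroup.center G64 := by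
    ext g
    rw [MonoidHom.mem_ker, mem_center_iff_model, ← ofAdd_zero]
    change Multiplicative.ofAdd _ = _ ↔ _
    rw [Multiplicative.ofAdd.injective.eq_iff, funext_iff]
    simp [Fin.forall_fin_succ]
  have hsurj : Function.Surjective toQuotientCenter := fun v =>
    ⟨equivModel.symm ⟨v.toAdd 0, v.toAdd 1, v.toAdd 2, v.toAdd 3, 0, 0⟩, by
      apply Multiplicative.toAdd.injective
      ext i
      fin_cases i <;> simp [toQuotientCenter]⟩
  exact ⟨(QuotientGroup.quotientMulEquivOfEq hker.symm).trans
    (QuotientGroup.quotientKerEquivOfSurjective _ hsurj)⟩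

open Classical in
theorem chi_eq (z g : G64) :
    chi z g = if g = 1 ∨ g = z then 4 else if g ∈ Subgroup.center G64 then -4 else 0 := by
  unfold chi
  split_ifs with h1 h2 h3 h3 <;> try rfl
  · exact absurd (mem_center_iff_eq.2 (Or.inr h2)) h3
  · exact absurd ((mem_center_iff_eq.1 h3).resolve_left fun h => h1 (Or.inl h)) h2

/-- The functions `χ_z` are permuted by the automorphisms of `G64`, as the centre is
characteristic. -/
theorem chi_mulAut (φ : MulAut G64) (z g : G64) : chi (φ z) (φ g) = chi z g := by
  classical
  have h : φ g ∈ Subgroup.center G64 ↔ g ∈ Subgroup.center G64 := by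
    simp only [Subgroup.mem_center_iff]
    rw [φ.surjective.forall]
    simp only [← map_mul, φ.injective.eq_iff]
  simp only [chi_eq, h, φ.injective.eq_iff, EmbeddingLike.map_eq_one_iff]

/-- An automorphism that pulls the character `χ₁` back to the one that belongs to `z` sends `z`
to `a²`. -/
theorem mulAut_apply_eq_a_sq {φ : MulAut G64} {z : G64} (hz : z ≠ 1)
    (h : ∀ g, chi z g = chi₁ (φ g)) : φ z = a ^ 2 := by
  have h1 := h z
  rw [chi_eq, if_pos (Or.inr rfl), chi₁, chi_eq] at h1
  split_ifs at h1 with h2 h3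
  · exact h2.resolve_left (by simpa using hz)
  · norm_num at h1

/-- Four elements of the model that satisfy the defining relations are the images of `a, b, c, d`
under an automorphism as soon as the resulting endomorphism has trivial kernel. -/
theorem exists_mulAut {f : Fin 4 → Model} (h : Relations f)
    (hinj : ∀ m : Model, f 0 ^ m.u₀.val * (f 1 ^ m.u₁.val * (f 2 ^ m.u₂.val * (f 3 ^ m.u₃.val *
      ((f 0 ^ 2) ^ m.z₀.val * (f 1 ^ 2) ^ m.z₁.val)))) = 1 → m = 1) :
    ∃ φ : MulAut G64, ∀ i, equivModel (φ (PresentedGroup.of i)) = f i := by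
  have hl : ∀ m, lift f h (ofModel m) = f 0 ^ m.u₀.val * (f 1 ^ m.u₁.val *
      (f 2 ^ m.u₂.val * (f 3 ^ m.u₃.val * ((f 0 ^ 2) ^ m.z₀.val * (f 1 ^ 2) ^ m.z₁.val)))) := by
    intro m
    simp [ofModel, a, b, c, d]
  have hbij : Function.Bijective (equivModel.symm.toMonoidHom.comp (lift f h)) := by
    rw [← Finite.injective_iff_bijective, injective_iff_map_eq_one]
    intro g hg
    have h1 : lift f h g = 1 := equivModel.symm.injective (hg.trans (map_one _).symm)
    rw [← ofModel_toModel g, hl] at h1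
    exact equivModel.injective ((hinj _ h1).trans (map_one _).symm)
  exact ⟨MulEquiv.ofBijective _ hbij, fun i => by simp⟩

/-- There is an automorphism `φ` with `φ(b²) = a²`. -/
theorem exists_mulAut_chi₂ : ∃ f₂ : MulAut G64, ∀ g, chi₂ g = chi₁ (f₂ g) := by
  obtain ⟨φ, hφ⟩ := exists_mulAut (f := ![⟨0, 0, 0, 1, 0, 0⟩, ⟨1, 0, 0, 0, 0, 0⟩,
    ⟨0, 1, 1, 0, 0, 0⟩, ⟨1, 1, 0, 1, 0, 0⟩]) (by decide +kernel) (by decide +kernel)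
  have h : φ (b ^ 2) = a ^ 2 := by
    apply equivModel.injective
    rw [map_pow, map_pow, b, hφ, equivModel_a_sq]
    decide +kernel
  exact ⟨φ, fun g => ((congrArg (chi · (φ g)) h.symm).trans (chi_mulAut φ _ g)).symm⟩

/-- There is an automorphism `φ` with `φ(a² b²) = a²`. -/
theorem exists_mulAut_chi₃ : ∃ f₃ : MulAut G64, ∀ g, chi₃ g = chi₁ (f₃ g) := by
  obtain ⟨φ, hφ⟩ := exists_mulAut (f := ![⟨0, 0, 0, 1, 0, 0⟩, ⟨1, 0, 1, 0, 0, 0⟩,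
    ⟨1, 1, 1, 1, 0, 0⟩, ⟨0, 1, 1, 1, 0, 0⟩]) (by decide +kernel) (by decide +kernel)
  have h : φ (a ^ 2 * b ^ 2) = a ^ 2 := by
    apply equivModel.injective
    rw [map_mul, map_pow, map_pow, map_mul, map_pow, map_pow, equivModel_a_sq, a, b, hφ, hφ]
    decide +kernel
  exact ⟨φ, fun g => ((congrArg (chi · (φ g)) h.symm).trans (chi_mulAut φ _ g)).symm⟩

/-- The only elements of order two are `a²`, `b²` and `a²b²`. -/
theorem eq_of_sq_eq_one {g : G64} (h : g ^ 2 = 1) :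
    g = 1 ∨ g = a ^ 2 ∨ g = b ^ 2 ∨ g = a ^ 2 * b ^ 2 := by
  rw [← equivModel.injective.eq_iff, map_pow, map_one] at h
  simp only [← equivModel.injective.eq_iff, map_mul, equivModel_a_sq, equivModel_b_sq, map_one]
  generalize equivModel g = m at *
  revert m
  decide +kernel

theorem pow_four_eq_one (g : G64) : g ^ 4 = 1 := by
  rw [← equivModel.injective.eq_iff, map_pow, map_one]
  generalize equivModel g = m
  revert m
  decide +kernel

/-- A property that holds for the generators and is stable under products holds for all elements,
since `g⁻¹ = g³`. -/
theorem induction_of {P : G64 → Prop} (one : P 1) (of : ∀ i, P (PresentedGroup.of i))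
    (mul : ∀ g h, P g → P h → P (g * h)) (g : G64) : P g := by
  have hg : g ∈ Subgroup.closure (Set.range (PresentedGroup.of (rels := relators))) := by
    rw [PresentedGroup.closure_range_of]
    trivial
  induction hg using Subgroup.closure_induction with
  | mem g hg =>
    obtain ⟨i, rfl⟩ := hg
    exact of i
  | one => exact one
  | mul g h _ _ ihg ihh => exact mul g h ihg ihh
  | inv g _ ih =>
    have e : g⁻¹ = g * (g * g) := by
      rw [inv_eq_iff_mul_eq_one, ← G64.pow_four_eq_one g]
      simp only [pow_succ, pow_zero, one_mul, mul_assoc]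
    rw [e]
    exact mul _ _ ih (mul _ _ ih ih)

end G64
/-! ### The permutation module and the lattice -/

/-- The permutations of 32 points whose matrices are the values of `ρ₁` on `a, b, c, d`. -/
def permGen : Fin 4 → Equiv.Perm (Fin 32) :=
  ![ofCycles 32 [[1, 13], [2, 14], [3, 9], [4, 10], [5, 21], [6, 22], [7, 11], [8, 12], [15, 24],
      [16, 23], [17, 26], [18, 25], [19, 27], [20, 28], [29, 31], [30, 32]],
    ofCycles 32 [[1, 3, 2, 4], [5, 18, 6, 17], [7, 15, 8, 16], [9, 14, 10, 13], [11, 24, 12, 23],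
      [19, 30, 20, 29], [21, 25, 22, 26], [27, 32, 28, 31]],
    ofCycles 32 [[1, 5], [2, 6], [3, 18], [4, 17], [7, 20], [8, 19], [9, 26], [10, 25], [11, 27],
      [12, 28], [13, 22], [14, 21], [15, 29], [16, 30], [23, 31], [24, 32]],
    ofCycles 32 [[1, 8, 2, 7], [3, 15, 4, 16], [5, 19, 6, 20], [9, 23, 10, 24], [11, 14, 12, 13],
      [17, 30, 18, 29], [21, 28, 22, 27], [25, 32, 26, 31]]]

set_option maxRecDepth 10000 in
theorem permRepGen_eq (i : Fin 4) : permRepGen i = (permGen i).permMatrix ℤ := by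
  fin_cases i <;> rfl

/-- The action of `G64` on 32 points. Since `P_s P_t` is the matrix of the permutation `t * s`, the
homomorphism sends the generators to the inverses of the given permutations. -/
def permHom : G64 →* Equiv.Perm (Fin 32) :=
  G64.lift (fun i => (permGen i)⁻¹) (by decide +kernel)

/-- The permutations that underlie the values of `ρ_M` on `a, b, c, d`. -/
def latticePerm : Fin 4 → Equiv.Perm (Fin 16) :=
  ![ofCycles 16 [[1, 7], [2, 5], [3, 11], [4, 6], [8, 12], [9, 13], [10, 14], [15, 16]],
    ofCycles 16 [[1, 2], [3, 9], [4, 8], [5, 7], [6, 12], [10, 15], [11, 13], [14, 16]],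
    ofCycles 16 [[1, 3], [2, 9], [4, 10], [5, 13], [6, 14], [7, 11], [8, 15], [12, 16]],
    ofCycles 16 [[1, 4], [2, 8], [3, 10], [5, 12], [6, 7], [9, 15], [11, 14], [13, 16]]]

/-- The signs of the rows in the values of `ρ_M` on `a, b, c, d`. -/
def latticeSign (i : Fin 4) (k : Fin 16) : ℤˣ :=
  if (k : ℕ) + 1 ∈ (![[8, 9, 12, 13], [2, 3, 5, 6, 8, 10, 13, 14], [2, 4, 5, 7, 9, 10, 11, 13],
    [1, 6, 8, 9, 10, 11, 12, 13]] : Fin 4 → List ℕ) i then -1 else 1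

set_option maxRecDepth 10000 in
theorem latticeRepGen_eq (i : Fin 4) : latticeRepGen i =
    Matrix.diagonal (fun k => (latticeSign i k : ℤ)) * (latticePerm i).permMatrix ℤ := by
  have h : (fun k => (latticeSign i k : ℤ)) = fun k : Fin 16 => if (k : ℕ) + 1 ∈
      (![[8, 9, 12, 13], [2, 3, 5, 6, 8, 10, 13, 14], [2, 4, 5, 7, 9, 10, 11, 13],
        [1, 6, 8, 9, 10, 11, 12, 13]] : Fin 4 → List ℕ) i then (-1 : ℤ) else 1 := by
    ext k
    unfold latticeSign
    split_ifs <;> rfl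
  rw [h]
  fin_cases i <;> rfl

/-- The values of the cocycle on `a, b, c, d`, multiplied by two. -/
def cocycleBit : Fin 4 → Fin 16 → ℕ :=
  ![![0, 1, 0, 0, 0, 1, 1, 1, 1, 0, 1, 0, 0, 1, 1, 0],
    ![0, 0, 0, 1, 0, 1, 0, 1, 0, 1, 0, 1, 0, 1, 1, 1],
    ![0, 1, 1, 0, 0, 1, 1, 1, 0, 1, 0, 0, 1, 0, 0, 1],
    ![0, 0, 0, 0, 0, 0, 0, 0, 0, 0, 0, 0, 0, 0, 0, 0]]

theorem cocycleGen_eq (i : Fin 4) : cocycleGen i = halves (cocycleBit i) := by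
  fin_cases i <;> rfl

/-- The group of the maps `x ↦ A x + v` of `ℚⁿ/ℤⁿ`, where `A` is a signed permutation matrix and
`2 v = 0`; the entries of `A` and `2 v` are recorded as a function to `{±1} × 𝔽₂`. The signs act
trivially on the elements of order two. -/
abbrev AffineMonomial (n : ℕ) : Type :=
  (Fin n → ℤˣ × Multiplicative (ZMod 2)) ⋊[mulAutArrow] Equiv.Perm (Fin n)


/-- The pairs of a matrix of `ρ_M` and a value of the cocycle for the four generators. -/
def latticeHomGen (i : Fin 4) : AffineMonomial 16 :=
  ⟨fun k => (latticeSign i k, Multiplicative.ofAdd (cocycleBit i k : ZMod 2)), (latticePerm i)⁻¹⟩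

theorem relations_latticeHomGen : Relations latticeHomGen := by
  unfold Relations
  refine ⟨⟨?_, ?_, ?_, ?_⟩, ⟨?_, ?_, ?_, ?_, ?_, ?_⟩, ?_, ?_, ?_, ?_, ?_, ?_⟩ <;>
    refine SemidirectProduct.ext (funext ?_) ?_ <;> decide +kernel

/-- The homomorphism `g ↦ (ρ_M(g), α̂(g))`. That it is well defined means both that `ρ_M` is a
representation and that `α̂` is a 1-cocycle. -/
def latticeHom : G64 →* AffineMonomial 16 :=
  G64.lift latticeHomGen relations_latticeHomGen

section SignedAction

/-- The sign of row `k` of the signed permutation matrix `ρ_M(g)`. -/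
def sgn (g : G64) (k : Fin 16) : ℤˣ := ((latticeHom g).left k).1

/-- Twice the entry `k` of the value of the cocycle at `g`. -/
def bit (g : G64) (k : Fin 16) : ZMod 2 := Multiplicative.toAdd ((latticeHom g).left k).2

/-- The column of the non-zero entry in row `k` of `ρ_M(g)`. -/
def src (g : G64) (k : Fin 16) : Fin 16 := (latticeHom g).right⁻¹ k

theorem src_mul (g h : G64) (k : Fin 16) : src (g * h) k = src h (src g k) := by
  simp [src]

theorem sgn_mul (g h : G64) (k : Fin 16) : sgn (g * h) k = sgn g k * sgn h (src g k) := by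
  rw [sgn, map_mul]
  rfl

theorem bit_mul (g h : G64) (k : Fin 16) : bit (g * h) k = bit g k + bit h (src g k) := by
  rw [bit, map_mul]
  rfl

@[simp] theorem src_one (k : Fin 16) : src 1 k = k := by simp [src]
@[simp] theorem sgn_one (k : Fin 16) : sgn 1 k = 1 := by simp [sgn]
@[simp] theorem bit_one (k : Fin 16) : bit 1 k = 0 := by simp [bit]

theorem src_of (i : Fin 4) (k : Fin 16) : src (PresentedGroup.of i) k = latticePerm i k := by
  simp [src, latticeHom, latticeHomGen]

theorem sgn_of (i : Fin 4) (k : Fin 16) : sgn (PresentedGroup.of i) k = latticeSign i k := by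
  simp [sgn, latticeHom, latticeHomGen]

theorem bit_of (i : Fin 4) (k : Fin 16) : bit (PresentedGroup.of i) k = cocycleBit i k := by
  simp [bit, latticeHom, latticeHomGen]

theorem src_bijective (g : G64) : Function.Bijective (src g) := (latticeHom g).right⁻¹.bijective

variable {A : Type*} [AddCommGroup A]

/-- The action of `G64` on `A ^ 16` by the signed permutation matrices `ρ_M(g)`. -/
def signedAct (g : G64) (v : Fin 16 → A) : Fin 16 → A := fun k => (sgn g k : ℤ) • v (src g k)

theorem signedAct_apply (g : G64) (v : Fin 16 → A) (k : Fin 16) :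
    signedAct g v k = (sgn g k : ℤ) • v (src g k) := rfl

theorem signedAct_mul (g h : G64) (v : Fin 16 → A) :
    signedAct (g * h) v = signedAct g (signedAct h v) := by
  ext k
  simp [signedAct, sgn_mul, src_mul, mul_smul]

@[simp] theorem signedAct_one (v : Fin 16 → A) : signedAct 1 v = v := by
  ext k
  simp [signedAct]

theorem signedAct_add (g : G64) (v w : Fin 16 → A) :
    signedAct g (v + w) = signedAct g v + signedAct g w := by
  ext k
  simp [signedAct]

end SignedAction

/-- The representation `ρ_M`. -/
def latticeRep : Representation ℤ G64 (Fin 16 → ℤ) where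
  toFun g :=
    { toFun := signedAct g
      map_add' := signedAct_add g
      map_smul' := fun n v => by
        ext k
        simp [signedAct, mul_left_comm] }
  map_one' := LinearMap.ext fun v => signedAct_one v
  map_mul' g h := LinearMap.ext fun v => signedAct_mul g h v

theorem latticeRep_apply (g : G64) (v : Fin 16 → ℤ) : latticeRep g v = signedAct g v := rfl

theorem latticeRep_of (i : Fin 4) :
    latticeRep (PresentedGroup.of i) = Matrix.toLin' (latticeRepGen i) := by
  refine LinearMap.ext fun v => funext fun k => ?_
  rw [latticeRep_apply, signedAct_apply, sgn_of, src_of, Matrix.toLin'_apply, latticeRepGen_eq,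
    ← Matrix.mulVec_mulVec, Matrix.mulVec_diagonal, Matrix.permMatrix_mulVec, smul_eq_mul,
    Function.comp_apply]

theorem toMatrix'_latticeRep (g : G64) (i j : Fin 16) :
    LinearMap.toMatrix' (latticeRep g) i j = if j = src g i then (sgn g i : ℤ) else 0 := by
  rw [LinearMap.toMatrix'_apply, latticeRep_apply, signedAct_apply]
  simp [Pi.single_apply, eq_comm]

theorem intMulVec_latticeRep {A : Type} [AddCommGroup A] (g : G64) (v : Fin 16 → A) :
    intMulVec (LinearMap.toMatrix' (latticeRep g)) v = signedAct g v := by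
  ext i
  simp only [intMulVec, toMatrix'_latticeRep, ite_smul, zero_smul, Finset.sum_ite_eq',
    Finset.mem_univ, if_true, signedAct]

theorem trace_latticeRep (g : G64) : LinearMap.trace ℤ _ (latticeRep g) = 4 * chi₁ g := by
  classical
  have h1 : LinearMap.trace ℤ _ (latticeRep g) = ∑ k, if k = src g k then (sgn g k : ℤ) else 0 := by
    rw [LinearMap.trace_eq_matrix_trace ℤ (Pi.basisFun ℤ (Fin 16)), LinearMap.toMatrix_eq_toMatrix']
    exact Finset.sum_congr rfl fun k _ => toMatrix'_latticeRep g k k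
  have h2 : ∀ m : Model, (∑ k : Fin 16, if k = src (G64.ofModel m) k
      then (sgn (G64.ofModel m) k : ℤ) else 0) =
      4 * if m = 1 ∨ m = ⟨0, 0, 0, 0, 1, 0⟩ then 4 else
        if m.u₀ = 0 ∧ m.u₁ = 0 ∧ m.u₂ = 0 ∧ m.u₃ = 0 then -4 else 0 := by
    intro m
    simp only [src, sgn, latticeHom, G64.ofModel, G64.a, G64.b, G64.c, G64.d, map_mul, map_pow,
      G64.lift_of]
    revert m
    decide +kernel
  rw [h1, chi₁, G64.chi_eq, ← G64.ofModel_toModel g, h2, G64.ofModel_toModel]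
  simp only [G64.mem_center_iff_model, ← G64.equivModel.injective.eq_iff, map_one,
    G64.equivModel_a_sq]
  rfl

theorem latticeRep_a_sq (v : Fin 16 → ℤ) : latticeRep (G64.a ^ 2) v = v := by
  have h : ∀ k, src (G64.a ^ 2) k = k ∧ sgn (G64.a ^ 2) k = 1 := by
    simp only [src, sgn, latticeHom, G64.a, map_pow, G64.lift_of]
    decide +kernel
  ext k
  rw [latticeRep_apply, signedAct_apply, (h k).1, (h k).2]
  simp

theorem latticeRep_b_sq (v : Fin 16 → ℤ) : latticeRep (G64.b ^ 2) v = -v := by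
  have h : ∀ k, src (G64.b ^ 2) k = k ∧ sgn (G64.b ^ 2) k = -1 := by
    simp only [src, sgn, latticeHom, G64.b, map_pow, G64.lift_of]
    decide +kernel
  ext k
  rw [latticeRep_apply, signedAct_apply, (h k).1, (h k).2]
  simp

theorem bit_a_sq (k : Fin 16) : bit (G64.a ^ 2) k = 1 := by
  revert k
  simp only [bit, latticeHom, G64.a, map_pow, G64.lift_of]
  decide +kernel

/-- The element `x / 2` of `ℚ / ℤ`, where `x` is `0` or `1`. -/
def halfCircle (x : ZMod 2) : AddCircle (1 : ℚ) := (((x.val : ℚ) / 2 : ℚ) : AddCircle (1 : ℚ))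

theorem halfCircle_add (x y : ZMod 2) : halfCircle (x + y) = halfCircle x + halfCircle y := by
  have h : ((1 / 2 : ℚ) : AddCircle (1 : ℚ)) + ((1 / 2 : ℚ) : AddCircle (1 : ℚ)) = 0 := by
    rw [← AddCircle.coe_add]
    norm_num
  have h2 : (1 + 1 : ZMod 2) = 0 := by decide
  have hx : ∀ x : ZMod 2, x = 0 ∨ x = 1 := by decide
  obtain rfl | rfl := hx x <;> obtain rfl | rfl := hx y <;>
    simp [halfCircle, ZMod.val_one, h2] at h ⊢
  exact h.symm

theorem units_smul_halfCircle (u : ℤˣ) (x : ZMod 2) : (u : ℤ) • halfCircle x = halfCircle x := by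
  have h : halfCircle x + halfCircle x = 0 := by
    rw [← halfCircle_add, CharTwo.add_self_eq_zero]
    simp [halfCircle]
  obtain rfl | rfl := Int.units_eq_one_or u
  · simp
  · simpa using neg_eq_of_add_eq_zero_left h

/-- The 1-cocycle `α̂ : G → ℚ¹⁶/ℤ¹⁶`. -/
def latticeCocycle (g : G64) (k : Fin 16) : AddCircle (1 : ℚ) := halfCircle (bit g k)

theorem isCocycle_latticeCocycle : IsCocycle latticeRep latticeCocycle := by
  intro g h
  ext k
  rw [intMulVec_latticeRep, Pi.add_apply, signedAct_apply]
  simp only [latticeCocycle]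
  rw [units_smul_halfCircle, bit_mul, halfCircle_add]

theorem latticeCocycle_of (i : Fin 4) : latticeCocycle (PresentedGroup.of i) = cocycleGen i := by
  ext k
  rw [cocycleGen_eq, latticeCocycle, bit_of, halfCircle, halves]
  have h : ∀ i k, ((cocycleBit i k : ZMod 2)).val = cocycleBit i k := by decide +kernel
  rw [h]

/-- The permutation representation `ρ₁`. -/
def permRep : Representation ℤ G64 (Fin 32 → ℤ) where
  toFun g := LinearMap.funLeft ℤ ℤ ((permHom g)⁻¹ : Equiv.Perm (Fin 32))
  map_one' := by
    rw [map_one]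
    rfl
  map_mul' g h := by
    refine LinearMap.ext fun v => ?_
    rw [map_mul, mul_inv_rev]
    rfl

theorem permRep_apply (g : G64) (v : Fin 32 → ℤ) (k : Fin 32) :
    permRep g v k = v ((permHom g)⁻¹ k) := rfl

theorem permRep_of (i : Fin 4) :
    permRep (PresentedGroup.of i) = Matrix.toLin' (permRepGen i) := by
  refine LinearMap.ext fun v => funext fun k => ?_
  rw [permRep_apply, permHom, G64.lift_of, inv_inv, Matrix.toLin'_apply, permRepGen_eq,
    Matrix.permMatrix_mulVec, Function.comp_apply]

theorem permHom_ofModel (m : Model) : permHom (G64.ofModel m) =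
    (permGen 0)⁻¹ ^ m.u₀.val * ((permGen 1)⁻¹ ^ m.u₁.val * ((permGen 2)⁻¹ ^ m.u₂.val *
      ((permGen 3)⁻¹ ^ m.u₃.val * (((permGen 0)⁻¹ ^ 2) ^ m.z₀.val *
        ((permGen 1)⁻¹ ^ 2) ^ m.z₁.val)))) := by
  simp only [permHom, G64.ofModel, G64.a, G64.b, G64.c, G64.d, map_mul, map_pow, G64.lift_of]

theorem permHom_a_sq : permHom (G64.a ^ 2) = 1 := by
  simp only [permHom, G64.a, map_pow, G64.lift_of]
  decide +kernel

theorem permHom_apply_zero_eq_zero_iff (g : G64) :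
    permHom g 0 = 0 ↔ g ∈ Subgroup.zpowers (G64.a ^ 2) := by
  constructor
  · intro hg
    have h : ∀ m : Model, permHom (G64.ofModel m) 0 = 0 → m = 1 ∨ m = ⟨0, 0, 0, 0, 1, 0⟩ := by
      simp only [permHom_ofModel]
      decide +kernel
    have h1 := h (G64.equivModel g) 
      ((congrArg (fun x => permHom x 0) (G64.ofModel_toModel g)).trans hg)
    rw [← map_one G64.equivModel, ← G64.equivModel_a_sq, G64.equivModel.injective.eq_iff,
      G64.equivModel.injective.eq_iff] at h1
    obtain rfl | rfl := h1
    exacts [one_mem _, Subgroup.mem_zpowers _]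
  · rintro ⟨n, rfl⟩
    simp [permHom_a_sq]

theorem exists_permHom_zero (k : Fin 32) : ∃ g, permHom g 0 = k := by
  have h : ∀ k, ∃ m : Model, permHom (G64.ofModel m) 0 = k := by
    simp only [permHom_ofModel]
    decide +kernel
  exact ⟨_, (h k).choose_spec⟩

/-- The map from the cosets of `⟨a²⟩` to the 32 points given by the orbit of the point `0`, whose
stabilizer is `⟨a²⟩`. -/
def cosetMap : (G64 ⧸ Subgroup.zpowers (G64.a ^ 2)) → Fin 32 :=
  Quotient.lift (fun g => permHom g 0) (by
    intro g h hgh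
    rw [← Quotient.eq_iff_equiv] at hgh
    have := QuotientGroup.eq.1 hgh
    rw [← permHom_apply_zero_eq_zero_iff, map_mul, map_inv, Equiv.Perm.mul_apply,
      Equiv.Perm.inv_eq_iff_eq] at this
    exact this.symm)

theorem cosetMap_bijective : Function.Bijective cosetMap := by
  constructor
  · intro x y
    induction x using QuotientGroup.induction_on with | _ g
    induction y using QuotientGroup.induction_on with | _ h
    intro hgh
    refine QuotientGroup.eq.2 ?_
    rw [← permHom_apply_zero_eq_zero_iff, map_mul, map_inv, Equiv.Perm.mul_apply,
      Equiv.Perm.inv_eq_iff_eq]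
    exact hgh.symm
  · intro k
    obtain ⟨g, hg⟩ := exists_permHom_zero k
    exact ⟨g, hg⟩

theorem cosetMap_smul (g : G64) (x : G64 ⧸ Subgroup.zpowers (G64.a ^ 2)) :
    cosetMap (g • x) = permHom g (cosetMap x) := by
  induction x using QuotientGroup.induction_on with | _ h
  change permHom (g * h) 0 = permHom g (permHom h 0)
  rw [map_mul, Equiv.Perm.mul_apply]

theorem nonempty_permRep_equiv : Nonempty (permRep.Equiv
    (Representation.ofMulAction ℤ G64 (G64 ⧸ Subgroup.zpowers (G64.a ^ 2)))) := by
  let e : (Fin 32 → ℤ) ≃ₗ[ℤ] MonoidAlgebra ℤ (G64 ⧸ Subgroup.zpowers (G64.a ^ 2)) :=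
    (LinearEquiv.funCongrLeft ℤ ℤ (Equiv.ofBijective _ cosetMap_bijective)).trans
      ((Finsupp.linearEquivFunOnFinite ℤ ℤ _).symm.trans (MonoidAlgebra.coeffLinearEquiv ℤ).symm)
  refine ⟨Representation.Equiv.mk e fun g => LinearMap.ext fun v => ?_⟩
  refine MonoidAlgebra.ext <| Finsupp.ext fun x => ?_
  refine Eq.trans ?_ (Representation.coeff_ofMulAction g _ x).symm
  change v ((permHom g)⁻¹ (cosetMap x)) = v (cosetMap (g⁻¹ • x))
  rw [cosetMap_smul, map_inv]

/-- The index `i` of the pair `{2i, 2i + 1}` that contains `j`. -/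
def half (j : Fin 32) : Fin 16 := ⟨j / 2, by omega⟩

/-- The sign of the `j`-th entry of the vector `e_{2i} - e_{2i+1}` for `j ∈ {2i, 2i + 1}` (points
labelled from `0`). -/
def paritySign (j : Fin 32) : ℤˣ := if (j : ℕ) % 2 = 0 then 1 else -1

theorem latticeIncl_apply (x : Fin 16 → ℤ) (j : Fin 32) :
    latticeIncl x j = paritySign j * x (half j) := by
  rw [latticeIncl, Fintype.linearCombination_apply, Finset.sum_apply,
    Finset.sum_eq_single (half j)]
  · have h : ∀ j : Fin 32, ((Pi.single (⟨2 * half j, by omega⟩ : Fin 32) 1 -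
      Pi.single (⟨2 * half j + 1, by omega⟩ : Fin 32) 1 : Fin 32 → ℤ)) j = paritySign j := by
      decide +kernel
    rw [Pi.smul_apply, h, smul_eq_mul, mul_comm]
  · intro i _ hi
    have h : ∀ (i : Fin 16) (j : Fin 32), i ≠ half j →
      ((Pi.single (⟨2 * i, by omega⟩ : Fin 32) 1 -
        Pi.single (⟨2 * i + 1, by omega⟩ : Fin 32) 1 : Fin 32 → ℤ)) j = 0 := by
      decide +kernel
    rw [Pi.smul_apply, h i j hi, smul_zero]
  · simp

theorem latticeIncl_injective : Function.Injective latticeIncl := by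
  have h1 : ∀ i : Fin 16, half ⟨2 * i, by omega⟩ = i ∧ paritySign ⟨2 * i, by omega⟩ = 1 := by
    decide +kernel
  intro x y hxy
  ext i
  have h := congrFun hxy ⟨2 * i, by omega⟩
  simpa [latticeIncl_apply, h1] using h

theorem latticeIncl_latticeRep (g : G64) (x : Fin 16 → ℤ) :
    latticeIncl (latticeRep g x) = permRep g (latticeIncl x) := by
  induction g using G64.induction_of generalizing x with
  | one => rw [map_one, map_one]; rfl
  | of i =>
    ext j
    have h : ∀ (i : Fin 4) (j : Fin 32), latticePerm i (half j) = half (permGen i j) ∧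
        paritySign j * latticeSign i (half j) = paritySign (permGen i j) := by
      decide +kernel
    rw [permRep_apply, latticeIncl_apply, latticeIncl_apply, latticeRep_apply, signedAct_apply,
      src_of, sgn_of, permHom, G64.lift_of, inv_inv, (h i j).1, ← (h i j).2, smul_eq_mul,
      Units.val_mul, mul_assoc]
  | mul g h ihg ihh =>
    rw [map_mul, map_mul, Module.End.mul_apply, Module.End.mul_apply, ihg, ihh]

theorem finsum_chi₁_smul {A : Type*} [AddCommGroup A] (F : G64 → A) :
    (∑ᶠ g, chi₁ g • F g) = (4 : ℤ) • (F 1 + F (G64.a ^ 2) - F (G64.b ^ 2) -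
      F (G64.a ^ 2 * G64.b ^ 2)) := by
  classical
  have hab : G64.equivModel (G64.a ^ 2 * G64.b ^ 2) = ⟨0, 0, 0, 0, 1, 1⟩ := by
    rw [map_mul, G64.equivModel_a_sq, G64.equivModel_b_sq]
    decide +kernel
  have ne : ∀ g h : G64, G64.equivModel g ≠ G64.equivModel h → g ≠ h :=
    fun g h hgh e => hgh (congrArg _ e)
  have h1 : (1 : G64) ≠ G64.a ^ 2 := ne _ _ (by
    rw [map_one, G64.equivModel_a_sq]
    decide)
  have h2 : (1 : G64) ≠ G64.b ^ 2 := ne _ _ (by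
    rw [map_one, G64.equivModel_b_sq]
    decide)
  have h3 : (1 : G64) ≠ G64.a ^ 2 * G64.b ^ 2 := ne _ _ (by
    rw [map_one, hab]
    decide)
  have h4 : G64.a ^ 2 ≠ G64.b ^ 2 := ne _ _ (by
    rw [G64.equivModel_a_sq, G64.equivModel_b_sq]
    decide)
  have h5 : G64.a ^ 2 ≠ G64.a ^ 2 * G64.b ^ 2 := ne _ _ (by
    rw [G64.equivModel_a_sq, hab]
    decide)
  have h6 : G64.b ^ 2 ≠ G64.a ^ 2 * G64.b ^ 2 := ne _ _ (by
    rw [G64.equivModel_b_sq, hab]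
    decide)
  rw [finsum_eq_finsetSum_of_support_subset (s := {1, G64.a ^ 2, G64.b ^ 2,
    G64.a ^ 2 * G64.b ^ 2})]
  · rw [Finset.sum_insert (by simp [h1, h2, h3]), Finset.sum_insert (by simp [h4, h5]),
      Finset.sum_insert (by simp [h6]), Finset.sum_singleton]
    simp only [chi₁, chi, true_or, or_true, if_true, h2.symm, h3.symm, h4.symm, h5.symm, or_false,
      if_false, h6.symm]
    module
  · intro g hg
    by_contra hg'
    simp only [Finset.coe_insert, Finset.coe_singleton, Set.mem_insert_iff,
      Set.mem_singleton_iff, not_or] at hg'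
    exact hg (by simp [chi₁, chi, hg'])

/-- Since `a²` acts trivially on the 32 points, the operator that belongs to `χ₁` is
`8 (1 - ρ₁(b²))`, and `ρ₁(b²)` exchanges the points `2i` and `2i + 1`. -/
theorem finsum_chi₁_smul_permRep (w : Fin 32 → ℤ) :
    (∑ᶠ g, chi₁ g • permRep g) w = (8 : ℤ) • (w - permRep (G64.b ^ 2) w) := by
  have h : permRep (G64.a ^ 2) = 1 := by
    refine LinearMap.ext fun v => funext fun k => ?_
    rw [permRep_apply, permHom_a_sq]
    rfl
  rw [finsum_chi₁_smul, map_mul, h, map_one, one_mul]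
  ext k
  simp only [LinearMap.smul_apply, LinearMap.sub_apply, LinearMap.add_apply, Module.End.one_apply,
    Pi.smul_apply, Pi.sub_apply, Pi.add_apply, smul_eq_mul]
  ring

theorem mem_range_latticeIncl_iff (v : Fin 32 → ℤ) :
    v ∈ LinearMap.range latticeIncl ↔
      ∃ (n : ℤ) (w : Fin 32 → ℤ), n ≠ 0 ∧ n • v = (∑ᶠ g, chi₁ g • permRep g) w := by
  simp only [finsum_chi₁_smul_permRep]
  constructor
  · rintro ⟨x, rfl⟩
    refine ⟨16, latticeIncl x, by norm_num, ?_⟩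
    rw [← latticeIncl_latticeRep, latticeRep_b_sq, map_neg, sub_neg_eq_add, ← two_smul ℤ, smul_smul]
    norm_num
  · rintro ⟨n, w, hn, h⟩
    have h1 : permRep (G64.b ^ 2) v = -v := by
      refine smul_right_injective _ hn ?_
      change n • permRep (G64.b ^ 2) v = n • -v
      have hb : permRep (G64.b ^ 2) (permRep (G64.b ^ 2) w) = w := by
        rw [← Module.End.mul_apply, ← map_mul, ← pow_add, G64.pow_four_eq_one, map_one,
          Module.End.one_apply]
      rw [smul_neg, h, ← map_smul, h, map_smul, map_sub, hb, ← smul_neg, neg_sub]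
    have h2 : ∀ j, (permHom (G64.b ^ 2))⁻¹ j =
        if (j : ℕ) % 2 = 0 then ⟨(j + 1) % 32, by omega⟩ else ⟨j - 1, by omega⟩ := by
      simp only [permHom, G64.b, map_pow, G64.lift_of]
      decide +kernel
    refine ⟨fun i => v ⟨2 * i, by omega⟩, funext fun j => ?_⟩
    have h3 := congrFun h1 j
    rw [permRep_apply, h2] at h3
    rw [latticeIncl_apply, paritySign, half]
    split_ifs at h3 ⊢ with hj
    · rw [Units.val_one, one_mul]
      congr 1
      ext
      simp
      omega
    · have : (⟨(j : ℕ) - 1, by omega⟩ : Fin 32) = ⟨2 * (j / 2 : ℕ), by omega⟩ := by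
        ext
        simp
        omega
      rw [this] at h3
      simp [h3]

end FlatQuat

namespace FlatQuat

open groupCohomology

/-! ### The cohomology class -/

section TotalCocycle

variable {k L : Type} [CommRing k] [AddCommGroup L] [Module k L] {ρ : Representation k G64 L}

/-- The 2-cocycle `(g, h) ↦ (c(g, h), c(f₂ g, f₂ h), c(f₃ g, f₃ h))`. -/
def totalCocycle (f₂ f₃ : MulAut G64) (c : cocycles₂ (Rep.of ρ)) :
    cocycles₂ (Rep.of (tripleRep ρ f₂ f₃)) :=
  ⟨fun p => ((c (p.1, p.2) : L), (c (f₂ p.1, f₂ p.2) : L), (c (f₃ p.1, f₃ p.2) : L)), by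
    rw [mem_cocycles₂_iff]
    intro g h j
    have H := (mem_cocycles₂_iff (c : G64 × G64 → L)).1 c.2
    refine Prod.ext (H g h j) (Prod.ext ?_ ?_)
    · have := H (f₂ g) (f₂ h) (f₂ j)
      rw [← map_mul, ← map_mul] at this
      exact this
    · have := H (f₃ g) (f₃ h) (f₃ j)
      rw [← map_mul, ← map_mul] at this
      exact this⟩

theorem totalClass_H2π (f₂ f₃ : MulAut G64) (c : cocycles₂ (Rep.of ρ)) :
    totalClass f₂ f₃ (H2π (Rep.of ρ) c) = H2π _ (totalCocycle f₂ f₃ c) := by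
  simp only [totalClass, pullback, pushforward, H2π_comp_map_apply]
  rw [← map_add, ← map_add]
  congr 1
  refine cocycles₂_ext (A := Rep.of (tripleRep ρ f₂ f₃)) fun g h => ?_
  refine Prod.ext ?_ (Prod.ext ?_ ?_)
  · exact (congrArg₂ (· + ·) (add_zero (c (g, h) : L)) rfl).trans (add_zero _)
  · exact (congrArg₂ (· + ·) (zero_add (c (f₂ g, f₂ h) : L)) rfl).trans (add_zero _)
  · exact (congrArg₂ (· + ·) (zero_add (0 : L)) rfl).trans (zero_add _)

/-- Every non-trivial subgroup contains an involution `z`, and if the restriction of `c` to it is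
the coboundary of `x`, then `c(z, z) = z x(z) - x(1) + x(z)` with `x(1) = c(1, 1)`. -/
theorem isSpecial_H2π {A : Rep.{0} k G64} (c : cocycles₂ A)
    (hc : ∀ z : G64, z ≠ 1 → z ^ 2 = 1 →
      ∀ x y : A, y = c (1, 1) → c (z, z) ≠ A.ρ z x - y + x) : IsSpecial (H2π A c) := by
  intro C hC _ h0
  obtain ⟨g, hg, hg1⟩ := C.bot_or_exists_ne_one.resolve_left hC
  obtain ⟨z, hz, hz1, hz2⟩ : ∃ z ∈ C, z ≠ 1 ∧ z ^ 2 = 1 := by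
    by_cases h : g ^ 2 = 1
    · exact ⟨g, hg, hg1, h⟩
    · exact ⟨g ^ 2, pow_mem hg 2, h, by rw [← pow_mul, G64.pow_four_eq_one]⟩
  rw [pullback, H2π_comp_map_apply, H2π_eq_zero_iff] at h0
  obtain ⟨x, hx⟩ := h0
  have h1 := congrFun hx (⟨z, hz⟩, ⟨z, hz⟩)
  have h2 := congrFun hx (1, 1)
  rw [d₁₂_hom_apply] at h1 h2
  have e : (⟨z, hz⟩ : C) * ⟨z, hz⟩ = 1 := Subtype.ext ((pow_two z).symm.trans hz2)
  refine hc z hz1 hz2 (x ⟨z, hz⟩) (x 1) ?_ ?_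
  · refine Eq.trans ?_ h2
    simp
  · refine h1.symm.trans ?_
    simp only [e]
    rfl

end TotalCocycle

/-- The lift of `α̂` to `ℚ¹⁶` with entries in `{0, 1/2}`, multiplied by two. -/
def doubleLift (g : G64) (k : Fin 16) : ℤ := (bit g k).val

theorem two_dvd_doubleLift (g h : G64) (k : Fin 16) :
    2 ∣ signedAct g (doubleLift h) k - doubleLift (g * h) k + doubleLift g k := by
  simp only [signedAct, doubleLift, bit_mul]
  generalize bit g k = x
  generalize bit h (src g k) = y
  generalize sgn g k = u
  revert u x y
  decide

/-- The value at `(g, h)` of the 2-cocycle `g • s(h) - s(gh) + s(g)`, where `s` is the lift of `α̂`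
with entries in `{0, 1/2}`. The division by two is exact. -/
def latticeCocycle₂Fun (g h : G64) (k : Fin 16) : ℤ :=
  (signedAct g (doubleLift h) k - doubleLift (g * h) k + doubleLift g k) / 2

theorem two_mul_latticeCocycle₂Fun (g h : G64) (k : Fin 16) :
    2 * latticeCocycle₂Fun g h k =
      signedAct g (doubleLift h) k - doubleLift (g * h) k + doubleLift g k :=
  Int.mul_ediv_cancel' (two_dvd_doubleLift g h k)

/-- The 2-cocycle of `G64` with values in `M` that represents the class `α`. -/
def latticeCocycle₂ : cocycles₂ (Rep.of latticeRep) :=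
  ⟨fun p => latticeCocycle₂Fun p.1 p.2, by
    rw [mem_cocycles₂_iff]
    intro g h j
    refine funext fun k => ?_
    change latticeCocycle₂Fun (g * h) j k + latticeCocycle₂Fun g h k =
      signedAct g (latticeCocycle₂Fun h j) k + latticeCocycle₂Fun g (h * j) k
    refine mul_left_cancel₀ (two_ne_zero' ℤ) ?_
    rw [mul_add, mul_add, two_mul_latticeCocycle₂Fun, two_mul_latticeCocycle₂Fun,
      two_mul_latticeCocycle₂Fun, signedAct_apply g (latticeCocycle₂Fun h j), smul_eq_mul,
      mul_left_comm, two_mul_latticeCocycle₂Fun, signedAct_mul, mul_assoc g h j]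
    simp only [signedAct_apply, smul_eq_mul]
    ring⟩

theorem latticeCocycle₂_apply (g h : G64) :
    (latticeCocycle₂ (g, h) : Fin 16 → ℤ) = latticeCocycle₂Fun g h := rfl

theorem isConnectingImage_latticeCocycle₂ :
    IsConnectingImage latticeRep latticeCocycle (H2π _ latticeCocycle₂) := by
  refine ⟨fun g k => (doubleLift g k : ℚ) / 2, latticeCocycle₂, fun g i => ?_, fun g h i => ?_, rfl⟩
  · simp [latticeCocycle, halfCircle, doubleLift]
  · rw [latticeCocycle₂_apply, intMulVec_latticeRep, signedAct_apply]
    have h1 := congrArg (Int.cast : ℤ → ℚ) (two_mul_latticeCocycle₂Fun g h i)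
    rw [signedAct_apply] at h1
    simp only [zsmul_eq_mul, smul_eq_mul] at h1 ⊢
    push_cast at h1
    linarith

theorem latticeCocycle₂Fun_one_one : latticeCocycle₂Fun 1 1 = 0 := by
  ext k
  simp [latticeCocycle₂Fun, signedAct, doubleLift]

theorem latticeCocycle₂Fun_a_sq : latticeCocycle₂Fun (G64.a ^ 2) (G64.a ^ 2) = 1 := by
  ext k
  have h : (G64.a ^ 2) * (G64.a ^ 2) = (1 : G64) := by rw [← pow_add, G64.pow_four_eq_one]
  have h2 := two_mul_latticeCocycle₂Fun (G64.a ^ 2) (G64.a ^ 2) k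
  rw [h, ← latticeRep_apply, latticeRep_a_sq] at h2
  simp only [doubleLift, bit_a_sq, bit_one] at h2
  change _ = (1 : ℤ)
  norm_num [ZMod.val_one] at h2
  omega

/-- For an involution `z`, let `j` be the component with `f_j(z) = a²`. There `z` acts trivially and
the cocycle has the value `(1, …, 1)` at `(z, z)`, which is not twice an integral vector. -/
theorem isSpecial_totalClass {f₂ f₃ : MulAut G64} (h₂ : ∀ g, chi₂ g = chi₁ (f₂ g))
    (h₃ : ∀ g, chi₃ g = chi₁ (f₃ g)) :
    IsSpecial (totalClass f₂ f₃ (H2π _ latticeCocycle₂)) := by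
  rw [totalClass_H2π]
  refine isSpecial_H2π _ fun z hz1 hz2 x y hy hx => ?_
  have key : ∀ (x : Fin 16 → ℤ), latticeCocycle₂Fun (G64.a ^ 2) (G64.a ^ 2) ≠
      latticeRep (G64.a ^ 2) x - latticeCocycle₂Fun 1 1 + x := by
    intro x hx
    rw [latticeCocycle₂Fun_a_sq, latticeCocycle₂Fun_one_one, latticeRep_a_sq] at hx
    have := congrFun hx 0
    simp at this
    omega
  subst hy
  obtain rfl | rfl | rfl | rfl := G64.eq_of_sq_eq_one hz2
  · exact hz1 rfl
  · exact key x.1 (congrArg Prod.fst hx)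
  · have e := G64.mulAut_apply_eq_a_sq hz1 h₂
    refine key x.2.1 ?_
    have := congrArg (fun v : (Fin 16 → ℤ) × (Fin 16 → ℤ) × (Fin 16 → ℤ) => v.2.1) hx
    change latticeCocycle₂Fun (f₂ _) (f₂ _) =
      latticeRep (f₂ _) x.2.1 - latticeCocycle₂Fun (f₂ 1) (f₂ 1) + x.2.1 at this
    rwa [e, map_one] at this
  · have e := G64.mulAut_apply_eq_a_sq hz1 h₃
    refine key x.2.2 ?_
    have := congrArg (fun v : (Fin 16 → ℤ) × (Fin 16 → ℤ) × (Fin 16 → ℤ) => v.2.2) hx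
    change latticeCocycle₂Fun (f₃ _) (f₃ _) =
      latticeRep (f₃ _) x.2.2 - latticeCocycle₂Fun (f₃ 1) (f₃ 1) + x.2.2 at this
    rwa [e, map_one] at this

end FlatQuat

namespace FlatQuat

/-! ### Irreducible representations on which the centre acts by non-trivial characters -/

section Irreducible

variable {K W : Type} [Field K] [AddCommGroup W] [Module K W] {τ : Representation K G64 W}

theorem exists_mulAut_a_sq {z : G64} (hz : z ≠ 1) (hz2 : z ^ 2 = 1) :
    ∃ φ : MulAut G64, φ (G64.a ^ 2) = z := by
  obtain ⟨f, hf⟩ : ∃ f : MulAut G64, ∀ g, chi z g = chi₁ (f g) := by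
    obtain rfl | rfl | rfl | rfl := G64.eq_of_sq_eq_one hz2
    · exact absurd rfl hz
    · exact ⟨1, fun g => rfl⟩
    · exact G64.exists_mulAut_chi₂
    · exact G64.exists_mulAut_chi₃
  exact ⟨f⁻¹, by rw [← G64.mulAut_apply_eq_a_sq hz hf, MulAut.inv_apply_self]⟩

/-- A submodule of an irreducible representation that is stable under the images of the generators
under an automorphism of `G64` is trivial. -/
theorem eq_bot_or_eq_top_of_twist (hτ : τ.IsIrreducible) (φ : MulAut G64) (S : Submodule K W)
    (hS : ∀ i, ∀ v ∈ S, twist τ φ (PresentedGroup.of i) v ∈ S) : S = ⊥ ∨ S = ⊤ := by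
  have h : ∀ g, ∀ v ∈ S, twist τ φ g v ∈ S := by
    intro g
    induction g using G64.induction_of with
    | one =>
      intro v hv
      rwa [map_one]
    | of i => exact hS i
    | mul g h ihg ihh =>
      intro v hv
      rw [map_mul]
      exact ihg _ (ihh _ hv)
  let S' : Subrepresentation τ := ⟨S, fun g v hv => by
    have := h (φ⁻¹ g) v hv
    change τ (φ (φ⁻¹ g)) v ∈ S at this
    rwa [MulAut.apply_inv_self] at this⟩
  obtain h | h := hτ.eq_bot_or_eq_top S'
  · exact Or.inl (congrArg Subrepresentation.toSubmodule h)
  · exact Or.inr (congrArg Subrepresentation.toSubmodule h)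

theorem commute_of_twist (φ : MulAut G64) (T : Module.End K W)
    (hT : ∀ i, Commute T (twist τ φ (PresentedGroup.of i))) (g : G64) : Commute T (τ g) := by
  have h : ∀ g, Commute T (twist τ φ g) := by
    intro g
    induction g using G64.induction_of with
    | one =>
      rw [map_one]
      exact Commute.one_right T
    | of i => exact hT i
    | mul g h ihg ihh =>
      rw [map_mul]
      exact ihg.mul_right ihh
  have := h (φ⁻¹ g)
  change Commute T (τ (φ (φ⁻¹ g))) at this
  rwa [MulAut.apply_inv_self] at this

theorem exists_ne_zero (hτ : τ.IsIrreducible) : ∃ w : W, w ≠ 0 := by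
  by_contra! h
  obtain ⟨S, T, hST⟩ := hτ.exists_pair_ne
  refine hST (Subrepresentation.toSubmodule_injective (Submodule.ext fun x => ?_))
  rw [h x]
  simp

/-- A central involution acts as a scalar, over any field: its `1`-eigenspace is stable under
`G64`. -/
theorem apply_eq_one_or_eq_neg_one (hτ : τ.IsIrreducible) {z : G64} (hz : z ∈ Subgroup.center G64)
    (hz2 : z ^ 2 = 1) : τ z = 1 ∨ τ z = -1 := by
  have hsq : ∀ v, τ z (τ z v) = v := fun v => by
    rw [← Module.End.mul_apply, ← map_mul, ← pow_two, hz2, map_one, Module.End.one_apply]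
  obtain h | h := eq_bot_or_eq_top_of_twist hτ 1 (LinearMap.ker (τ z - 1)) (fun i v hv => by
    rw [LinearMap.mem_ker, LinearMap.sub_apply, Module.End.one_apply, sub_eq_zero] at hv ⊢
    change τ z (τ (PresentedGroup.of i) v) = τ (PresentedGroup.of i) v
    rw [← Module.End.mul_apply, ← map_mul, ← (Subgroup.mem_center_iff.1 hz _), map_mul,
      Module.End.mul_apply, hv])
  · right
    refine LinearMap.ext fun v => ?_
    have : τ z v + v ∈ LinearMap.ker (τ z - 1) := by
      rw [LinearMap.mem_ker, LinearMap.sub_apply, Module.End.one_apply, map_add, hsq, add_comm,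
        sub_self]
    rw [h, Submodule.mem_bot] at this
    exact eq_neg_of_add_eq_zero_left this
  · left
    exact sub_eq_zero.1 (LinearMap.ker_eq_top.1 h)

/-- If the trivial character of the centre does not occur, then exactly one central involution acts
trivially, and after a twist by an automorphism of `G64` this is `a²`. -/
theorem exists_twist [CharZero K] (hτ : τ.IsIrreducible)
    (hsum : 1 + τ (G64.a ^ 2) + τ (G64.b ^ 2) + τ (G64.a ^ 2 * G64.b ^ 2) = 0) :
    ∃ φ : MulAut G64, twist τ φ (G64.a ^ 2) = 1 ∧ twist τ φ (G64.b ^ 2) = -1 := by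
  obtain ⟨w, hw⟩ := exists_ne_zero hτ
  have ha4 : (G64.a ^ 2) ^ 2 = 1 := by rw [← pow_mul, G64.pow_four_eq_one]
  have hb4 : (G64.b ^ 2) ^ 2 = 1 := by rw [← pow_mul, G64.pow_four_eq_one]
  have hab4 : (G64.a ^ 2 * G64.b ^ 2) ^ 2 = 1 := by
    rw [Commute.mul_pow (Subgroup.mem_center_iff.1 G64.b_sq_mem_center (G64.a ^ 2)), ha4, hb4,
      one_mul]
  -- an automorphism that sends `a²` to `z` sends `b²` to one of the two other involutions
  have key : ∀ z : G64, z ≠ 1 → z ^ 2 = 1 → τ z = 1 →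
      (∀ y : G64, y ≠ 1 → y ≠ z → y ^ 2 = 1 → τ y = -1) →
      ∃ φ : MulAut G64, twist τ φ (G64.a ^ 2) = 1 ∧ twist τ φ (G64.b ^ 2) = -1 := by
    intro z hz hz2 hτz h
    obtain ⟨φ, rfl⟩ := exists_mulAut_a_sq hz hz2
    refine ⟨φ, hτz, h (φ (G64.b ^ 2)) ?_ ?_ ?_⟩
    · rw [ne_eq, EmbeddingLike.map_eq_one_iff, ← G64.equivModel.injective.eq_iff,
        G64.equivModel_b_sq, map_one]
      decide
    · rw [ne_eq, EmbeddingLike.apply_eq_iff_eq, ← G64.equivModel.injective.eq_iff,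
        G64.equivModel_b_sq, G64.equivModel_a_sq]
      decide
    · rw [← map_pow, hb4, map_one]
  have h1 : (1 : Module.End K W) + 1 + 1 + 1 ≠ 0 := by
    intro h
    have := LinearMap.congr_fun h w
    simp only [LinearMap.add_apply, Module.End.one_apply, LinearMap.zero_apply] at this
    have h4 : (4 : K) • w = 0 := by rw [← this]; module
    exact hw ((smul_eq_zero.1 h4).resolve_left (by norm_num))
  rw [map_mul] at hsum
  have hab : τ (G64.a ^ 2 * G64.b ^ 2) = τ (G64.a ^ 2) * τ (G64.b ^ 2) := map_mul _ _ _
  have ha1 : G64.a ^ 2 ≠ 1 := by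
    rw [ne_eq, ← G64.equivModel.injective.eq_iff, G64.equivModel_a_sq, map_one]
    decide
  have hb1 : G64.b ^ 2 ≠ 1 := by
    rw [ne_eq, ← G64.equivModel.injective.eq_iff, G64.equivModel_b_sq, map_one]
    decide
  have hab1 : G64.a ^ 2 * G64.b ^ 2 ≠ 1 := by
    rw [ne_eq, ← G64.equivModel.injective.eq_iff, map_mul, G64.equivModel_a_sq,
      G64.equivModel_b_sq, map_one]
    decide
  obtain ha | ha := apply_eq_one_or_eq_neg_one hτ G64.a_sq_mem_center ha4 <;>
    obtain hb | hb := apply_eq_one_or_eq_neg_one hτ G64.b_sq_mem_center hb4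
  · rw [ha, hb, one_mul] at hsum
    exact absurd hsum h1
  · exact ⟨1, ha, hb⟩
  · refine key _ hb1 hb4 hb fun y hy1 hy2 hy3 => ?_
    obtain rfl | rfl | rfl | rfl := G64.eq_of_sq_eq_one hy3
    · exact absurd rfl hy1
    · exact ha
    · exact absurd rfl hy2
    · rw [hab, ha, hb, mul_one]
  · refine key _ hab1 hab4 (by rw [hab, ha, hb, neg_mul_neg, one_mul]) fun y hy1 hy2 hy3 => ?_
    obtain rfl | rfl | rfl | rfl := G64.eq_of_sq_eq_one hy3
    · exact absurd rfl hy1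
    · exact ha
    · exact hb
    · exact absurd rfl hy2

/-- The identity has 4 square roots in `G64` and each central involution has 20. -/
theorem sum_sq_eq (z : G64) (hz : z ≠ 1) (hz2 : z ^ 2 = 1) [DecidableEq G64] :
    (∑ g : G64, if g ^ 2 = 1 ∨ g ^ 2 = z then (1 : ℤ) else -1) = -16 := by
  have h : ∀ z : Model, z ≠ 1 → z ^ 2 = 1 →
      (∑ g : Model, if g ^ 2 = 1 ∨ g ^ 2 = z then (1 : ℤ) else -1) = -16 := by
    decide +kernel
  rw [← h (G64.equivModel z) (by simpa using hz) (by rw [← map_pow, hz2, map_one]),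
    ← G64.equivModel.toEquiv.sum_comp]
  refine Finset.sum_congr rfl fun g _ => if_congr ?_ rfl rfl
  simp only [MulEquiv.toEquiv_eq_coe, MulEquiv.coe_toEquiv, ← map_pow,
    G64.equivModel.injective.eq_iff, EmbeddingLike.map_eq_one_iff]

end Irreducible

section Operators

variable {K W : Type} [Field K] [AddCommGroup W] [Module K W] {σ : Representation K G64 W}

theorem map_mul_map_of_commutator {x y z : G64} (h : ⁅x, y⁆ = z) :
    σ x * σ y = σ z * (σ y * σ x) := by
  rw [← map_mul, ← map_mul, ← map_mul, ← h, commutatorElement_def]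
  group

/-- If `a²` acts as `1` and `b²` as `-1`, then `a` and `c` generate a split quaternion algebra that
commutes with `b` and `dc` (see `j_relations`). -/
theorem operator_relations (h1 : σ (G64.a ^ 2) = 1) (h2 : σ (G64.b ^ 2) = -1) :
    (σ G64.a * σ G64.a = 1 ∧ σ G64.b * σ G64.b = -1 ∧ σ G64.c * σ G64.c = 1 ∧
      σ G64.d * σ G64.d = -1) ∧
    σ G64.a * σ G64.b = σ G64.b * σ G64.a ∧ σ G64.a * σ G64.c = -(σ G64.c * σ G64.a) ∧
    σ G64.a * σ G64.d = -(σ G64.d * σ G64.a) ∧ σ G64.b * σ G64.c = σ G64.c * σ G64.b ∧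
    σ G64.b * σ G64.d = -(σ G64.d * σ G64.b) ∧ σ G64.c * σ G64.d = σ G64.d * σ G64.c := by
  obtain ⟨⟨-, -, hac, hbd⟩, ⟨h01, h02, h03, h12, h13, h23⟩, -⟩ := G64.relations
  simp only [Matrix.cons_val] at *
  refine ⟨⟨?_, ?_, ?_, ?_⟩, ?_, ?_, ?_, ?_, ?_, ?_⟩
  · rw [← map_mul, ← pow_two, h1]
  · rw [← map_mul, ← pow_two, h2]
  · rw [← map_mul, ← pow_two, ← hac, h1]
  · rw [← map_mul, ← pow_two, ← hbd, h2]
  · rw [map_mul_map_of_commutator h01, h1, one_mul]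
  · rw [map_mul_map_of_commutator h02, map_mul, h1, h2, one_mul, neg_one_mul]
  · rw [map_mul_map_of_commutator h03, h2, neg_one_mul]
  · rw [map_mul_map_of_commutator h12, h1, one_mul]
  · rw [map_mul_map_of_commutator h13, map_mul, h1, h2, one_mul, neg_one_mul]
  · rw [map_mul_map_of_commutator h23, map_one, one_mul]

/-- `dc` and `b` satisfy the relations of the quaternions `j` and `i`, and they commute with `a` and
`c`. -/
theorem j_relations (h1 : σ (G64.a ^ 2) = 1) (h2 : σ (G64.b ^ 2) = -1) :
    (σ G64.d * σ G64.c) * (σ G64.d * σ G64.c) = -1 ∧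
    (σ G64.d * σ G64.c) * σ G64.b = -(σ G64.b * (σ G64.d * σ G64.c)) ∧
    (σ G64.d * σ G64.c) * σ G64.a = σ G64.a * (σ G64.d * σ G64.c) ∧
    (σ G64.d * σ G64.c) * σ G64.c = σ G64.c * (σ G64.d * σ G64.c) := by
  obtain ⟨⟨ha, hb, hc, hd⟩, hab, hac, had, hbc, hbd, hcd⟩ := operator_relations h1 h2
  refine ⟨?_, ?_, ?_, ?_⟩
  · rw [mul_assoc, ← mul_assoc (σ G64.c), hcd, mul_assoc, hc, mul_one, hd]
  · rw [mul_assoc, ← hbc, ← mul_assoc, ← mul_assoc, hbd, neg_mul, neg_neg]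
  · rw [mul_assoc, eq_comm, ← mul_assoc, had, neg_mul, mul_assoc, hac, mul_neg, neg_neg]
  · rw [mul_assoc, hc, ← mul_assoc, hcd, mul_assoc, hc]

/-- Either `w + a w` or `c w` is a fixed vector of `a`. -/
theorem exists_apply_a_eq (h1 : σ (G64.a ^ 2) = 1) (h2 : σ (G64.b ^ 2) = -1)
    {w : W} (hw : w ≠ 0) :
    ∃ v : W, v ≠ 0 ∧ σ G64.a v = v := by
  obtain ⟨⟨ha, -, hc, -⟩, -, hac, -⟩ := operator_relations h1 h2
  have haa : ∀ v, σ G64.a (σ G64.a v) = v := fun v => LinearMap.congr_fun ha v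
  by_cases h : w + σ G64.a w = 0
  · refine ⟨σ G64.c w, fun h0 => hw ?_, ?_⟩
    · have := LinearMap.congr_fun hc w
      rw [Module.End.mul_apply, h0, map_zero] at this
      exact this.symm
    · have := LinearMap.congr_fun hac w
      rw [LinearMap.neg_apply, Module.End.mul_apply, Module.End.mul_apply, ← map_neg,
        ← eq_neg_of_add_eq_zero_left h] at this
      exact this
  · exact ⟨_, h, by rw [map_add, haa, add_comm]⟩

end Operators

/-! ### Quaternionic type -/

section Quaternionic

variable {W : Type} [AddCommGroup W] [Module ℝ W] {σ : Representation ℝ G64 W}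

/-- The quaternion `i`. -/
def quaternionI : ℍ[ℝ] := ⟨0, 1, 0, 0⟩

/-- The quaternion `j`. -/
def quaternionJ : ℍ[ℝ] := ⟨0, 0, 1, 0⟩

/-- The action of the quaternions for which `i` acts as `b` and `j` as `dc`. -/
def quaternionHom (h1 : σ (G64.a ^ 2) = 1) (h2 : σ (G64.b ^ 2) = -1) :
    ℍ[ℝ] →ₐ[ℝ] Module.End ℝ W :=
  QuaternionAlgebra.Basis.liftHom
    { i := σ G64.b
      j := σ G64.d * σ G64.c
      k := σ G64.b * (σ G64.d * σ G64.c)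
      i_mul_i := by rw [(operator_relations h1 h2).1.2.1]; simp
      j_mul_j := by rw [(j_relations h1 h2).1]; simp
      i_mul_j := rfl
      j_mul_i := by rw [(j_relations h1 h2).2.1]; simp }

theorem quaternionHom_apply (h1 : σ (G64.a ^ 2) = 1) (h2 : σ (G64.b ^ 2) = -1) (q : ℍ[ℝ]) :
    quaternionHom h1 h2 q = algebraMap ℝ _ q.re + q.imI • σ G64.b +
      q.imJ • (σ G64.d * σ G64.c) + q.imK • (σ G64.b * (σ G64.d * σ G64.c)) := rfl

theorem quaternionHom_i (h1 : σ (G64.a ^ 2) = 1) (h2 : σ (G64.b ^ 2) = -1) :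
    quaternionHom h1 h2 quaternionI = σ G64.b := by
  have h : quaternionI.re = 0 ∧ quaternionI.imI = 1 ∧ quaternionI.imJ = 0 ∧ quaternionI.imK = 0 :=
    ⟨rfl, rfl, rfl, rfl⟩
  rw [quaternionHom_apply, h.1, h.2.1, h.2.2.1, h.2.2.2]
  simp

theorem quaternionHom_j (h1 : σ (G64.a ^ 2) = 1) (h2 : σ (G64.b ^ 2) = -1) :
    quaternionHom h1 h2 quaternionJ = σ G64.d * σ G64.c := by
  have h : quaternionJ.re = 0 ∧ quaternionJ.imI = 0 ∧ quaternionJ.imJ = 1 ∧ quaternionJ.imK = 0 :=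
    ⟨rfl, rfl, rfl, rfl⟩
  rw [quaternionHom_apply, h.1, h.2.1, h.2.2.1, h.2.2.2]
  simp

theorem commute_quaternionHom (h1 : σ (G64.a ^ 2) = 1) (h2 : σ (G64.b ^ 2) = -1)
    {X : Module.End ℝ W} (hi : Commute X (σ G64.b)) (hj : Commute X (σ G64.d * σ G64.c))
    (q : ℍ[ℝ]) : Commute X (quaternionHom h1 h2 q) := by
  rw [quaternionHom_apply]
  exact ((Commute.add_right (Algebra.commutes q.re X).symm (hi.smul_right _)).add_right
    (hj.smul_right _)).add_right ((hi.mul_right hj).smul_right _)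

/-- The map `ℍ² → W`, `(p, r) ↦ p w + c (r w)`. For a fixed vector `w ≠ 0` of `a` in an irreducible
representation it is bijective. -/
def quaternionModelMap (h1 : σ (G64.a ^ 2) = 1) (h2 : σ (G64.b ^ 2) = -1) (w : W) :
    ℍ[ℝ] × ℍ[ℝ] →ₗ[ℝ] W :=
  (LinearMap.applyₗ w ∘ₗ (quaternionHom h1 h2).toLinearMap).coprod
    (σ G64.c ∘ₗ LinearMap.applyₗ w ∘ₗ (quaternionHom h1 h2).toLinearMap)

section

variable {h1 : σ (G64.a ^ 2) = 1} {h2 : σ (G64.b ^ 2) = -1} {w : W}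

theorem quaternionModelMap_apply (p r : ℍ[ℝ]) : quaternionModelMap h1 h2 w (p, r) =
    quaternionHom h1 h2 p w + σ G64.c (quaternionHom h1 h2 r w) := rfl

theorem c_quaternionModelMap (p r : ℍ[ℝ]) :
    σ G64.c (quaternionModelMap h1 h2 w (p, r)) = quaternionModelMap h1 h2 w (r, p) := by
  rw [quaternionModelMap_apply, quaternionModelMap_apply, map_add, ← Module.End.mul_apply,
    ← Module.End.mul_apply, (operator_relations h1 h2).1.2.2.1, Module.End.one_apply, add_comm]

theorem quaternionHom_quaternionModelMap (q p r : ℍ[ℝ]) :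
    quaternionHom h1 h2 q (quaternionModelMap h1 h2 w (p, r)) =
      quaternionModelMap h1 h2 w (q * p, q * r) := by
  have hc := commute_quaternionHom h1 h2 (X := σ G64.c)
    (operator_relations h1 h2).2.2.2.2.1.symm (j_relations h1 h2).2.2.2.symm q
  rw [quaternionModelMap_apply, quaternionModelMap_apply, map_add, map_mul, map_mul,
    ← Module.End.mul_apply _ (σ G64.c), ← hc.eq]
  rfl

theorem a_quaternionModelMap (hw : σ G64.a w = w) (p r : ℍ[ℝ]) :
    σ G64.a (quaternionModelMap h1 h2 w (p, r)) = quaternionModelMap h1 h2 w (p, -r) := by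
  have ha := commute_quaternionHom h1 h2 (X := σ G64.a)
    (operator_relations h1 h2).2.1 (j_relations h1 h2).2.2.1.symm
  have ha' : ∀ q, σ G64.a (quaternionHom h1 h2 q w) = quaternionHom h1 h2 q w := fun q => by
    rw [← Module.End.mul_apply, (ha q).eq, Module.End.mul_apply, hw]
  rw [quaternionModelMap_apply, quaternionModelMap_apply, map_add, ha', ← Module.End.mul_apply,
    (operator_relations h1 h2).2.2.1, LinearMap.neg_apply, Module.End.mul_apply, ha', map_neg,
    LinearMap.neg_apply, map_neg]

theorem b_quaternionModelMap (p r : ℍ[ℝ]) :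
    σ G64.b (quaternionModelMap h1 h2 w (p, r)) =
      quaternionModelMap h1 h2 w (quaternionI * p, quaternionI * r) := by
  rw [← quaternionHom_quaternionModelMap, quaternionHom_i]

theorem d_quaternionModelMap (p r : ℍ[ℝ]) :
    σ G64.d (quaternionModelMap h1 h2 w (p, r)) =
      quaternionModelMap h1 h2 w (quaternionJ * r, quaternionJ * p) := by
  rw [← quaternionHom_quaternionModelMap, quaternionHom_j, ← c_quaternionModelMap,
    ← Module.End.mul_apply]

theorem quaternionModelMap_injective (hw0 : w ≠ 0) (hw : σ G64.a w = w) :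
    Function.Injective (quaternionModelMap h1 h2 w) := by
  have hdiv : ∀ q, quaternionHom h1 h2 q w = 0 → q = 0 := by
    intro q hq
    by_contra hq0
    apply hw0
    rw [← Module.End.one_apply (R := ℝ) w, ← map_one (quaternionHom h1 h2), ← inv_mul_cancel₀ hq0,
      map_mul, Module.End.mul_apply, hq, map_zero]
  have hfst : ∀ p r, quaternionModelMap h1 h2 w (p, r) = 0 → p = 0 := by
    intro p r h
    have h' : quaternionModelMap h1 h2 w (p + p, 0) = 0 := by
      have := congrArg (σ G64.a) h
      rw [a_quaternionModelMap hw, map_zero] at this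
      rw [← add_zero (0 : W)]
      nth_rw 2 [← h]
      rw [← this, ← map_add, Prod.mk_add_mk, neg_add_cancel]
    rw [quaternionModelMap_apply, map_zero, LinearMap.zero_apply, map_zero, add_zero] at h'
    have := hdiv _ h'
    rwa [← two_smul ℝ, smul_eq_zero, or_iff_right two_ne_zero] at this
  rw [injective_iff_map_eq_zero]
  rintro ⟨p, r⟩ h
  refine Prod.ext (hfst p r h) (hfst r p ?_)
  rw [← c_quaternionModelMap, h, map_zero]

end

/-- Identify `W` with `ℍ²` by `quaternionModelMap`. The group acts through left multiplications and
matrices with entries `0, ±1`, so that the endomorphisms are the right multiplications by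
quaternions. -/
theorem nonempty_intertwiningMap_equiv_quaternion {τ : Representation ℝ G64 W}
    (hτ : τ.IsIrreducible) (φ : MulAut G64) (h1 : twist τ φ (G64.a ^ 2) = 1)
    (h2 : twist τ φ (G64.b ^ 2) = -1) : Nonempty (τ.IntertwiningMap τ ≃ₐ[ℝ] ℍ[ℝ]) := by
  obtain ⟨w₀, hw₀⟩ := exists_ne_zero hτ
  obtain ⟨w, hw0, hw⟩ := exists_apply_a_eq h1 h2 hw₀
  set Φ := quaternionModelMap h1 h2 w with hΦ
  have hinj : Function.Injective Φ := quaternionModelMap_injective hw0 hw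
  have hΦ1 : Φ (1, 0) = w := by
    rw [hΦ, quaternionModelMap_apply, map_one, map_zero]
    simp
  have hsurj : Function.Surjective Φ := by
    rw [← LinearMap.range_eq_top]
    refine (eq_bot_or_eq_top_of_twist hτ φ _ ?_).resolve_left fun h => hw0 ?_
    · rintro i _ ⟨⟨p, r⟩, rfl⟩
      fin_cases i
      · exact ⟨_, (a_quaternionModelMap hw p r).symm⟩
      · exact ⟨_, (b_quaternionModelMap p r).symm⟩
      · exact ⟨_, (c_quaternionModelMap p r).symm⟩
      · exact ⟨_, (d_quaternionModelMap p r).symm⟩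
    · rw [← Submodule.mem_bot ℝ, ← h]
      exact ⟨_, hΦ1⟩
  let e : (ℍ[ℝ] × ℍ[ℝ]) ≃ₗ[ℝ] W := LinearEquiv.ofBijective Φ ⟨hinj, hsurj⟩
  -- right multiplication by the conjugate of a quaternion, transported to `W`
  let T (s : ℍ[ℝ]) : Module.End ℝ W := e.toLinearMap ∘ₗ
    ((LinearMap.mulRight ℝ (star s)).prodMap (LinearMap.mulRight ℝ (star s))) ∘ₗ
    e.symm.toLinearMap
  have hT : ∀ s p r, T s (Φ (p, r)) = Φ (p * star s, r * star s) := by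
    intro s p r
    have : e.symm (Φ (p, r)) = (p, r) := e.symm_apply_apply (p, r)
    change Φ ((e.symm (Φ (p, r))).1 * star s, (e.symm (Φ (p, r))).2 * star s) = _
    rw [this]
  have ext : ∀ {X Y : Module.End ℝ W}, (∀ p r, X (Φ (p, r)) = Y (Φ (p, r))) → X = Y := by
    intro X Y h
    refine LinearMap.ext fun v => ?_
    obtain ⟨⟨p, r⟩, rfl⟩ := hsurj v
    exact h p r
  have hcomm : ∀ s g, Commute (T s) (τ g) := by
    intro s
    refine commute_of_twist φ _ fun i => ext fun p r => ?_
    rw [Module.End.mul_apply, Module.End.mul_apply, hT]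
    fin_cases i
    · refine (congrArg (T s) (a_quaternionModelMap hw p r)).trans
        (Eq.trans ?_ (a_quaternionModelMap hw _ _).symm)
      rw [← hΦ, hT, neg_mul]
    · refine (congrArg (T s) (b_quaternionModelMap p r)).trans
        (Eq.trans ?_ (b_quaternionModelMap _ _).symm)
      rw [← hΦ, hT, mul_assoc, mul_assoc]
    · refine (congrArg (T s) (c_quaternionModelMap p r)).trans
        (Eq.trans ?_ (c_quaternionModelMap _ _).symm)
      rw [← hΦ, hT]
    · refine (congrArg (T s) (d_quaternionModelMap p r)).trans
        (Eq.trans ?_ (d_quaternionModelMap _ _).symm)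
      rw [← hΦ, hT, mul_assoc, mul_assoc]
  let F : ℍ[ℝ] →ₐ[ℝ] τ.IntertwiningMap τ := AlgHom.ofLinearMap
    { toFun := fun s => ⟨T s, fun g => hcomm s g⟩
      map_add' := fun s t => Representation.IntertwiningMap.ext (ext fun p r => by
        change T (s + t) _ = T s _ + T t _
        rw [hT, hT, hT, ← map_add, star_add, mul_add, mul_add]
        rfl)
      map_smul' := fun x s => Representation.IntertwiningMap.ext (ext fun p r => by
        change T (x • s) _ = x • T s _
        rw [hT, hT, ← map_smul, Quaternion.star_smul, mul_smul_comm, mul_smul_comm]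
        rfl) }
    (Representation.IntertwiningMap.ext (ext fun p r => by
        change T 1 _ = Φ (p, r)
        rw [hT, star_one, mul_one, mul_one]))
    (fun s t => Representation.IntertwiningMap.ext (ext fun p r => by
        change T (s * t) _ = T s (T t _)
        rw [hT, hT, hT, star_mul, mul_assoc, mul_assoc]))
  refine ⟨(AlgEquiv.ofBijective F ⟨fun s t hst => ?_, fun X => ?_⟩).symm⟩
  · have : T s (Φ (1, 0)) = T t (Φ (1, 0)) :=
      congrArg (fun X : τ.IntertwiningMap τ => X (Φ (1, 0))) hst
    rw [hT, hT, one_mul, one_mul] at this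
    exact star_injective (congrArg Prod.fst (hinj this))
  · obtain ⟨⟨p, r⟩, hpr⟩ := hsurj (X w)
    have hX : ∀ g, Commute X.toLinearMap (twist τ φ g) := fun g => X.isIntertwining' (φ g)
    have hXa : twist τ φ G64.a (X w) = X w :=
      (LinearMap.congr_fun (hX G64.a).eq w).symm.trans (congrArg X hw)
    have hr : r = 0 := by
      have h : Φ (p, -r) = Φ (p, r) := by
        rw [hΦ, ← a_quaternionModelMap hw, ← hΦ, hpr, hXa]
      have := congrArg Prod.snd (hinj h)
      have h0 : (2 : ℝ) • r = 0 := by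
        rw [two_smul, add_eq_zero_iff_eq_neg]
        exact this.symm
      exact (smul_eq_zero.1 h0).resolve_left two_ne_zero
    rw [hr] at hpr
    have hXw : X w = quaternionHom h1 h2 p w := by
      rw [← hpr, hΦ, quaternionModelMap_apply, map_zero]
      simp
    have hXq : ∀ q, X (quaternionHom h1 h2 q w) = quaternionHom h1 h2 (q * p) w := by
      intro q
      have := LinearMap.congr_fun
        (commute_quaternionHom h1 h2 (hX G64.b) ((hX G64.d).mul_right (hX G64.c)) q).eq w
      refine this.trans ?_
      rw [map_mul, Module.End.mul_apply, Module.End.mul_apply, ← hXw]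
      rfl
    refine ⟨star p, Representation.IntertwiningMap.ext (ext fun q t => ?_)⟩
    change T (star p) _ = X (Φ (q, t))
    rw [hT, star_star, hΦ, quaternionModelMap_apply, quaternionModelMap_apply, map_add, hXq,
      ← hXq t]
    congr 1
    exact (LinearMap.congr_fun (hX G64.c).eq (quaternionHom h1 h2 t w)).symm

end Quaternionic

/-! ### Frobenius–Schur indicators and the summands of the holonomy representation -/

section Complex

variable {W : Type} [AddCommGroup W] [Module ℂ W]

theorem exists_joint_eigenvector {σ : Representation ℂ G64 W} (h1 : σ (G64.a ^ 2) = 1)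
    (h2 : σ (G64.b ^ 2) = -1) {u : W} (hu : u ≠ 0) :
    ∃ w : W, w ≠ 0 ∧ σ G64.a w = w ∧ σ G64.b w = Complex.I • w := by
  obtain ⟨v, hv0, hv⟩ := exists_apply_a_eq h1 h2 hu
  obtain ⟨⟨-, hb, -, -⟩, hab, -⟩ := operator_relations h1 h2
  obtain ⟨hjj, hjb, hja, -⟩ := j_relations h1 h2
  have hbb : σ G64.b (σ G64.b v) = -v := LinearMap.congr_fun hb v
  have hI : Complex.I * Complex.I = -1 := Complex.I_mul_I
  by_cases h : v - Complex.I • σ G64.b v = 0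
  · refine ⟨(σ G64.d * σ G64.c) v, fun h0 => hv0 ?_, ?_, ?_⟩
    · have := LinearMap.congr_fun hjj v
      rw [Module.End.mul_apply, h0, map_zero] at this
      exact neg_eq_zero.1 this.symm
    · have := LinearMap.congr_fun hja v
      rw [Module.End.mul_apply, hv] at this
      exact this.symm
    · have hbv : σ G64.b v = -(Complex.I • v) := by
        have e : Complex.I • Complex.I • σ G64.b v = -σ G64.b v := by
          rw [smul_smul, hI, neg_one_smul]
        rw [← sub_eq_zero.1 h] at e
        rw [e, neg_neg]
      have := LinearMap.congr_fun hjb v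
      rw [Module.End.mul_apply, hbv, map_neg, map_smul, LinearMap.neg_apply, neg_inj] at this
      exact this.symm
  · refine ⟨_, h, ?_, ?_⟩
    · have := LinearMap.congr_fun hab v
      rw [Module.End.mul_apply, Module.End.mul_apply, hv] at this
      rw [map_sub, map_smul, this, hv]
    · rw [map_sub, map_smul, hbb, smul_sub, smul_smul, hI, smul_neg, neg_one_smul]
      abel

/-- The joint eigenvectors `w, j w, c w, c j w` of `a` and `b`, where `j = dc`, form a basis. -/
theorem finrank_eq_four {τ : Representation ℂ G64 W} (hτ : τ.IsIrreducible) (φ : MulAut G64)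
    (h1 : twist τ φ (G64.a ^ 2) = 1) (h2 : twist τ φ (G64.b ^ 2) = -1) :
    Module.finrank ℂ W = 4 := by
  obtain ⟨u, hu⟩ := exists_ne_zero hτ
  obtain ⟨w, hw0, hwa, hwb⟩ := exists_joint_eigenvector h1 h2 hu
  obtain ⟨⟨-, -, hc, -⟩, -, hac, -, hbc, -, hcd⟩ := operator_relations h1 h2
  obtain ⟨hjj, hjb, hja, hjc⟩ := j_relations h1 h2
  generalize hA : twist τ φ G64.a = A at *
  generalize hB : twist τ φ G64.b = B at *
  generalize hC : twist τ φ G64.c = C at *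
  generalize hD : twist τ φ G64.d = D at *
  generalize hJ : D * C = J at *
  have hd : D = J * C := by rw [← hJ, mul_assoc, hc, mul_one]
  have hcc : ∀ v, C (C v) = v := fun v => LinearMap.congr_fun hc v
  have hjj' : ∀ v, J (J v) = -v := fun v => LinearMap.congr_fun hjj v
  have hac' : ∀ v, A (C v) = -C (A v) := fun v => LinearMap.congr_fun hac v
  have hbc' : ∀ v, B (C v) = C (B v) := fun v => LinearMap.congr_fun hbc v
  have hja' : ∀ v, A (J v) = J (A v) := fun v => (LinearMap.congr_fun hja v).symm
  have hjb' : ∀ v, B (J v) = -J (B v) := fun v => by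
    rw [eq_neg_iff_add_eq_zero, add_comm, ← eq_neg_iff_add_eq_zero]
    exact LinearMap.congr_fun hjb v
  have hjc' : ∀ v, J (C v) = C (J v) := fun v => LinearMap.congr_fun hjc v
  have hd' : ∀ v, D v = J (C v) := fun v => LinearMap.congr_fun hd v
  have hj0 : ∀ v, J v = 0 → v = 0 := fun v hv => by
    rw [← neg_eq_zero, ← hjj', hv, map_zero]
  have hc0 : ∀ v, C v = 0 → v = 0 := fun v hv => by rw [← hcc v, hv, map_zero]
  let x : Fin 4 → W := ![w, J w, C w, C (J w)]
  -- the four vectors are eigenvectors of `2a - ib` for different eigenvalues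
  have hlin : LinearIndependent ℂ x := by
    refine Module.End.eigenvectors_linearIndependent' ((2 : ℂ) • A - Complex.I • B)
      ![3, 1, -1, -3] ?_ x fun k => ?_
    · intro i j hij
      fin_cases i <;> fin_cases j <;> first | rfl | (exfalso; revert hij; norm_num)
    · rw [Module.End.hasEigenvector_iff, Module.End.mem_eigenspace_iff, LinearMap.sub_apply,
        LinearMap.smul_apply, LinearMap.smul_apply]
      fin_cases k <;>
        simp only [x, Fin.zero_eta, Fin.mk_one, Fin.reduceFinMk, Matrix.cons_val, hac', hbc', hja',
          hjb', hwa, hwb, map_neg, map_smul]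
      · refine ⟨?_, hw0⟩
        rw [smul_smul, Complex.I_mul_I]
        module
      · refine ⟨?_, fun h => hw0 (hj0 _ h)⟩
        rw [smul_neg, smul_smul, Complex.I_mul_I]
        module
      · refine ⟨?_, fun h => hw0 (hc0 _ h)⟩
        rw [smul_smul, Complex.I_mul_I]
        module
      · refine ⟨?_, fun h => hw0 (hj0 _ (hc0 _ h))⟩
        rw [smul_neg, smul_neg, smul_smul, Complex.I_mul_I]
        module
  have hx : ∀ k, x k ∈ Submodule.span ℂ (Set.range x) := fun k =>
    Submodule.subset_span ⟨k, rfl⟩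
  have htop : Submodule.span ℂ (Set.range x) = ⊤ := by
    refine (eq_bot_or_eq_top_of_twist hτ φ _ ?_).resolve_left fun h => hw0 ?_
    · intro i
      change Submodule.span ℂ (Set.range x) ≤ (Submodule.span ℂ (Set.range x)).comap
        (twist τ φ (PresentedGroup.of i))
      rw [Submodule.span_le, Set.range_subset_iff]
      intro k
      change twist τ φ (PresentedGroup.of i) (x k) ∈ Submodule.span ℂ (Set.range x)
      have hgen : twist τ φ (PresentedGroup.of i) = ![A, B, C, D] i := by
        fin_cases i
        exacts [hA, hB, hC, hD]
      rw [hgen]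
      have hx0 := hx 0
      have hx1 := hx 1
      have hx2 := hx 2
      have hx3 := hx 3
      fin_cases i <;> fin_cases k <;>
        simp only [Fin.zero_eta, Fin.mk_one, Fin.reduceFinMk, Matrix.cons_val, x, hac', hbc', hja',
          hjb', hwa, hwb, map_neg, map_smul, hcc, hd', hjc', hjj', Submodule.neg_mem_iff]
          at hx0 hx1 hx2 hx3 ⊢ <;>
        first | assumption | (exact Submodule.smul_mem _ _ (by assumption))
    · rw [← Submodule.mem_bot ℂ, ← h]
      exact hx 0
  rw [← finrank_top, ← htop, finrank_span_eq_card hlin, Fintype.card_fin]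

/-- All squares in `G64` are central, and act as `±1`. By `sum_sq_eq` the sum of the characters of
the squares is `-16` times the dimension. -/
theorem frobeniusSchur_eq {τ : Representation ℂ G64 W} (hτ : τ.IsIrreducible) (φ : MulAut G64)
    (h1 : twist τ φ (G64.a ^ 2) = 1) (h2 : twist τ φ (G64.b ^ 2) = -1) :
    frobeniusSchur τ = -1 := by
  classical
  have h4 := finrank_eq_four hτ φ h1 h2
  have : Module.Finite ℂ W := Module.finite_of_finrank_pos (by rw [h4]; norm_num)
  have ha4 : (G64.a ^ 2) ^ 2 = 1 := by rw [← pow_mul, G64.pow_four_eq_one]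
  have ha1 : G64.a ^ 2 ≠ 1 := by
    rw [ne_eq, ← G64.equivModel.injective.eq_iff, G64.equivModel_a_sq, map_one]
    decide
  have hchar : ∀ g : G64, τ.character (g ^ 2) =
      ((if g ^ 2 = 1 ∨ g ^ 2 = φ (G64.a ^ 2) then (1 : ℤ) else -1 : ℤ) : ℂ) * 4 := by
    intro g
    have htr : LinearMap.trace ℂ W 1 = 4 := by
      rw [LinearMap.trace_one, h4]
      norm_num
    obtain ⟨y, hy⟩ := φ.surjective (g ^ 2)
    have hg : y ^ 2 = 1 := by
      apply φ.injective
      rw [map_pow, hy, ← pow_mul, G64.pow_four_eq_one, map_one]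
    rw [← hy]
    change LinearMap.trace ℂ W (twist τ φ y) = _
    simp only [EmbeddingLike.map_eq_one_iff, EmbeddingLike.apply_eq_iff_eq]
    split_ifs with h
    · have : twist τ φ y = 1 := by
        obtain rfl | rfl := h
        exacts [map_one _, h1]
      rw [this, htr]
      norm_num
    · have : twist τ φ y = -1 := by
        obtain rfl | rfl | rfl | rfl := G64.eq_of_sq_eq_one hg
        · exact absurd (Or.inl rfl) h
        · exact absurd (Or.inr rfl) h
        · exact h2
        · rw [map_mul, h1, h2, one_mul]
      rw [this, map_neg, htr]
      norm_num
  rw [frobeniusSchur, finsum_congr hchar, finsum_eq_sum_of_fintype, ← Finset.sum_mul,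
    ← Int.cast_sum, sum_sq_eq _ (by rw [ne_eq, EmbeddingLike.map_eq_one_iff]; exact ha1)
      (by rw [← map_pow, ha4, map_one]), G64.card_eq]
  norm_num

end Complex

section Lattice

theorem latticeRep_of_sq_eq_one {z : G64} (hz : z ^ 2 = 1) (hz1 : z ≠ 1) (hza : z ≠ G64.a ^ 2)
    (v : Fin 16 → ℤ) : latticeRep z v = -v := by
  obtain rfl | rfl | rfl | rfl := G64.eq_of_sq_eq_one hz
  · exact absurd rfl hz1
  · exact absurd rfl hza
  · exact latticeRep_b_sq v
  · rw [map_mul, Module.End.mul_apply, latticeRep_b_sq, latticeRep_a_sq]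

/-- `(1 + ρ(f(a²))) (1 + ρ(f(b²))) = 0`, as at least one of the two involutions is not `a²` and
hence acts as `-1`. -/
theorem sum_center_latticeRep (f : MulAut G64) (v : Fin 16 → ℤ) :
    v + latticeRep (f (G64.a ^ 2)) v + latticeRep (f (G64.b ^ 2)) v +
      latticeRep (f (G64.a ^ 2 * G64.b ^ 2)) v = 0 := by
  have hsq : ∀ g : G64, (f (g ^ 2)) ^ 2 = 1 := fun g => by
    rw [← map_pow, ← pow_mul, G64.pow_four_eq_one, map_one]
  have ha1 : f (G64.a ^ 2) ≠ 1 := by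
    rw [ne_eq, EmbeddingLike.map_eq_one_iff, ← G64.equivModel.injective.eq_iff,
      G64.equivModel_a_sq, map_one]
    decide
  have hb1 : f (G64.b ^ 2) ≠ 1 := by
    rw [ne_eq, EmbeddingLike.map_eq_one_iff, ← G64.equivModel.injective.eq_iff,
      G64.equivModel_b_sq, map_one]
    decide
  rw [map_mul f, map_mul latticeRep, Module.End.mul_apply]
  by_cases ha : f (G64.a ^ 2) = G64.a ^ 2
  · have hb : f (G64.b ^ 2) ≠ G64.a ^ 2 := by
      rw [← ha, ne_eq, EmbeddingLike.apply_eq_iff_eq, ← G64.equivModel.injective.eq_iff,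
        G64.equivModel_a_sq, G64.equivModel_b_sq]
      decide
    rw [latticeRep_of_sq_eq_one (hsq _) hb1 hb, map_neg]
    abel
  · rw [latticeRep_of_sq_eq_one (hsq _) ha1 ha, latticeRep_of_sq_eq_one (hsq _) ha1 ha]
    abel

theorem sum_center_tripleRep (f₂ f₃ : MulAut G64) :
    1 + tripleRep latticeRep f₂ f₃ (G64.a ^ 2) + tripleRep latticeRep f₂ f₃ (G64.b ^ 2) +
      tripleRep latticeRep f₂ f₃ (G64.a ^ 2 * G64.b ^ 2) = 0 :=
  LinearMap.ext fun v => Prod.ext (sum_center_latticeRep 1 v.1)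
    (Prod.ext (sum_center_latticeRep f₂ v.2.1) (sum_center_latticeRep f₃ v.2.2))

theorem sum_center_extendScalars (K : Type) [Field K] (f₂ f₃ : MulAut G64)
    (U : Subrepresentation (extendScalars K (tripleRep latticeRep f₂ f₃))) :
    1 + U.toRepresentation (G64.a ^ 2) + U.toRepresentation (G64.b ^ 2) +
      U.toRepresentation (G64.a ^ 2 * G64.b ^ 2) = 0 := by
  have h := congrArg (Module.End.baseChangeHom ℤ K _) (sum_center_tripleRep f₂ f₃)
  rw [map_add, map_add, map_add, map_one, map_zero] at h
  exact LinearMap.ext fun v => Subtype.ext (LinearMap.congr_fun h (v : K ⊗[ℤ] _))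

theorem isOfQuaternionicType_tripleRep (f₂ f₃ : MulAut G64) :
    IsOfQuaternionicType (extendScalars ℝ (tripleRep latticeRep f₂ f₃)) := by
  intro U hU
  obtain ⟨φ, h1, h2⟩ := exists_twist hU (sum_center_extendScalars ℝ f₂ f₃ U)
  exact nonempty_intertwiningMap_equiv_quaternion hU φ h1 h2

theorem frobeniusSchur_tripleRep (f₂ f₃ : MulAut G64)
    (U : Subrepresentation (extendScalars ℂ (tripleRep latticeRep f₂ f₃)))
    (hU : U.toRepresentation.IsIrreducible) : frobeniusSchur U.toRepresentation = -1 := by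
  obtain ⟨φ, h1, h2⟩ := exists_twist hU (sum_center_extendScalars ℂ f₂ f₃ U)
  exact frobeniusSchur_eq hU φ h1 h2

end Lattice

end FlatQuat

namespace FlatQuat

open groupCohomology

/-! ### The extension that belongs to a 2-cocycle -/

section Extension

variable {k G L : Type} [CommRing k] [Group G] [AddCommGroup L] [Module k L]
  {ρ : Representation k G L}

/-- The extension of `G` by `L` that is given by the 2-cocycle `c`: the set `L × G` with
multiplication `(l, g)(m, h) = (l + g • m + c(g, h), gh)`. -/
@[ext]
structure CocycleExtension (c : cocycles₂ (Rep.of ρ)) : Type where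
  left : L
  right : G

namespace CocycleExtension

variable (c : cocycles₂ (Rep.of ρ))

/-- The value of the cocycle, as an element of `L`. -/
def val (g h : G) : L := c (g, h)

theorem val_mul (g h j : G) :
    val c (g * h) j + val c g h = ρ g (val c h j) + val c g (h * j) :=
  (mem_cocycles₂_iff (c : G × G → L)).1 c.2 g h j

theorem val_one_left (g : G) : val c 1 g = val c 1 1 := cocycles₂_map_one_fst c g

theorem val_one_right (g : G) : val c g 1 = ρ g (val c 1 1) := cocycles₂_map_one_snd c g

instance : Mul (CocycleExtension c) :=
  ⟨fun x y => ⟨x.left + ρ x.right y.left + val c x.right y.right, x.right * y.right⟩⟩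

instance : One (CocycleExtension c) := ⟨⟨-val c 1 1, 1⟩⟩

instance : Inv (CocycleExtension c) :=
  ⟨fun x => ⟨-ρ x.right⁻¹ x.left - val c x.right⁻¹ x.right - val c 1 1, x.right⁻¹⟩⟩

variable {c}

theorem mul_left (x y : CocycleExtension c) :
    (x * y).left = x.left + ρ x.right y.left + val c x.right y.right := rfl

@[simp] theorem mul_right (x y : CocycleExtension c) : (x * y).right = x.right * y.right := rfl

theorem one_left : (1 : CocycleExtension c).left = -val c 1 1 := rfl

@[simp] theorem one_right : (1 : CocycleExtension c).right = 1 := rfl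

instance : Group (CocycleExtension c) :=
  Group.ofLeftAxioms
    (fun x y z => by
      refine CocycleExtension.ext ?_ (mul_assoc _ _ _)
      simp only [mul_left, mul_right, map_add, map_mul, Module.End.mul_apply]
      have := val_mul c x.right y.right z.right
      rw [← sub_eq_zero] at this ⊢
      rw [← this]
      abel)
    (fun x => by
      refine CocycleExtension.ext ?_ (one_mul _)
      rw [mul_left, one_left, one_right, map_one, Module.End.one_apply, val_one_left c x.right]
      abel)
    (fun x => by
      refine CocycleExtension.ext ?_ (inv_mul_cancel _)
      change -ρ x.right⁻¹ x.left - val c x.right⁻¹ x.right - val c 1 1 + ρ x.right⁻¹ x.left +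
        val c x.right⁻¹ x.right = -val c 1 1
      abel)

variable (c) in
/-- The inclusion of `L`. -/
def inl : Multiplicative L →* CocycleExtension c where
  toFun l := ⟨l.toAdd - val c 1 1, 1⟩
  map_one' := CocycleExtension.ext (zero_sub _) rfl
  map_mul' l m := by
    refine CocycleExtension.ext ?_ (one_mul _).symm
    simp only [mul_left, map_one, Module.End.one_apply, toAdd_mul]
    abel

theorem inl_left (l : Multiplicative L) : (inl c l).left = l.toAdd - val c 1 1 := rfl

@[simp] theorem inl_right (l : Multiplicative L) : (inl c l).right = 1 := rfl

/-- The identity element is `(-c(1, 1), 1)`, because `c` need not be normalized. -/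
theorem eq_inl_iff {x : CocycleExtension c} {l : L} :
    x = inl c (Multiplicative.ofAdd l) ↔ x.right = 1 ∧ x.left + val c 1 1 = l := by
  rw [CocycleExtension.ext_iff, inl_left, inl_right, toAdd_ofAdd, eq_sub_iff_add_eq, and_comm]

variable (c) in
/-- The group extension `0 → L → Γ → G → 1`. -/
def groupExtension : GroupExtension (Multiplicative L) (CocycleExtension c) G where
  inl := inl c
  rightHom :=
    { toFun := right
      map_one' := rfl
      map_mul' := fun _ _ => rfl }
  inl_injective l m h := by
    have := congrArg left h
    rw [inl_left, inl_left, sub_left_inj] at this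
    exact this
  range_inl_eq_ker_rightHom := by
    ext x
    refine ⟨?_, fun h => ⟨Multiplicative.ofAdd (x.left + val c 1 1), (eq_inl_iff.2 ⟨h, rfl⟩).symm⟩⟩
    rintro ⟨l, rfl⟩
    rfl
  rightHom_surjective g := ⟨⟨0, g⟩, rfl⟩

variable (c) in
theorem inducesAction : InducesAction (groupExtension c) ρ := by
  intro γ z
  rw [eq_mul_inv_iff_mul_eq]
  refine CocycleExtension.ext ?_ ((one_mul _).trans (mul_one _).symm)
  change ρ γ.right z - val c 1 1 + ρ 1 γ.left + val c 1 γ.right =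
    γ.left + ρ γ.right (z - val c 1 1) + val c γ.right 1
  rw [map_one, Module.End.one_apply, val_one_left c γ.right, val_one_right c γ.right, map_sub]
  abel

variable (c) in
theorem hasClass : HasClass (groupExtension c) (H2π (Rep.of ρ) c) := by
  refine ⟨⟨fun g => ⟨0, g⟩, fun g => rfl⟩, c, fun g h => ?_, rfl⟩
  refine CocycleExtension.ext ?_ (one_mul _).symm
  change 0 + ρ g 0 + val c g h = val c g h - val c 1 1 + ρ 1 0 + val c 1 (g * h)
  rw [map_zero, map_zero, val_one_left c (g * h)]
  abel

end CocycleExtension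

/-- The extension that is obtained by replacing the group in the middle by an isomorphic one. -/
def mapExtension {N Γ Γ' : Type} [Group N] [Group Γ] [Group Γ'] (S : GroupExtension N Γ G)
    (e : Γ ≃* Γ') : GroupExtension N Γ' G where
  inl := e.toMonoidHom.comp S.inl
  rightHom := S.rightHom.comp e.symm.toMonoidHom
  inl_injective := e.injective.comp S.inl_injective
  range_inl_eq_ker_rightHom := by
    ext x
    have := SetLike.ext_iff.1 S.range_inl_eq_ker_rightHom (e.symm x)
    refine Iff.trans ?_ this
    simp only [MonoidHom.mem_range, MonoidHom.comp_apply]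
    exact exists_congr fun l => (e.eq_symm_apply).symm
  rightHom_surjective := S.rightHom_surjective.comp e.symm.surjective

section Transport

variable {Γ Γ' : Type} [Group Γ] [Group Γ'] {S : GroupExtension (Multiplicative L) Γ G}

theorem InducesAction.map (h : InducesAction S ρ) (e : Γ ≃* Γ') :
    InducesAction (mapExtension S e) ρ := by
  intro γ z
  change e (S.inl _) = γ * e (S.inl _) * γ⁻¹
  rw [← e.eq_symm_apply, map_mul, map_mul, map_inv, e.symm_apply_apply]
  exact h (e.symm γ) z

theorem HasClass.map {β : H2 (Rep.of ρ)} (h : HasClass S β) (e : Γ ≃* Γ') :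
    HasClass (mapExtension S e) β := by
  obtain ⟨σ, c, hσ, rfl⟩ := h
  refine ⟨⟨fun g => e (σ g), fun g => ?_⟩, c, fun g h => ?_, rfl⟩
  · change S.rightHom (e.symm (e (σ g))) = g
    rw [e.symm_apply_apply, σ.rightHom_section]
  · change e (σ g) * e (σ h) = e (S.inl _) * e (σ (g * h))
    rw [← map_mul e, ← map_mul e, hσ]

/-- An element of an abelian subgroup of finite index commutes with a multiple of every element of
the lattice, hence acts trivially on the torsion-free lattice. -/
theorem InducesAction.isTranslationSubgroup [Finite G] [IsAddTorsionFree L]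
    (h : InducesAction S ρ) (hρ : ∀ g, ρ g = 1 → g = 1) : IsTranslationSubgroup S.inl.range := by
  refine ⟨⟨inferInstance, ?_⟩, ?_⟩
  · rw [S.range_inl_eq_ker_rightHom]
    infer_instance
  · rintro B ⟨hB, hBi⟩ x hx
    rw [S.range_inl_eq_ker_rightHom, MonoidHom.mem_ker]
    refine hρ _ (LinearMap.ext fun l => ?_)
    obtain ⟨n, hn, -, hnB⟩ := Subgroup.exists_pow_mem_of_index_ne_zero hBi.index_ne_zero
      (S.inl (Multiplicative.ofAdd l))
    have hc : x * S.inl (Multiplicative.ofAdd l) ^ n = S.inl (Multiplicative.ofAdd l) ^ n * x :=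
      congrArg Subtype.val (hB.is_comm.comm (⟨x, hx⟩ : B) ⟨_, hnB⟩)
    have h1 := h x (n • l)
    rw [ofAdd_nsmul n l, map_pow, hc, mul_inv_cancel_right, ← map_pow, ← ofAdd_nsmul] at h1
    have h2 : ρ (S.rightHom x) (n • l) = n • l := S.inl_injective h1
    rw [map_nsmul] at h2
    exact nsmul_right_injective hn.ne' h2

end Transport

end Extension

end FlatQuat

namespace FlatQuat

/-! ### Quotients of Euclidean space are flat manifolds -/

section Euclidean

open Bundle Topology

variable {n : ℕ} {X : Type} [TopologicalSpace X] [ChartedSpace (EuclideanSpace ℝ (Fin n)) X]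

/-- The coordinate changes of the given atlas are locally restrictions of isometries of `ℝⁿ`. -/
def HasEuclideanTransitions (n : ℕ) (X : Type) [TopologicalSpace X]
    [ChartedSpace (EuclideanSpace ℝ (Fin n)) X] : Prop :=
  ∀ φ ∈ atlas (EuclideanSpace ℝ (Fin n)) X, ∀ ψ ∈ atlas (EuclideanSpace ℝ (Fin n)) X,
    ∀ y ∈ φ.target, φ.symm y ∈ ψ.source →
      ∃ T : EuclideanSpace ℝ (Fin n) ≃ᵃⁱ[ℝ] EuclideanSpace ℝ (Fin n),
        ψ ∘ φ.symm =ᶠ[𝓝 y] T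

theorem affineIsometryEquiv_eq_add {E : Type*} [NormedAddCommGroup E]
    [NormedSpace ℝ E] (T : E ≃ᵃⁱ[ℝ] E) : (T : E → E) = fun x => T.linearIsometryEquiv x + T 0 := by
  ext x
  simpa using T.map_vadd 0 x

theorem hasFDerivAt_affineIsometryEquiv {E : Type*} [NormedAddCommGroup E]
    [NormedSpace ℝ E] (T : E ≃ᵃⁱ[ℝ] E) (x : E) :
    HasFDerivAt T (T.linearIsometryEquiv.toContinuousLinearEquiv : E →L[ℝ] E) x := by
  rw [affineIsometryEquiv_eq_add T]
  exact (T.linearIsometryEquiv.toContinuousLinearEquiv.hasFDerivAt).add_const _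

theorem HasEuclideanTransitions.isManifold (h : HasEuclideanTransitions n X) :
    IsManifold (𝓡 n) ∞ X := by
  apply isManifold_of_contDiffOn
  intro e e' he he' y hy
  simp only [mfld_simps] at hy ⊢
  obtain ⟨T, hT⟩ := h e he e' he' y hy.1 hy.2
  have : ContDiffAt ℝ ∞ T y := by
    rw [affineIsometryEquiv_eq_add T]
    exact (T.linearIsometryEquiv.toContinuousLinearEquiv.contDiff.add contDiff_const).contDiffAt
  exact (this.congr_of_eventuallyEq hT).contDiffWithinAt

/-- The derivative of coordinate changes is isometric. -/
theorem HasEuclideanTransitions.inner_tangentCoordChange (h : HasEuclideanTransitions n X)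
    [IsManifold (𝓡 n) 1 X] {x y z : X} (hx : z ∈ (chartAt (EuclideanSpace ℝ (Fin n)) x).source)
    (hy : z ∈ (chartAt (EuclideanSpace ℝ (Fin n)) y).source) (v w : EuclideanSpace ℝ (Fin n)) :
    inner ℝ (tangentCoordChange (𝓡 n) x y z v) (tangentCoordChange (𝓡 n) x y z w) =
      inner ℝ v w := by
  obtain ⟨T, hT⟩ := h _ (chart_mem_atlas _ x) _ (chart_mem_atlas _ y) (chartAt _ x z)
    (OpenPartialHomeomorph.map_source _ hx) (by rwa [OpenPartialHomeomorph.left_inv _ hx])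
  have : tangentCoordChange (𝓡 n) x y z =
      (T.linearIsometryEquiv.toContinuousLinearEquiv : _ →L[ℝ] EuclideanSpace ℝ (Fin n)) := by
    rw [tangentCoordChange_def]
    simp only [mfld_simps, fderivWithin_univ]
    exact ((hasFDerivAt_affineIsometryEquiv T _).congr_of_eventuallyEq hT).fderiv
  rw [this]
  exact T.linearIsometryEquiv.inner_map_map v w

/-- The inner product of `ℝⁿ` as a bilinear map. -/
def stdInner (n : ℕ) :
    EuclideanSpace ℝ (Fin n) →L[ℝ] EuclideanSpace ℝ (Fin n) →L[ℝ] ℝ :=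
  innerSL ℝ

/-- The standard inner product on a tangent space, which as a type is `ℝⁿ`: the tangent vector is
read in the preferred chart at its base point. -/
def tangentInner (x : X) :
    TangentSpace (𝓡 n) x →L[ℝ] TangentSpace (𝓡 n) x →L[ℝ] ℝ :=
  stdInner n

/-- The Riemannian metric that is the standard one in each chart. It is smooth because it is
constant in charts: the coordinate changes preserve the inner product. -/
def HasEuclideanTransitions.metric (h : HasEuclideanTransitions n X)
    [IsManifold (𝓡 n) ∞ X] :
    ContMDiffRiemannianMetric (𝓡 n) ∞ (EuclideanSpace ℝ (Fin n))
      (fun x : X => TangentSpace (𝓡 n) x) where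
  inner x := tangentInner x
  symm _ v w := real_inner_comm (F := EuclideanSpace ℝ (Fin n)) w v
  pos _ v hv := real_inner_self_pos (F := EuclideanSpace ℝ (Fin n)).2 hv
  isVonNBounded b := by
    have : Bornology.IsVonNBounded ℝ {v : EuclideanSpace ℝ (Fin n) | inner ℝ v v < 1} := by
      refine (NormedSpace.isVonNBounded_ball ℝ (EuclideanSpace ℝ (Fin n)) 1).subset fun v hv => ?_
      have hv' : inner ℝ v v < 1 := hv
      rw [real_inner_self_eq_norm_sq] at hv'
      rw [mem_ball_zero_iff]
      nlinarith [norm_nonneg v]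
    exact this
  contMDiff := by
    intro x₀
    rw [contMDiffAt_section]
    refine (contMDiffAt_const (c := stdInner n)).congr_of_eventuallyEq ?_
    filter_upwards [(chartAt (EuclideanSpace ℝ (Fin n)) x₀).open_source.mem_nhds
      (mem_chart_source _ x₀)] with x hx
    ext v w
    rw [hom_trivializationAt_apply]
    rw [ContinuousLinearMap.inCoordinates]
    simp only [ContinuousLinearMap.comp_apply]
    have hx2 : x ∈ (trivializationAt (EuclideanSpace ℝ (Fin n) →L[ℝ] ℝ)
        (fun x : X => TangentSpace (𝓡 n) x →L[ℝ] ℝ) x₀).baseSet := by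
      rw [hom_trivializationAt_baseSet]; exact ⟨hx, Set.mem_univ _⟩
    rw [Trivialization.continuousLinearMapAt_apply, Trivialization.linearMapAt_apply, if_pos hx2,
      hom_trivializationAt_apply]
    simp only [ContinuousLinearMap.inCoordinates, ContinuousLinearMap.comp_apply]
    rw [Trivialization.continuousLinearMapAt_apply]
    rw [TangentBundle.symmL_trivializationAt_eq_core hx]
    refine Eq.trans ?_ (h.inner_tangentCoordChange hx (mem_chart_source _ x) v w)
    exact congrArg (fun f : ℝ →ₗ[ℝ] ℝ => f _)
      (Bundle.Trivial.linearMapAt_trivialization ℝ X ℝ x)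

theorem HasEuclideanTransitions.metricMatrix_eq_one (h : HasEuclideanTransitions n X)
    [IsManifold (𝓡 n) ∞ X] {φ : OpenPartialHomeomorph X (EuclideanSpace ℝ (Fin n))}
    (hφ : φ ∈ atlas (EuclideanSpace ℝ (Fin n)) X) {y : EuclideanSpace ℝ (Fin n)}
    (hy : y ∈ φ.target) : metricMatrix h.metric φ y = 1 := by
  obtain ⟨T, hT⟩ := h φ hφ _ (chart_mem_atlas _ (φ.symm y)) y hy (mem_chart_source _ _)
  have hd : MDifferentiableAt (𝓡 n) (𝓡 n) φ.symm y :=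
    mdifferentiableAt_atlas_symm hφ hy
  have hm : ∀ v : EuclideanSpace ℝ (Fin n),
      mfderiv (𝓡 n) (𝓡 n) φ.symm y v = T.linearIsometryEquiv v := by
    intro v
    rw [hd.mfderiv]
    simp only [mfld_simps, fderivWithin_univ]
    exact congrArg (fun f : EuclideanSpace ℝ (Fin n) →L[ℝ] EuclideanSpace ℝ (Fin n) => f v)
      ((hasFDerivAt_affineIsometryEquiv T _).congr_of_eventuallyEq hT).fderiv
  ext i j
  rw [metricMatrix, Matrix.of_apply, hm, hm]
  refine (T.linearIsometryEquiv.inner_map_map _ _).trans ?_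
  simp [EuclideanSpace.inner_single_left, Matrix.one_apply]

/-- The curvature of a locally constant metric vanishes. -/
theorem riemannTensor_eq_zero {G : EuclideanSpace ℝ (Fin n) → Matrix (Fin n) (Fin n) ℝ}
    {A : Matrix (Fin n) (Fin n) ℝ} {y : EuclideanSpace ℝ (Fin n)} (hG : G =ᶠ[𝓝 y] fun _ => A)
    (l i j k : Fin n) : riemannTensor G l i j k y = 0 := by
  have hc : ∀ l i j, christoffel G l i j =ᶠ[𝓝 y] fun _ => 0 := by
    intro l i j
    filter_upwards [hG.eventuallyEq_nhds] with z hz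
    have hp : ∀ i j k, partialDeriv i (fun z => G z j k) z = 0 := by
      intro i j k
      have : (fun z => G z j k) =ᶠ[𝓝 z] fun _ => A j k := by
        filter_upwards [hz] with w hw
        rw [hw]
      rw [partialDeriv, this.fderiv_eq]
      simp
    simp [christoffel, hp]
  have hp : ∀ l i j k, partialDeriv k (christoffel G l i j) y = 0 := by
    intro l i j k
    rw [partialDeriv, (hc l i j).fderiv_eq]
    simp
  simp [riemannTensor, hp, (hc _ _ _).eq_of_nhds]

theorem HasEuclideanTransitions.isFlat_metric (h : HasEuclideanTransitions n X)
    [IsManifold (𝓡 n) ∞ X] : IsFlat h.metric := by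
  intro φ hφ y hy u v _
  have hG : metricMatrix h.metric φ =ᶠ[𝓝 y] fun _ => 1 := by
    filter_upwards [φ.open_target.mem_nhds hy] with z hz using h.metricMatrix_eq_one hφ hz
  simp [sectionalCurvature, riemannTensor_eq_zero hG]

section Quotient

variable {Γ : Type} [Group Γ] [MulAction Γ (EuclideanSpace ℝ (Fin n))]

/-- The atlas whose charts are all local sections of a local homeomorphism `p : ℝⁿ → Y`. -/
@[reducible] def sectionChartedSpace {Y : Type} [TopologicalSpace Y]
    {p : EuclideanSpace ℝ (Fin n) → Y} (hp : IsLocalHomeomorph p) (hs : Function.Surjective p) :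
    ChartedSpace (EuclideanSpace ℝ (Fin n)) Y where
  atlas := {φ | ∀ y ∈ φ.target, φ.symm y = p y}
  chartAt x := (hp (Function.surjInv hs x)).choose.symm
  mem_chart_source x := by
    obtain ⟨h1, h2⟩ := (hp (Function.surjInv hs x)).choose_spec
    have := OpenPartialHomeomorph.map_source _ h1
    rw [← h2, Function.surjInv_eq hs x] at this
    exact this
  chart_mem_atlas x y _ := by
    obtain ⟨h1, h2⟩ := (hp (Function.surjInv hs x)).choose_spec
    rw [OpenPartialHomeomorph.symm_symm]
    exact congrFun h2.symm y

/-- Two local sections of the covering differ locally by an element of the group. -/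
theorem hasEuclideanTransitions_of_isQuotientCoveringMap {Y : Type} [TopologicalSpace Y]
    {p : EuclideanSpace ℝ (Fin n) → Y} (hp : IsQuotientCoveringMap p Γ)
    (hisom : ∀ γ : Γ, ∃ T : EuclideanSpace ℝ (Fin n) ≃ᵃⁱ[ℝ] EuclideanSpace ℝ (Fin n),
      ∀ x, γ • x = T x) :
    letI := sectionChartedSpace hp.isCoveringMap.isLocalHomeomorph hp.surjective
    HasEuclideanTransitions n Y := by
  let _ := sectionChartedSpace hp.isCoveringMap.isLocalHomeomorph hp.surjective
  intro φ hφ ψ hψ y hy hyψ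
  have hφ' : ∀ y ∈ φ.target, φ.symm y = p y := hφ
  have hψ' : ∀ y ∈ ψ.target, ψ.symm y = p y := hψ
  have h1 : p (ψ (φ.symm y)) = p y := by
    rw [← hψ' _ (ψ.map_source hyψ), ψ.left_inv hyψ, hφ' y hy]
  obtain ⟨γ, hγ⟩ := hp.apply_eq_iff_mem_orbit.1 h1
  obtain ⟨T, hT⟩ := hisom γ
  refine ⟨T, ?_⟩
  have hγ' : T y = ψ (φ.symm y) := by rw [← hT]; exact hγ
  have hnear : ∀ᶠ z in 𝓝 y, T z ∈ ψ.target :=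
    T.continuous.continuousAt.eventually_mem
      (ψ.open_target.mem_nhds (by rw [hγ']; exact ψ.map_source hyψ))
  filter_upwards [hnear, φ.open_target.mem_nhds hy] with z hz hzφ
  rw [Function.comp_apply, hφ' z hzφ, ← hp.map_smul γ, hT, ← hψ' _ hz, ψ.right_inv hz]

/-- Cover the two compact sets by finitely many balls of radius `δ / 4`: at most one group element
moves a point of a given ball into another given ball. -/
theorem properlyDiscontinuous {δ : ℝ} (hδ : 0 < δ)
    (hisom : ∀ γ : Γ, ∃ T : EuclideanSpace ℝ (Fin n) ≃ᵃⁱ[ℝ] EuclideanSpace ℝ (Fin n),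
      ∀ x, γ • x = T x)
    (hdisp : ∀ γ : Γ, γ ≠ 1 → ∀ x : EuclideanSpace ℝ (Fin n), δ ≤ dist x (γ • x)) :
    ProperlyDiscontinuousSMul Γ (EuclideanSpace ℝ (Fin n)) where
  finite_disjoint_inter_image {K L} hK hL := by
    have hdist : ∀ (γ : Γ) (x y : EuclideanSpace ℝ (Fin n)), dist (γ • x) (γ • y) = dist x y := by
      intro γ x y
      obtain ⟨T, hT⟩ := hisom γ
      rw [hT, hT, T.dist_map]
    obtain ⟨s, hsK, hs, hKs⟩ := hK.finite_cover_balls (e := δ / 4) (by positivity)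
    obtain ⟨t, htL, ht, hLt⟩ := hL.finite_cover_balls (e := δ / 4) (by positivity)
    classical
    refine Set.Finite.subset ((hs.prod ht).biUnion (t := fun q => {γ : Γ |
      ∃ x ∈ Metric.ball q.1 (δ / 4), γ • x ∈ Metric.ball q.2 (δ / 4)}) ?_) ?_
    · rintro ⟨q, r⟩ -
      refine Set.Subsingleton.finite ?_
      rintro γ ⟨x, hx, hγx⟩ γ' ⟨x', hx', hγx'⟩
      by_contra hne
      have h1 := hdisp (γ⁻¹ * γ') (by simpa [inv_mul_eq_one] using hne) x'
      rw [← hdist γ, ← mul_smul, mul_inv_cancel_left] at h1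
      rw [Metric.mem_ball] at hx hx' hγx hγx'
      have h2 := dist_triangle4 (γ • x') (γ • x) r (γ' • x')
      rw [hdist] at h2
      have h3 := dist_triangle_right x' x q
      have h4 := dist_comm r (γ' • x')
      linarith
    · rintro γ ⟨y, ⟨x, hx, rfl⟩, hy⟩
      obtain ⟨q, hq, hxq⟩ := Set.mem_iUnion₂.1 (hKs hx)
      obtain ⟨r, hr, hyr⟩ := Set.mem_iUnion₂.1 (hLt hy)
      exact Set.mem_biUnion (x := (q, r)) ⟨hq, hr⟩ ⟨x, hxq, hyr⟩

/-- A group of isometries of `ℝⁿ` whose elements `γ ≠ 1` move all points by at least `δ > 0`, and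
whose orbits all meet a fixed ball, acts freely and properly discontinuously with compact
quotient. The quotient is a flat manifold. -/
theorem exists_flatManifold {δ R : ℝ} (hδ : 0 < δ)
    (hisom : ∀ γ : Γ, ∃ T : EuclideanSpace ℝ (Fin n) ≃ᵃⁱ[ℝ] EuclideanSpace ℝ (Fin n),
      ∀ x, γ • x = T x)
    (hdisp : ∀ γ : Γ, γ ≠ 1 → ∀ x : EuclideanSpace ℝ (Fin n), δ ≤ dist x (γ • x))
    (hR : ∀ x : EuclideanSpace ℝ (Fin n), ∃ γ : Γ, ‖γ • x‖ ≤ R) :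
    ∃ (X : FlatManifold n) (p : EuclideanSpace ℝ (Fin n) → X.carrier),
      IsQuotientCoveringMap p Γ := by
  have := properlyDiscontinuous hδ hisom hdisp
  have : IsCancelSMul Γ (EuclideanSpace ℝ (Fin n)) :=
    isCancelSMul_iff_eq_one_of_smul_eq.2 fun γ x hγ => by
      by_contra hne
      have := hdisp γ hne x
      rw [hγ, dist_self] at this
      linarith
  have : ContinuousConstSMul Γ (EuclideanSpace ℝ (Fin n)) := ⟨fun γ => by
    obtain ⟨T, hT⟩ := hisom γ
    simpa only [hT] using T.continuous⟩
  let Y := Quotient (MulAction.orbitRel Γ (EuclideanSpace ℝ (Fin n)))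
  let p : EuclideanSpace ℝ (Fin n) → Y := Quotient.mk _
  have hp : IsQuotientCoveringMap p Γ :=
    isQuotientCoveringMap_quotientMk_of_properlyDiscontinuousSMul
  let _ := sectionChartedSpace hp.isCoveringMap.isLocalHomeomorph hp.surjective
  have hE : HasEuclideanTransitions n Y := hasEuclideanTransitions_of_isQuotientCoveringMap hp hisom
  have := hE.isManifold
  have : T2Space Y := inferInstance
  have : CompactSpace Y := ⟨by
    have hc := (ProperSpace.isCompact_closedBall (0 : EuclideanSpace ℝ (Fin n)) R).image
      hp.continuous
    convert hc
    refine (Set.eq_univ_of_forall fun y => ?_).symm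
    obtain ⟨x, rfl⟩ := hp.surjective y
    obtain ⟨γ, hγ⟩ := hR x
    exact ⟨γ • x, by simpa using hγ, hp.map_smul γ⟩⟩
  have : ConnectedSpace Y := hp.surjective.connectedSpace hp.continuous
  exact ⟨{ carrier := Y, metric := hE.metric, flat := hE.isFlat_metric }, p, hp⟩

end Quotient

end Euclidean

end FlatQuat

namespace FlatQuat

open groupCohomology

/-! ### The Bieberbach group -/

section Bieberbach

/-- The three components of a vector in `M ⊕ M^{f₂} ⊕ M^{f₃}`. -/
def component (l : (Fin 16 → ℤ) × (Fin 16 → ℤ) × (Fin 16 → ℤ)) : Fin 3 → Fin 16 → ℤ :=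
  ![l.1, l.2.1, l.2.2]

theorem component_add (l m : (Fin 16 → ℤ) × (Fin 16 → ℤ) × (Fin 16 → ℤ)) (j : Fin 3) :
    component (l + m) j = component l j + component m j := by
  fin_cases j <;> rfl

theorem component_zero (j : Fin 3) : component 0 j = 0 := by fin_cases j <;> rfl

theorem component_injective : Function.Injective component := by
  intro l m h
  exact Prod.ext (congrFun h 0) (Prod.ext (congrFun h 1) (congrFun h 2))

variable (f₂ f₃ : MulAut G64)

/-- The automorphism by which `G` acts on the component with a given index. -/
def componentAut : Fin 3 → MulAut G64 := ![1, f₂, f₃]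

variable {f₂ f₃}

theorem component_tripleRep (g : G64) (l : (Fin 16 → ℤ) × (Fin 16 → ℤ) × (Fin 16 → ℤ)) (j : Fin 3) :
    component (tripleRep latticeRep f₂ f₃ g l) j =
      signedAct (componentAut f₂ f₃ j g) (component l j) := by
  fin_cases j <;> rfl

variable (f₂ f₃) in
/-- The extension of `G64` by `M ⊕ M^{f₂} ⊕ M^{f₃}` that belongs to the class
`α + f₂*(α) + f₃*(α)`. -/
abbrev BieberbachGroup : Type := CocycleExtension (totalCocycle f₂ f₃ latticeCocycle₂)

theorem component_val (g h : G64) (j : Fin 3) :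
    component (CocycleExtension.val (totalCocycle f₂ f₃ latticeCocycle₂) g h) j =
      latticeCocycle₂Fun (componentAut f₂ f₃ j g) (componentAut f₂ f₃ j h) := by
  fin_cases j <;> rfl

theorem val_one_one : CocycleExtension.val (totalCocycle f₂ f₃ latticeCocycle₂) 1 1 = 0 := by
  refine component_injective (funext fun j => ?_)
  rw [component_val, map_one, latticeCocycle₂Fun_one_one, component_zero]

/-- The index of the coordinate `k` of the component `j` in `ℝ⁴⁸`. -/
def coordIndex (j : Fin 3) (k : Fin 16) : Fin 48 := finProdFinEquiv (j, k)

theorem euclidean_ext {x y : EuclideanSpace ℝ (Fin 48)}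
    (h : ∀ j k, x (coordIndex j k) = y (coordIndex j k)) :
    x = y := by
  ext i
  obtain ⟨⟨j, k⟩, rfl⟩ := (finProdFinEquiv (m := 3) (n := 16)).surjective i
  exact h j k

/-- The element `(l, g)` acts on each component of `ℝ⁴⁸` by `x ↦ l + g x + s(g)`, where `g` acts
through the automorphism of the component and `s` is the lift of `α̂` to `ℚ¹⁶` with entries in
`{0, 1/2}`. As the 2-cocycle is the coboundary of `s`, this is an action. -/
def affineAct (γ : BieberbachGroup f₂ f₃) (x : EuclideanSpace ℝ (Fin 48)) :
    EuclideanSpace ℝ (Fin 48) :=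
  WithLp.toLp 2 fun i =>
    let p : Fin 3 × Fin 16 := (finProdFinEquiv (m := 3) (n := 16)).symm i
    component γ.left p.1 p.2 +
      signedAct (componentAut f₂ f₃ p.1 γ.right) (fun k => x (coordIndex p.1 k)) p.2 +
      (doubleLift (componentAut f₂ f₃ p.1 γ.right) p.2 : ℝ) / 2

theorem affineAct_apply (γ : BieberbachGroup f₂ f₃) (x : EuclideanSpace ℝ (Fin 48)) (j : Fin 3)
    (k : Fin 16) : affineAct γ x (coordIndex j k) = component γ.left j k +
      signedAct (componentAut f₂ f₃ j γ.right) (fun k => x (coordIndex j k)) k +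
      (doubleLift (componentAut f₂ f₃ j γ.right) k : ℝ) / 2 := by
  simp [affineAct, coordIndex]

instance : MulAction (BieberbachGroup f₂ f₃) (EuclideanSpace ℝ (Fin 48)) where
  smul := affineAct
  one_smul x := by
    change affineAct 1 x = x
    refine euclidean_ext fun j k => ?_
    rw [affineAct_apply, CocycleExtension.one_left, val_one_one, neg_zero, component_zero,
      CocycleExtension.one_right, map_one, signedAct_one]
    simp [doubleLift]
  mul_smul γ γ' x := by
    change affineAct (γ * γ') x = affineAct γ (affineAct γ' x)
    refine euclidean_ext fun j k => ?_
    simp only [affineAct_apply, CocycleExtension.mul_left, CocycleExtension.mul_right, map_mul,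
      signedAct_mul, component_add, component_tripleRep, component_val, Pi.add_apply]
    have h := congrArg (Int.cast : ℤ → ℝ) (two_mul_latticeCocycle₂Fun
      (componentAut f₂ f₃ j γ.right) (componentAut f₂ f₃ j γ'.right) k)
    simp only [signedAct_apply, zsmul_eq_mul, smul_eq_mul] at h ⊢
    push_cast at h ⊢
    linear_combination h / 2

theorem bieberbach_smul_apply (γ : BieberbachGroup f₂ f₃) (x : EuclideanSpace ℝ (Fin 48))
    (j : Fin 3) (k : Fin 16) : (γ • x) (coordIndex j k) = component γ.left j k +
      signedAct (componentAut f₂ f₃ j γ.right) (fun k => x (coordIndex j k)) k +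
      (doubleLift (componentAut f₂ f₃ j γ.right) k : ℝ) / 2 := affineAct_apply γ x j k

theorem inl_smul_apply (l : (Fin 16 → ℤ) × (Fin 16 → ℤ) × (Fin 16 → ℤ))
    (x : EuclideanSpace ℝ (Fin 48)) (j : Fin 3) (k : Fin 16) :
    (CocycleExtension.inl (totalCocycle f₂ f₃ latticeCocycle₂) (Multiplicative.ofAdd l) • x)
      (coordIndex j k) = component l j k + x (coordIndex j k) := by
  rw [bieberbach_smul_apply, CocycleExtension.inl_left, val_one_one, sub_zero,
    CocycleExtension.inl_right, map_one, signedAct_one]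
  simp [doubleLift]

theorem dist_sq_eq_sum (x y : EuclideanSpace ℝ (Fin 48)) :
    dist x y ^ 2 = ∑ j, ∑ k, (x (coordIndex j k) - y (coordIndex j k)) ^ 2 := by
  rw [EuclideanSpace.dist_eq, Real.sq_sqrt (Finset.sum_nonneg fun _ _ => sq_nonneg _),
    ← (finProdFinEquiv (m := 3) (n := 16)).sum_comp, Fintype.sum_prod_type]
  simp only [Real.dist_eq, sq_abs, coordIndex]

theorem isometry_smul (γ : BieberbachGroup f₂ f₃) :
    Isometry (fun x : EuclideanSpace ℝ (Fin 48) => γ • x) := by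
  refine Isometry.of_dist_eq fun x y => ?_
  rw [← sq_eq_sq₀ dist_nonneg dist_nonneg, dist_sq_eq_sum, dist_sq_eq_sum]
  refine Finset.sum_congr rfl fun j _ => ?_
  rw [← (src_bijective (componentAut f₂ f₃ j γ.right)).sum_comp
    fun k => (x (coordIndex j k) - y (coordIndex j k)) ^ 2]
  refine Finset.sum_congr rfl fun k _ => ?_
  rw [bieberbach_smul_apply, bieberbach_smul_apply, signedAct_apply, signedAct_apply]
  obtain h | h := Int.units_eq_one_or (sgn (componentAut f₂ f₃ j γ.right) k) <;> rw [h] <;>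
    simp only [Units.val_one, Units.val_neg, zsmul_eq_mul, Int.cast_neg, Int.cast_one] <;> ring

theorem exists_affineIsometryEquiv (γ : BieberbachGroup f₂ f₃) :
    ∃ T : EuclideanSpace ℝ (Fin 48) ≃ᵃⁱ[ℝ] EuclideanSpace ℝ (Fin 48), ∀ x, γ • x = T x :=
  ⟨(IsometryEquiv.mk (MulAction.toPerm γ) (isometry_smul γ)).toRealAffineIsometryEquiv,
    fun _ => rfl⟩

theorem exists_norm_smul_le (x : EuclideanSpace ℝ (Fin 48)) :
    ∃ γ : BieberbachGroup f₂ f₃, ‖γ • x‖ ≤ √48 := by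
  let l : Fin 3 → Fin 16 → ℤ := fun j k => -⌊x (coordIndex j k)⌋
  have hl : ∀ j, component (l 0, l 1, l 2) j = l j := fun j => by fin_cases j <;> rfl
  refine ⟨CocycleExtension.inl _ (Multiplicative.ofAdd (l 0, l 1, l 2)), ?_⟩
  refine Real.le_sqrt_of_sq_le ?_
  rw [← dist_zero_right, dist_sq_eq_sum]
  have h : ∀ j k, ((CocycleExtension.inl (totalCocycle f₂ f₃ latticeCocycle₂)
      (Multiplicative.ofAdd (l 0, l 1, l 2)) • x) (coordIndex j k) -
        (0 : EuclideanSpace ℝ (Fin 48)) (coordIndex j k)) ^ 2 ≤ 1 := by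
    intro j k
    rw [inl_smul_apply, hl]
    have h1 := Int.floor_le (x (coordIndex j k))
    have h2 := Int.lt_floor_add_one (x (coordIndex j k))
    simp only [l, Int.cast_neg, PiLp.zero_apply, sub_zero]
    nlinarith
  refine (Finset.sum_le_sum fun j _ => Finset.sum_le_sum fun k _ => h j k).trans ?_
  norm_num

theorem one_le_dist_inl_smul {l : (Fin 16 → ℤ) × (Fin 16 → ℤ) × (Fin 16 → ℤ)} (hl : l ≠ 0)
    (x : EuclideanSpace ℝ (Fin 48)) :
    1 ≤ dist x (CocycleExtension.inl (totalCocycle f₂ f₃ latticeCocycle₂)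
      (Multiplicative.ofAdd l) • x) := by
  obtain ⟨j, k, hjk⟩ : ∃ j k, component l j k ≠ 0 := by
    by_contra! h
    refine hl (component_injective (funext fun j => funext fun k => ?_))
    rw [h, component_zero, Pi.zero_apply]
  rw [← one_le_sq_iff₀ dist_nonneg, dist_sq_eq_sum]
  refine le_trans ?_ (Finset.single_le_sum
    (fun j _ => Finset.sum_nonneg fun k _ => sq_nonneg _) (Finset.mem_univ j))
  refine le_trans ?_ (Finset.single_le_sum (fun k _ => sq_nonneg _) (Finset.mem_univ k))
  rw [inl_smul_apply, one_le_sq_iff_one_le_abs]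
  have : (1 : ℝ) ≤ |(component l j k : ℝ)| := by
    exact_mod_cast Int.one_le_abs hjk
  rwa [show ∀ a b : ℝ, a - (b + a) = -b from fun a b => by ring, abs_neg]

/-- Let `z` be the involution over which `γ = (l, z)` lies. In the component on which `z` acts
through `a²`, the entries of `γ²` are `2 l + 1`, hence not zero. -/
theorem exists_sq_eq_inl (h₂ : ∀ g, chi₂ g = chi₁ (f₂ g)) (h₃ : ∀ g, chi₃ g = chi₁ (f₃ g))
    {γ : BieberbachGroup f₂ f₃} (h1 : γ.right ≠ 1) (hsq : γ.right ^ 2 = 1) :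
    ∃ l, l ≠ 0 ∧ γ ^ 2 = CocycleExtension.inl _ (Multiplicative.ofAdd l) := by
  refine ⟨_, ?_, CocycleExtension.eq_inl_iff.2
    ⟨by rw [pow_two, CocycleExtension.mul_right, ← pow_two, hsq], rfl⟩⟩
  intro h0
  rw [val_one_one, add_zero, pow_two, CocycleExtension.mul_left] at h0
  have key : ∀ j, componentAut f₂ f₃ j γ.right = G64.a ^ 2 → False := by
    intro j hj
    have h := congrArg (fun l => component l j 0) h0
    simp only [component_add, component_tripleRep, component_val, hj, latticeCocycle₂Fun_a_sq,
      ← latticeRep_apply, latticeRep_a_sq, component_zero, Pi.add_apply, Pi.one_apply,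
      Pi.zero_apply] at h
    omega
  obtain h | h | h | h := G64.eq_of_sq_eq_one hsq
  · exact h1 h
  · exact key 0 h
  · exact key 1 (by rw [h] at h1 ⊢; exact G64.mulAut_apply_eq_a_sq h1 h₂)
  · exact key 2 (by rw [h] at h1 ⊢; exact G64.mulAut_apply_eq_a_sq h1 h₃)

/-- The quotient `G64` has exponent four, and each of its non-trivial cyclic subgroups contains an
involution, to which `exists_sq_eq_inl` applies. -/
theorem exists_pow_four_eq_inl (h₂ : ∀ g, chi₂ g = chi₁ (f₂ g)) (h₃ : ∀ g, chi₃ g = chi₁ (f₃ g))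
    {γ : BieberbachGroup f₂ f₃} (hγ : γ ≠ 1) :
    ∃ l, l ≠ 0 ∧ γ ^ 4 = CocycleExtension.inl _ (Multiplicative.ofAdd l) := by
  have hpow : ∀ (l : (Fin 16 → ℤ) × (Fin 16 → ℤ) × (Fin 16 → ℤ)) (n : ℕ), n ≠ 0 → l ≠ 0 →
      ∃ m, m ≠ 0 ∧ (CocycleExtension.inl (totalCocycle f₂ f₃ latticeCocycle₂)
        (Multiplicative.ofAdd l)) ^ n = CocycleExtension.inl _ (Multiplicative.ofAdd m) :=
    fun l n hn hl => ⟨n • l, smul_ne_zero hn hl, by rw [ofAdd_nsmul, map_pow]⟩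
  by_cases h1 : γ.right = 1
  · have e := CocycleExtension.eq_inl_iff.2 ⟨h1, rfl⟩
    obtain ⟨m, hm, hm'⟩ := hpow (γ.left + CocycleExtension.val
      (totalCocycle f₂ f₃ latticeCocycle₂) 1 1) 4 (by norm_num) (by
        intro h
        rw [h, ofAdd_zero, map_one] at e
        exact hγ e)
    exact ⟨m, hm, by rw [← hm', ← e]⟩
  · by_cases h2 : γ.right ^ 2 = 1
    · obtain ⟨l, hl, hl'⟩ := exists_sq_eq_inl h₂ h₃ h1 h2
      obtain ⟨m, hm, hm'⟩ := hpow l 2 two_ne_zero hl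
      exact ⟨m, hm, by rw [← hm', ← hl', ← pow_mul]⟩
    · have e : (γ ^ 2).right = γ.right ^ 2 := by rw [pow_two, pow_two, CocycleExtension.mul_right]
      obtain ⟨l, hl, hl'⟩ := exists_sq_eq_inl h₂ h₃ (γ := γ ^ 2) (by rwa [e])
        (by rw [e, ← pow_mul, G64.pow_four_eq_one])
      exact ⟨l, hl, by rw [← hl', ← pow_mul]⟩

theorem isTorsionFreeGroup_bieberbachGroup (h₂ : ∀ g, chi₂ g = chi₁ (f₂ g))
    (h₃ : ∀ g, chi₃ g = chi₁ (f₃ g)) : IsTorsionFreeGroup (BieberbachGroup f₂ f₃) := by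
  intro γ hγ
  by_contra hne
  obtain ⟨l, hl, hl'⟩ := exists_pow_four_eq_inl h₂ h₃ hne
  obtain ⟨n, hn, hn'⟩ := isOfFinOrder_iff_pow_eq_one.1 (hγ.pow (n := 4))
  rw [hl', ← map_pow, ← ofAdd_nsmul] at hn'
  have := (CocycleExtension.groupExtension (totalCocycle f₂ f₃ latticeCocycle₂)).inl_injective
    (hn'.trans (map_one (CocycleExtension.inl (totalCocycle f₂ f₃ latticeCocycle₂))).symm)
  exact smul_ne_zero hn.ne' hl this

/-- Iterating an isometry moves a point at most proportionally to the number of steps. -/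
theorem dist_le_mul_dist_smul (γ : BieberbachGroup f₂ f₃) (x : EuclideanSpace ℝ (Fin 48)) (n : ℕ) :
    dist x (γ ^ n • x) ≤ n * dist x (γ • x) := by
  induction n with
  | zero => simp
  | succ n ih =>
    have h : dist (γ • x) (γ ^ (n + 1) • x) = dist x (γ ^ n • x) := by
      rw [pow_succ', mul_smul]
      exact (isometry_smul γ).dist_eq _ _
    have := dist_triangle x (γ • x) (γ ^ (n + 1) • x)
    push_cast
    linarith

theorem le_dist_smul (h₂ : ∀ g, chi₂ g = chi₁ (f₂ g)) (h₃ : ∀ g, chi₃ g = chi₁ (f₃ g))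
    {γ : BieberbachGroup f₂ f₃} (hγ : γ ≠ 1) (x : EuclideanSpace ℝ (Fin 48)) :
    1 / 4 ≤ dist x (γ • x) := by
  obtain ⟨l, hl, hl'⟩ := exists_pow_four_eq_inl h₂ h₃ hγ
  have h1 := dist_le_mul_dist_smul γ x 4
  have h2 := one_le_dist_inl_smul (f₂ := f₂) (f₃ := f₃) hl x
  rw [← hl'] at h2
  push_cast at h1
  linarith

theorem trace_tripleRep (h₂ : ∀ g, chi₂ g = chi₁ (f₂ g)) (h₃ : ∀ g, chi₃ g = chi₁ (f₃ g))
    (g : G64) : LinearMap.trace ℤ _ (tripleRep latticeRep f₂ f₃ g) =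
      4 * (chi₁ g + chi₂ g + chi₃ g) := by
  have h := LinearMap.trace_prodMap' (latticeRep g)
    ((latticeRep (f₂ g)).prodMap (latticeRep (f₃ g)))
  have h' := LinearMap.trace_prodMap' (latticeRep (f₂ g)) (latticeRep (f₃ g))
  rw [trace_latticeRep, trace_latticeRep, ← h₂, ← h₃] at h'
  rw [trace_latticeRep, h'] at h
  refine h.trans ?_
  ring

/-- The holonomy representation is faithful: the intersection of the kernels `{χ_i = 4}` is
trivial. -/
theorem eq_one_of_tripleRep_eq_one (h₂ : ∀ g, chi₂ g = chi₁ (f₂ g)) (h₃ : ∀ g, chi₃ g = chi₁ (f₃ g))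
    {g : G64} (hg : tripleRep latticeRep f₂ f₃ g = 1) : g = 1 := by
  have h1 := trace_tripleRep h₂ h₃ g
  rw [hg, ← map_one (tripleRep latticeRep f₂ f₃), trace_tripleRep h₂ h₃] at h1
  have h4 : ∀ z, chi z 1 = 4 ∧ chi z g ≤ 4 := by
    intro z
    refine ⟨by simp [chi], ?_⟩
    unfold chi
    split_ifs <;> norm_num
  simp only [chi₁, chi₂, chi₃, (h4 _).1] at h1
  have ha := (h4 (G64.a ^ 2)).2
  have hb := (h4 (G64.b ^ 2)).2
  have hab := (h4 (G64.a ^ 2 * G64.b ^ 2)).2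
  have key : ∀ z, chi z g = 4 → g = 1 ∨ g = z := by
    intro z hz
    unfold chi at hz
    split_ifs at hz with h
    · exact h
    · norm_num at hz
  obtain h | h := key (G64.a ^ 2) (by omega)
  · exact h
  obtain h' | h' := key (G64.b ^ 2) (by omega)
  · exact h'
  have := congrArg G64.equivModel (h.symm.trans h')
  rw [G64.equivModel_a_sq, G64.equivModel_b_sq] at this
  exact absurd this (by decide)

theorem exists_flatManifold_bieberbachGroup (h₂ : ∀ g, chi₂ g = chi₁ (f₂ g))
    (h₃ : ∀ g, chi₃ g = chi₁ (f₃ g)) : ∃ X : FlatManifold 48, ∀ x : X.carrier,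
      Nonempty (BieberbachGroup f₂ f₃ ≃* FundamentalGroup X.carrier x) := by
  obtain ⟨X, p, hp⟩ := exists_flatManifold (Γ := BieberbachGroup f₂ f₃) (δ := 1 / 4) (R := √48)
    (by norm_num) exists_affineIsometryEquiv (fun γ hγ x => le_dist_smul h₂ h₃ hγ x)
    exists_norm_smul_le
  refine ⟨X, fun x => ?_⟩
  obtain ⟨e, he⟩ := hp.surjective x
  -- the fundamental group is the opposite of the group of the covering
  exact ⟨(MulEquiv.inv' _).trans (hp.fundamentalGroupEquiv ⟨e, he⟩).symm⟩

theorem exists_flatManifold_hasClass (h₂ : ∀ g, chi₂ g = chi₁ (f₂ g))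
    (h₃ : ∀ g, chi₃ g = chi₁ (f₃ g)) : ∃ X : FlatManifold 48, ∀ x : X.carrier,
      IsTorsionFreeGroup (FundamentalGroup X.carrier x) ∧
      ∃ S : GroupExtension (Multiplicative ((Fin 16 → ℤ) × (Fin 16 → ℤ) × (Fin 16 → ℤ)))
          (FundamentalGroup X.carrier x) G64,
        IsTranslationSubgroup S.inl.range ∧
        InducesAction S (tripleRep latticeRep f₂ f₃) ∧
        HasClass S (totalClass f₂ f₃ (H2π _ latticeCocycle₂)) := by
  obtain ⟨X, hX⟩ := exists_flatManifold_bieberbachGroup h₂ h₃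
  refine ⟨X, fun x => ?_⟩
  obtain ⟨e⟩ := hX x
  have h := (CocycleExtension.inducesAction (totalCocycle f₂ f₃ latticeCocycle₂)).map e
  refine ⟨fun γ hγ => ?_, _,
    h.isTranslationSubgroup fun g => eq_one_of_tripleRep_eq_one h₂ h₃, h, ?_⟩
  · have h1 := isTorsionFreeGroup_bieberbachGroup h₂ h₃ (e.symm γ)
      (e.symm.toMonoidHom.isOfFinOrder hγ)
    exact e.symm.map_eq_one_iff.1 h1
  · rw [totalClass_H2π]
    exact (CocycleExtension.hasClass _).map e

end Bieberbach

end FlatQuat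

end

open FlatQuat
theorem theorem1 :
    -- the group
    (Nat.card G64 = 64 ∧
      orderOf G64.a = 4 ∧ orderOf G64.b = 4 ∧ orderOf G64.c = 4 ∧ orderOf G64.d = 4 ∧
      Subgroup.center G64 = Subgroup.closure {G64.a ^ 2, G64.b ^ 2} ∧
      Nonempty (Subgroup.center G64 ≃* Multiplicative (Fin 2 → ZMod 2)) ∧
      Nonempty (G64 ⧸ Subgroup.center G64 ≃* Multiplicative (Fin 4 → ZMod 2))) ∧
    -- the automorphisms
    (∃ f₂ : MulAut G64, ∀ g, chi₂ g = chi₁ (f₂ g)) ∧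
    (∃ f₃ : MulAut G64, ∀ g, chi₃ g = chi₁ (f₃ g)) ∧
    -- the permutation module, the lattice in it, and the cocycle
    ∃ (ρ₁ : Representation ℤ G64 (Fin 32 → ℤ)) (ρM : Representation ℤ G64 (Fin 16 → ℤ))
      (αhat : G64 → Fin 16 → AddCircle (1 : ℚ)) (α : groupCohomology.H2 (Rep.of ρM)),
      (∀ i, ρ₁ (PresentedGroup.of i) = Matrix.toLin' (permRepGen i)) ∧
      Nonempty (ρ₁.Equiv
        (Representation.ofMulAction ℤ G64 (G64 ⧸ Subgroup.zpowers (G64.a ^ 2)))) ∧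
      (∀ i, ρM (PresentedGroup.of i) = Matrix.toLin' (latticeRepGen i)) ∧
      (∀ g, LinearMap.trace ℤ _ (ρM g) = 4 * chi₁ g) ∧
      Function.Injective latticeIncl ∧
      (∀ g x, latticeIncl (ρM g x) = ρ₁ g (latticeIncl x)) ∧
      (∀ v, v ∈ LinearMap.range latticeIncl ↔
        ∃ (n : ℤ) (w : Fin 32 → ℤ), n ≠ 0 ∧ n • v = (∑ᶠ g, chi₁ g • ρ₁ g) w) ∧
      IsCocycle ρM αhat ∧
      (∀ i, αhat (PresentedGroup.of i) = cocycleGen i) ∧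
      IsConnectingImage ρM αhat α ∧
      -- the extension class and the type of the summands
      ∀ f₂ f₃ : MulAut G64, (∀ g, chi₂ g = chi₁ (f₂ g)) → (∀ g, chi₃ g = chi₁ (f₃ g)) →
        IsSpecial (totalClass f₂ f₃ α) ∧
        Module.finrank ℤ ((Fin 16 → ℤ) × (Fin 16 → ℤ) × (Fin 16 → ℤ)) = 48 ∧
        (∀ g, LinearMap.trace ℤ _ (tripleRep ρM f₂ f₃ g) = 4 * (chi₁ g + chi₂ g + chi₃ g)) ∧
        IsOfQuaternionicType (extendScalars ℝ (tripleRep ρM f₂ f₃)) ∧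
        (∀ U : Subrepresentation (extendScalars ℂ (tripleRep ρM f₂ f₃)),
          U.toRepresentation.IsIrreducible → frobeniusSchur U.toRepresentation = -1) ∧
        -- the flat manifold with this holonomy representation
        ∃ X : FlatManifold 48, ∀ x : X.carrier,
          IsTorsionFreeGroup (FundamentalGroup X.carrier x) ∧
          ∃ S : GroupExtension (Multiplicative ((Fin 16 → ℤ) × (Fin 16 → ℤ) × (Fin 16 → ℤ)))
              (FundamentalGroup X.carrier x) G64,
            IsTranslationSubgroup S.inl.range ∧
            InducesAction S (tripleRep ρM f₂ f₃) ∧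
            HasClass S (totalClass f₂ f₃ α) := by
  refine ⟨⟨G64.card_eq, G64.orderOf_generator 0, G64.orderOf_generator 1, G64.orderOf_generator 2,
    G64.orderOf_generator 3, G64.center_eq_closure, G64.nonempty_center_equiv,
    G64.nonempty_quotient_center_equiv⟩, G64.exists_mulAut_chi₂, G64.exists_mulAut_chi₃, permRep,
    latticeRep, latticeCocycle, groupCohomology.H2π _ latticeCocycle₂, permRep_of,
    nonempty_permRep_equiv, latticeRep_of, trace_latticeRep, latticeIncl_injective,
    latticeIncl_latticeRep, mem_range_latticeIncl_iff, isCocycle_latticeCocycle, latticeCocycle_of,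
    isConnectingImage_latticeCocycle₂, fun f₂ f₃ h₂ h₃ => ⟨isSpecial_totalClass h₂ h₃, ?_,
    trace_tripleRep h₂ h₃, isOfQuaternionicType_tripleRep f₂ f₃, frobeniusSchur_tripleRep f₂ f₃,
    exists_flatManifold_hasClass h₂ h₃⟩⟩
  simp only [Module.finrank_prod, Module.finrank_fin_fun]
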